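/- Let $d\ge 2$ be an integer, let $\nu\ge -1$ and $\gamma>0$ be real numbers, and let $\zeta$ be a Poisson point process on $\mathbb{R}^{d-1}\times\mathbb{R}$ whose intensity measure has the density $(v,h)\mapsto \gamma(2\pi)^{-d/2}e^{h/2}$ with respect to Lebesgue measure. For a set $X\subset\mathbb{R}^{d-1}\times\mathbb{R}$ and $x=(v,W)$ put $\operatorname{pow}(w,x)=\|w-v\|^2+W$ and let $C(x,X)=\{w\in\mathbb{R}^{d-1}:\operatorname{pow}(w,x)\le \operatorname{pow}(w,x')\text{ for all }x'\in X\}$ be the Laguerre cell of $x$. Let $\zeta^*$ be the set of all points $(z,-K_z)$, where $z$ runs through the vertices of the Laguerre cells $C(x,\zeta)$, $x\in\zeta$, that have non-empty interior, and $K_z=\min_{x\in\zeta}\operatorname{pow}(z,x)$. (The Laguerre cells of $\zeta^*$ are almost surely the cells of the Gaussian-Delaunay tessellation, i.e. of the tessellation dual to the Laguerre tessellation of $\zeta$.) On the space $\mathcal{C}'$ of non-empty compact subsets of $\mathbb{R}^{d-1}$ with the Hausdorff metric, the distribution $\mathbb{P}_\nu$ of the $\operatorname{Vol}^\nu$-weighted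 typical cell $Z_\nu$ of the Gaussian-Delaunay tessellation is given by $$\mathbb{P}_\nu(A)=\frac1{\lambda_\nu}\,\mathbb{E}\sum_{(v,h)\in\zeta^*}\mathbf 1(M_{v,h}\in A)\,\mathbf 1_{[0,1]^{d-1}}(v)\operatorname{Vol}(M_{v,h})^\nu,\qquad \lambda_\nu=\mathbb{E}\sum_{(v,h)\in\zeta^*}\mathbf 1_{[0,1]^{d-1}}(v)\operatorname{Vol}(M_{v,h})^\nu,$$ where $M_{v,h}=C((v,h),\zeta^*)-v$. Write $\Delta_{d-1}(y_1,\ldots,y_d)$ for the $(d-1)$-dimensional volume of $\operatorname{conv}(y_1,\ldots,y_d)$. Then $0<\lambda_\nu<\infty$, the function $$f(y_1,\ldots,y_d)=\widehat\alpha_{d,\nu}\,\Delta_{d-1}(y_1,\ldots,y_d)^{\nu+1}\prod_{i=1}^d e^{-\|y_i\|^2/2},\qquad \widehat\alpha_{d,\nu}=\frac{1}{2^{\frac{(d-1)(d+\nu+1)}2}\pi^{\frac{d(d-1)}2}}\,\frac{((d-1)!)^{\nu+1}}{d^{\frac{\nu+1}2}}\prod_{j=1}^{d-1}\frac{\Gamma(\frac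 j2)}{\Gamma(\frac{j+\nu+1}2)},$$ is a probability density on $(\mathbb{R}^{d-1})^d$, and for every Borel set $A\subset\mathcal{C}'$ $$\mathbb{P}_\nu(A)=\int_{(\mathbb{R}^{d-1})^d}\mathbf 1_A(\operatorname{conv}(y_1,\ldots,y_d))\,f(y_1,\ldots,y_d)\,\mathrm d(y_1,\ldots,y_d).$$ That is, $Z_\nu$ has the distribution of $\operatorname{conv}(Y_1,\ldots,Y_d)$, where $(Y_1,\ldots,Y_d)$ has joint density $f$; in particular the law of $Z_\nu$ does not depend on $\gamma$. -/

import Mathlib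

open MeasureTheory ProbabilityTheory Set TopologicalSpace
open scoped ENNReal NNReal

namespace GaussianDelaunay

noncomputable section

/-! ### Poisson point processes -/

/-- The Poisson distribution with mean `r ∈ [0, ∞]`, as a law on `[0, ∞]`; for `r = ∞` it is the
point mass at `∞`. -/
def poissonLaw (r : ℝ≥0∞) : Measure ℝ≥0∞ :=
  open Classical in
  if r = ⊤ then Measure.dirac ⊤ else (poissonMeasure r.toNNReal).map (fun k : ℕ => (k : ℝ≥0∞))

/-- A σ-finite counting measure: a σ-finite measure with values in `{0, 1, 2, …, ∞}`. -/
structure IsCountingMeasure {X : Type*} [MeasurableSpace X] (ξ : Measure X) : Prop where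
  sigmaFinite : SigmaFinite ξ
  integer_valued : ∀ B : Set X, MeasurableSet B → ∃ k : ℕ∞, ξ B = (k : ℝ≥0∞)

/-- `η` is a Poisson point process on `X` with intensity measure `μ`, defined over `(Ω, P)`.
(The σ-algebra on `Measure X` is the one generated by the evaluations `ξ ↦ ξ B`.) -/
structure IsPoissonPointProcess {Ω X : Type*} [MeasurableSpace Ω] [MeasurableSpace X]
    (P : Measure Ω) (η : Ω → Measure X) (μ : Measure X) : Prop where
  measurable : Measurable η
  counting : ∀ ω, IsCountingMeasure (η ω)
  poisson : ∀ B : Set X, MeasurableSet B → HasLaw (fun ω => η ω B) (poissonLaw (μ B)) P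
  indep : ∀ (k : ℕ) (B : Fin k → Set X), (∀ i, MeasurableSet (B i)) →
    Pairwise (fun i j => Disjoint (B i) (B j)) → iIndepFun (fun i ω => η ω (B i)) P

/-- The set of points (atoms) of a counting measure. -/
def points {X : Type*} [MeasurableSpace X] (ξ : Measure X) : Set X := {x | ξ {x} ≠ 0}

/-- The intensity measure on `ℝ^(d-1) × ℝ` with density `γ (2π)^(-d/2) e^(h/2)` at `(v, h)`. -/
def gaussianIntensity (d : ℕ) (γ : ℝ) : Measure (EuclideanSpace ℝ (Fin (d - 1)) × ℝ) :=
  (volume : Measure (EuclideanSpace ℝ (Fin (d - 1)) × ℝ)).withDensity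
    fun x => ENNReal.ofReal (γ / (2 * Real.pi) ^ ((d : ℝ) / 2) * Real.exp (x.2 / 2))

/-! ### Laguerre diagrams and their duals -/

section Laguerre

variable {n : ℕ}

/-- The power of `w` with respect to the weighted point `x = (v, W)`. -/
def power (w : EuclideanSpace ℝ (Fin n)) (x : EuclideanSpace ℝ (Fin n) × ℝ) : ℝ :=
  ‖w - x.1‖ ^ 2 + x.2

/-- The Laguerre cell of the weighted point `x` with respect to the set `X`. -/
def laguerreCell (x : EuclideanSpace ℝ (Fin n) × ℝ) (X : Set (EuclideanSpace ℝ (Fin n) × ℝ)) :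
    Set (EuclideanSpace ℝ (Fin n)) :=
  {w | ∀ x' ∈ X, power w x ≤ power w x'}

/-- The Laguerre diagram of `X`: all Laguerre cells with non-empty interior. -/
def laguerreDiagram (X : Set (EuclideanSpace ℝ (Fin n) × ℝ)) :
    Set (Set (EuclideanSpace ℝ (Fin n))) :=
  {C | ∃ x ∈ X, C = laguerreCell x X ∧ (interior C).Nonempty}

/-- The vertices of the Laguerre diagram: the vertices (extreme points) of its cells. -/
def laguerreVertices (X : Set (EuclideanSpace ℝ (Fin n) × ℝ)) : Set (EuclideanSpace ℝ (Fin n)) :=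
  {z | ∃ C ∈ laguerreDiagram X, z ∈ C.extremePoints ℝ}

/-- The dual weighted points `(z, -K_z)`, where `z` runs through the vertices of the Laguerre
diagram of `X` and `K_z` is the least power of `z` with respect to the points of `X`.  The point
`(z, K_z)` is the apex of the downward paraboloid through the points of `X` whose cells meet in
`z`; the Laguerre diagram of the dual points is the dual (Delaunay) tessellation. -/
def dualPoints (X : Set (EuclideanSpace ℝ (Fin n) × ℝ)) : Set (EuclideanSpace ℝ (Fin n) × ℝ) :=
  {p | p.1 ∈ laguerreVertices X ∧ IsLeast (power p.1 '' X) (-p.2)}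

/-- The cell of the dual tessellation that belongs to the dual point `p = (z, -K_z)`, translated
by `-z`. -/
def centredCell (X : Set (EuclideanSpace ℝ (Fin n) × ℝ)) (p : EuclideanSpace ℝ (Fin n) × ℝ) :
    Set (EuclideanSpace ℝ (Fin n)) :=
  (fun w => w - p.1) '' laguerreCell p (dualPoints X)

/-! ### Weighted typical cells -/

/-- The unit cube `[0, 1]^n`. -/
def unitCube (n : ℕ) : Set (EuclideanSpace ℝ (Fin n)) := {v | ∀ i, v i ∈ Icc (0 : ℝ) 1}

/-- The Borel σ-algebra on the space of non-empty compact sets with the Hausdorff metric. -/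
instance : MeasurableSpace (NonemptyCompacts (EuclideanSpace ℝ (Fin n))) := borel _

instance : BorelSpace (NonemptyCompacts (EuclideanSpace ℝ (Fin n))) := ⟨rfl⟩

/-- A family of non-empty compact sets, regarded as a family of sets. -/
def asSets (A : Set (NonemptyCompacts (EuclideanSpace ℝ (Fin n)))) :
    Set (Set (EuclideanSpace ℝ (Fin n))) :=
  (fun K : NonemptyCompacts (EuclideanSpace ℝ (Fin n)) => (K : Set (EuclideanSpace ℝ (Fin n)))) '' A

variable {Ω : Type*} [MeasurableSpace Ω]

/-- The normalizing constant `λ_{η,ν} = 𝔼 ∑ 1(v ∈ [0,1]^n) Vol(M)^ν`, where the sum runs through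
the dual points `(v, h)` with centred cells `M`. -/
def cellIntensity (P : Measure Ω) (η : Ω → Measure (EuclideanSpace ℝ (Fin n) × ℝ)) (ν : ℝ) :
    ℝ≥0∞ :=
  ∫⁻ ω, ∑' p : dualPoints (points (η ω)),
    (unitCube n).indicator 1 p.1.1 * volume (centredCell (points (η ω)) p.1) ^ ν ∂P

/-- The distribution `ℙ_{η,ν}` of the `Vol^ν`-weighted typical cell of the dual tessellation,
`ℙ_{η,ν}(A) = λ_{η,ν}⁻¹ 𝔼 ∑ 1(M ∈ A) 1(v ∈ [0,1]^n) Vol(M)^ν`. -/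
def typicalCellLaw (P : Measure Ω) (η : Ω → Measure (EuclideanSpace ℝ (Fin n) × ℝ)) (ν : ℝ)
    (A : Set (NonemptyCompacts (EuclideanSpace ℝ (Fin n)))) : ℝ≥0∞ :=
  (cellIntensity P η ν)⁻¹ * ∫⁻ ω, ∑' p : dualPoints (points (η ω)),
    (asSets A).indicator 1 (centredCell (points (η ω)) p.1) *
      (unitCube n).indicator 1 p.1.1 * volume (centredCell (points (η ω)) p.1) ^ ν ∂P

end Laguerre

/-! ### The volume-weighted Gaussian simplex -/

/-- `Δ_{d-1}(y_1, …, y_d)`, the volume of the simplex `conv(y_1, …, y_d)`. -/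
def simplexVolume {d : ℕ} (y : Fin d → EuclideanSpace ℝ (Fin (d - 1))) : ℝ :=
  volume.real (convexHull ℝ (range y))

/-- The constant `α̂_{d,ν}`. -/
def alphaHat (d : ℕ) (ν : ℝ) : ℝ :=
  1 / ((2 : ℝ) ^ (((d : ℝ) - 1) * (d + ν + 1) / 2) * Real.pi ^ ((d : ℝ) * (d - 1) / 2)) *
    (((d - 1).factorial : ℝ) ^ (ν + 1) / (d : ℝ) ^ ((ν + 1) / 2)) *
    ∏ j ∈ Finset.Icc 1 (d - 1), Real.Gamma ((j : ℝ) / 2) / Real.Gamma (((j : ℝ) + ν + 1) / 2)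

/-- The density `α̂_{d,ν} Δ_{d-1}(y_1, …, y_d)^(ν+1) ∏ e^(-‖y_i‖²/2)`. -/
def simplexDensity (d : ℕ) (ν : ℝ) (y : Fin d → EuclideanSpace ℝ (Fin (d - 1))) : ℝ :=
  alphaHat d ν * simplexVolume y ^ (ν + 1) * ∏ i, Real.exp (-‖y i‖ ^ 2 / 2)

end

end GaussianDelaunay

namespace GaussianDelaunay

noncomputable section

/-! ### The Mecke formula -/

section Mecke

variable {Ω X : Type*} [MeasurableSpace Ω] [MeasurableSpace X]

/-! Write `n = d - 1` and let `c = γ (2π)^(-d/2)`. A dual point `(z, -K)` stands for the downward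
paraboloid `h = K - ‖v - z‖²` that passes through `n + 1` affinely independent points `(v_i, h_i)`
of the process and has no point of the process strictly below it. For almost every realization the
paraboloid contains no further point, and the dual cell at `(z, -K)` is the simplex spanned by the
`v_i` (`IsDualSimplex.laguerreCell_eq`). A sum over dual points is therefore `1 / (n + 1)!` times a
sum over ordered tuples of points of the process (`tsum_dualPoints`).

The multivariate Mecke formula (`IsPoissonPointProcess.lintegral_tupleKernel`) turns the expectation
of such a sum into an integral over `n + 1` points with respect to the product of the intensity
measure, weighted by the probability that no point of the process lies below their paraboloid. This
probability is `exp(-2c (2π)^(n/2) e^(K/2))`; it depends on the height `K` alone.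

For fixed `v_i` the heights `h_i = K - ‖v_i - z‖²` are traded for `(z, K)`. The Jacobian is `2^n
|det|`, with the determinant of the edge vectors, and the densities become `∏ e^(h_i/2) =
e^((n+1)K/2) ∏ e^(-‖v_i - z‖²/2)`. After the translation `y_i = v_i - z` the integral splits
(`lintegral_pi_expIntensity`) into the volume of the cube, an integral over `K`, and an integral
over the shape. The Jacobian contributes one power of the simplex volume and the weight contributes
`ν` powers, whence the exponent `ν + 1`. Only the first factors involve `γ`, and they cancel in the
quotient that defines the typical cell.

The constant is a moment of a Gaussian determinant. Rotating the first row to a coordinate axis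
splits off its norm and lowers the dimension by one, so the moment is a product of moments of norms
of Gaussian vectors (`lintegral_edgeMatrix_rpow`). -/

instance isProbabilityMeasure_poissonLaw (r : ℝ≥0∞) : IsProbabilityMeasure (poissonLaw r) := by
  unfold poissonLaw
  split_ifs
  · infer_instance
  · exact Measure.isProbabilityMeasure_map (measurable_of_countable _).aemeasurable

lemma lintegral_poissonLaw {r : ℝ≥0∞} (hr : r ≠ ⊤) {φ : ℝ≥0∞ → ℝ≥0∞} (hφ : Measurable φ) :
    ∫⁻ t, φ t ∂poissonLaw r =
      ∑' k : ℕ, ENNReal.ofReal (Real.exp (-r.toReal) * r.toReal ^ k / k.factorial) * φ k := by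
  rw [poissonLaw, if_neg hr, lintegral_map hφ (measurable_of_countable _), poissonMeasure,
    lintegral_sum_measure]
  simp only [lintegral_smul_measure, lintegral_dirac, smul_eq_mul]
  rfl

/-- Since `k · r^k / k! = r · r^(k-1) / (k-1)!`, shifting the index by one proves it. This is the
Mecke formula for a single count. -/
lemma lintegral_mul_poissonLaw {r : ℝ≥0∞} (hr : r ≠ ⊤) {φ : ℝ≥0∞ → ℝ≥0∞} (hφ : Measurable φ) :
    ∫⁻ t, t * φ t ∂poissonLaw r = r * ∫⁻ t, φ (t + 1) ∂poissonLaw r := by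
  rw [lintegral_poissonLaw (φ := fun t => t * φ t) hr (measurable_id.mul hφ),
    lintegral_poissonLaw (φ := fun t => φ (t + 1)) hr (hφ.comp (measurable_id.add_const 1)),
    tsum_eq_zero_add' ENNReal.summable, ← ENNReal.tsum_mul_left]
  simp only [Nat.cast_zero, zero_mul, mul_zero, zero_add]
  refine tsum_congr fun k => ?_
  rw [← mul_assoc, ← mul_assoc]
  push_cast
  congr 1
  rw [show ((k : ℝ≥0∞) + 1) = ENNReal.ofReal ((k : ℝ) + 1) by
    rw [ENNReal.ofReal_add (by positivity) (by positivity)]; simp]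
  nth_rewrite 3 [← ENNReal.ofReal_toReal hr]
  rw [← ENNReal.ofReal_mul (by positivity), ← ENNReal.ofReal_mul (by positivity)]
  congr 1
  rw [Nat.factorial_succ]
  have : (k.factorial : ℝ) ≠ 0 := by positivity
  push_cast
  rw [pow_succ]
  field_simp

lemma poissonLaw_singleton_zero {r : ℝ≥0∞} (hr : r ≠ ⊤) :
    poissonLaw r {0} = ENNReal.ofReal (Real.exp (-r.toReal)) := by
  rw [← lintegral_indicator_one (measurableSet_singleton _),
    lintegral_poissonLaw hr (measurable_one.indicator (measurableSet_singleton _)),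
    tsum_eq_single 0]
  · simp
  · intro k hk
    simp [hk]

variable {P : Measure Ω} {η : Ω → Measure X} {μ : Measure X}

lemma IsPoissonPointProcess.measurable_apply (hη : IsPoissonPointProcess P η μ) {B : Set X}
    (hB : MeasurableSet B) : Measurable fun ω => η ω B :=
  (Measure.measurable_coe hB).comp hη.measurable

lemma IsPoissonPointProcess.iIndepFun_fintype (hη : IsPoissonPointProcess P η μ) {ι : Type*}
    [Fintype ι] {B : ι → Set X} (hB : ∀ i, MeasurableSet (B i))
    (hd : Pairwise (fun i j => Disjoint (B i) (B j))) : iIndepFun (fun i ω => η ω (B i)) P := by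
  have h := hη.indep (Fintype.card ι) (fun k => B ((Fintype.equivFin ι).symm k)) (fun k => hB _)
    (fun i j hij => hd fun h => hij ((Fintype.equivFin ι).symm.injective h))
  have h2 := h.precomp (Fintype.equivFin ι).injective
  simpa using h2

/-- Counts of disjoint sets are independent, so their joint law is a product of Poisson laws and the
identity for one count can be applied in the coordinate `a` with all the others frozen. -/
lemma IsPoissonPointProcess.lintegral_mul_of_disjoint [IsProbabilityMeasure P]
    (hη : IsPoissonPointProcess P η μ) {ι : Type*} [Fintype ι] [DecidableEq ι] {B : ι → Set X}
    (hB : ∀ i, MeasurableSet (B i)) (hd : Pairwise (fun i j => Disjoint (B i) (B j))) (a : ι)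
    (ha : μ (B a) ≠ ⊤) {Φ : (ι → ℝ≥0∞) → ℝ≥0∞} (hΦ : Measurable Φ) :
    ∫⁻ ω, η ω (B a) * Φ (fun i => η ω (B i)) ∂P =
      μ (B a) * ∫⁻ ω, Φ (fun i => η ω (B i) + (Pi.single a 1 : ι → ℝ≥0∞) i) ∂P := by
  have hm : Measurable fun ω i => η ω (B i) := measurable_pi_lambda _ fun i =>
    hη.measurable_apply (hB i)
  have hlaw := (iIndepFun_iff_map_fun_eq_pi_map
    (fun i => (hη.measurable_apply (hB i)).aemeasurable)).1 (hη.iIndepFun_fintype hB hd)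
  simp only [fun i => (hη.poisson (B i) (hB i)).map_eq] at hlaw
  have hΦ' : Measurable fun f : ι → ℝ≥0∞ => Φ (fun i => f i + (Pi.single a 1 : ι → ℝ≥0∞) i) :=
    hΦ.comp (measurable_pi_lambda _ fun i => (measurable_pi_apply i).add_const _)
  have e1 := lintegral_map (μ := P) ((measurable_pi_apply a).mul hΦ) hm
  have e2 := lintegral_map (μ := P) (hΦ'.const_mul (μ (B a))) hm
  simp only [Pi.mul_apply] at e1
  have e3 := lintegral_const_mul (μ := P) (μ (B a)) (hΦ'.comp hm)
  simp only [Function.comp_def] at e3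
  rw [← e3, ← e1, ← e2, hlaw]
  refine lintegral_eq_of_lmarginal_eq {a} ((measurable_pi_apply a).mul hΦ)
    (hΦ'.const_mul (μ (B a))) ?_
  rw [lmarginal_singleton, lmarginal_singleton]
  funext f
  have hu : Measurable fun t : ℝ≥0∞ => Φ (Function.update f a t) :=
    hΦ.comp (measurable_update f)
  have key := lintegral_mul_poissonLaw ha hu
  have hu' : Measurable fun t : ℝ≥0∞ =>
      Φ (fun i => Function.update f a t i + (Pi.single a 1 : ι → ℝ≥0∞) i) :=
    hΦ'.comp (measurable_update f)
  rw [lintegral_const_mul _ hu']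
  simp only [Function.update_self]
  rw [key]
  congr 2
  funext t
  congr 1
  funext i
  by_cases h : i = a
  · subst h; simp
  · simp [h]

/-- The atom of the algebra generated by the sets `B i` that has the pattern `s`. -/
def partitionAtom {Y ι : Type*} (B : ι → Set Y) (s : ι → Prop) : Set Y := {x | ∀ i, x ∈ B i ↔ s i}

lemma measurableSet_partitionAtom {ι : Type*} [Countable ι] {B : ι → Set X}
    (hB : ∀ i, MeasurableSet (B i)) (s : ι → Prop) : MeasurableSet (partitionAtom B s) := by
  have : partitionAtom B s = ⋂ i, {x | x ∈ B i ↔ s i} := by ext; simp [partitionAtom]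
  rw [this]
  refine MeasurableSet.iInter fun i => ?_
  by_cases h : s i
  · simpa [h] using hB i
  · simp only [h, iff_false]
    exact (hB i).compl

lemma disjoint_partitionAtom {Y ι : Type*} (B : ι → Set Y) :
    Pairwise (fun s t => Disjoint (partitionAtom B s) (partitionAtom B t)) := by
  intro s t hst
  rw [Set.disjoint_left]
  intro x hs ht
  exact hst (funext fun i => propext ((hs i).symm.trans (ht i)))

open Classical in
lemma iUnion_partitionAtom {Y ι : Type*} (B : ι → Set Y) (i : ι) :
    ⋃ s ∈ {s : ι → Prop | s i}, partitionAtom B s = B i := by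
  ext x
  simp only [mem_iUnion, mem_ofPred_eq, exists_prop]
  constructor
  · rintro ⟨s, hs, hx⟩
    exact (hx i).2 hs
  · intro hx
    exact ⟨fun j => x ∈ B j, hx, fun j => Iff.rfl⟩

open Classical in
lemma measure_eq_sum_partitionAtom {ι : Type*} [Fintype ι] {B : ι → Set X}
    (hB : ∀ i, MeasurableSet (B i)) (ξ : Measure X) (i : ι) :
    ξ (B i) = ∑ s : ι → Prop, if s i then ξ (partitionAtom B s) else 0 := by
  rw [← Finset.sum_filter, ← measure_biUnion_finset]
  · conv_lhs => rw [← iUnion_partitionAtom B i]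
    simp
  · intro s _ t _ hst
    exact disjoint_partitionAtom B hst
  · intro s _
    exact measurableSet_partitionAtom hB s

open Classical in
-- Overlapping sets are cut into the disjoint atoms of the algebra that they generate. Both sides
-- become sums over the atoms inside `B a`, and a point mass in an atom raises the count of that
-- atom only.
lemma IsPoissonPointProcess.lintegral_mul_cylinder [IsProbabilityMeasure P]
    (hη : IsPoissonPointProcess P η μ) {ι : Type*} [Fintype ι] {B : ι → Set X}
    (hB : ∀ i, MeasurableSet (B i)) (a : ι) (ha : μ (B a) ≠ ⊤) {Φ : (ι → ℝ≥0∞) → ℝ≥0∞}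
    (hΦ : Measurable Φ) :
    ∫⁻ ω, η ω (B a) * Φ (fun i => η ω (B i)) ∂P =
      ∫⁻ x in B a, ∫⁻ ω, Φ (fun i => (η ω + Measure.dirac x) (B i)) ∂P ∂μ := by
  have hE := measurableSet_partitionAtom hB
  -- `L` recovers the counts of the sets `B i` from the counts of the atoms.
  set L : ((ι → Prop) → ℝ≥0∞) → ι → ℝ≥0∞ := fun f i => ∑ s, if s i then f s else 0 with hL
  have hLm : Measurable L := by
    refine measurable_pi_lambda _ fun i => Finset.measurable_sum _ fun s _ => ?_
    by_cases h : s i <;> simp [h, measurable_pi_apply]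
  have hLξ : ∀ ξ : Measure X, (fun i => ξ (B i)) = L (fun s => ξ (partitionAtom B s)) :=
    fun ξ => funext fun i => measure_eq_sum_partitionAtom hB ξ i
  have hdir : ∀ s, ∀ x ∈ partitionAtom B s, ∀ t,
      Measure.dirac x (partitionAtom B t) = (Pi.single s 1 : (ι → Prop) → ℝ≥0∞) t := by
    intro s x hx t
    rw [Measure.dirac_apply' _ (hE t)]
    by_cases hst : t = s
    · subst hst; simp [hx]
    · rw [Pi.single_eq_of_ne hst, indicator_of_notMem]
      exact fun h => (disjoint_partitionAtom B hst).le_bot ⟨h, hx⟩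
  have hmE : ∀ s, Measurable fun ω => η ω (partitionAtom B s) := fun s => hη.measurable_apply (hE s)
  have hLHS : ∫⁻ ω, η ω (B a) * Φ (fun i => η ω (B i)) ∂P = ∑ s : ι → Prop,
      if s a then ∫⁻ ω, η ω (partitionAtom B s) *
        Φ (L (fun t => η ω (partitionAtom B t))) ∂P else 0 := by
    have : ∀ ω, η ω (B a) * Φ (fun i => η ω (B i)) = ∑ s : ι → Prop,
        if s a then η ω (partitionAtom B s) * Φ (L (fun t => η ω (partitionAtom B t))) else 0 := by
      intro ω
      rw [hLξ, measure_eq_sum_partitionAtom hB (η ω) a, Finset.sum_mul]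
      exact Finset.sum_congr rfl fun s _ => by split_ifs <;> simp
    simp only [this]
    rw [lintegral_finsetSum]
    · exact Finset.sum_congr rfl fun s _ => by split_ifs <;> simp
    · intro s _
      by_cases h : s a
      · simp only [h, if_true]
        exact (hmE s).mul (hΦ.comp (hLm.comp (measurable_pi_lambda _ hmE)))
      · simp [h]
  have hRHS : ∫⁻ x in B a, ∫⁻ ω, Φ (fun i => (η ω + Measure.dirac x) (B i)) ∂P ∂μ =
      ∑ s : ι → Prop, if s a then ∫⁻ x in partitionAtom B s,
        ∫⁻ ω, Φ (fun i => (η ω + Measure.dirac x) (B i)) ∂P ∂μ else 0 := by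
    rw [← Finset.sum_filter, ← lintegral_biUnion_finset]
    · conv_lhs => rw [← iUnion_partitionAtom B a]
      simp
    · intro s _ t _ hst
      exact disjoint_partitionAtom B hst
    · intro s _
      exact hE s
  rw [hLHS, hRHS]
  refine Finset.sum_congr rfl fun s _ => ?_
  by_cases hs : s a
  swap
  · simp [hs]
  simp only [hs, if_true]
  have hsub : partitionAtom B s ⊆ B a := fun x hx => (hx a).2 hs
  have h := hη.lintegral_mul_of_disjoint hE (disjoint_partitionAtom B) s
    (ne_top_of_le_ne_top ha (measure_mono hsub)) (hΦ.comp hLm)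
  simp only [Function.comp_apply] at h
  rw [h]
  rw [setLIntegral_congr_fun (g := fun _ => ∫⁻ ω, Φ (L (fun t => η ω (partitionAtom B t) +
    (Pi.single s 1 : (ι → Prop) → ℝ≥0∞) t)) ∂P) (hE s)]
  · rw [setLIntegral_const, mul_comm]
  · intro x hx
    refine lintegral_congr fun ω => ?_
    rw [hLξ]
    simp only [Measure.add_apply, hdir s x hx]

/-- The measure `ξ` if it is finite on all the sets `W m`, and zero otherwise. -/
def locallyFinitePart (W : ℕ → Set X) (ξ : Measure X) : Measure X :=
  open Classical in if ∀ m, ξ (W m) < ⊤ then ξ else 0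

lemma locallyFinitePart_of_lt_top {W : ℕ → Set X} {ξ : Measure X} (h : ∀ m, ξ (W m) < ⊤) :
    locallyFinitePart W ξ = ξ := if_pos h

lemma locallyFinitePart_apply_lt_top (W : ℕ → Set X) (ξ : Measure X) (m : ℕ) :
    locallyFinitePart W ξ (W m) < ⊤ := by
  unfold locallyFinitePart
  split_ifs with h
  · exact h m
  · simp

lemma measurable_locallyFinitePart {W : ℕ → Set X} (hW : ∀ m, MeasurableSet (W m)) :
    Measurable (locallyFinitePart W) := by
  refine Measurable.ite ?_ measurable_id measurable_const
  have : {ξ : Measure X | ∀ m, ξ (W m) < ⊤} = ⋂ m, {ξ | ξ (W m) < ⊤} := by ext; simp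
  rw [this]
  exact MeasurableSet.iInter fun m => (Measure.measurable_coe (hW m)) measurableSet_Iio

/-- `locallyFinitePart` as a kernel. -/
def pointKernel (W : ℕ → Set X) (hW : ∀ m, MeasurableSet (W m)) : Kernel (Measure X) X where
  toFun := locallyFinitePart W
  measurable' := measurable_locallyFinitePart hW

/-- Finiteness at each point gives no uniform bound, so the kernel is split according to the integer
part of its total mass; each piece is bounded and at each point only one piece is non-zero. -/
lemma isSFiniteKernel_of_lt_top {α β : Type*} [MeasurableSpace α] [MeasurableSpace β]
    (κ : Kernel α β) (h : ∀ a, κ a univ < ⊤) : IsSFiniteKernel κ := by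
  classical
  have hs : ∀ k : ℕ, MeasurableSet {a | ⌊(κ a univ).toReal⌋₊ = k} := fun k =>
    (Nat.measurable_floor.comp ((Kernel.measurable_coe κ .univ).ennreal_toReal))
      (measurableSet_singleton k)
  have hfin : ∀ k : ℕ, IsFiniteKernel (Kernel.piecewise (hs k) κ 0) := by
    intro k
    refine ⟨⟨ENNReal.ofReal (k + 1), by simp, fun a => ?_⟩⟩
    rw [Kernel.piecewise_apply]
    split_ifs with ha
    · rw [← ENNReal.ofReal_toReal (h a).ne]
      refine ENNReal.ofReal_le_ofReal ?_
      have : ⌊(κ a univ).toReal⌋₊ = k := ha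
      rw [← this]
      exact (Nat.lt_floor_add_one _).le
    · simp
  have : κ = Kernel.sum fun k : ℕ => Kernel.piecewise (hs k) κ 0 := by
    ext a s hsm
    rw [Kernel.sum_apply' _ _ hsm, tsum_eq_single (⌊(κ a univ).toReal⌋₊)]
    · rw [Kernel.piecewise_apply, if_pos (by simp)]
    · intro k hk
      rw [Kernel.piecewise_apply, if_neg (by simpa using fun h => hk h.symm)]
      simp
  rw [this]
  infer_instance

/-- This is what replacing measures that are not locally finite by zero achieves: on each disjointed
window the kernel has finite mass everywhere. Being s-finite, it can be used in products of kernels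
and in measurability of partial integrals. -/
lemma isSFiniteKernel_pointKernel {W : ℕ → Set X} (hW : ∀ m, MeasurableSet (W m))
    (hU : ⋃ m, W m = univ) : IsSFiniteKernel (pointKernel W hW) := by
  have hD : ∀ m, MeasurableSet (disjointed W m) := fun m => MeasurableSet.disjointed hW m
  have : pointKernel W hW = Kernel.sum fun m => Kernel.restrict (pointKernel W hW) (hD m) := by
    ext ξ s hs
    rw [Kernel.sum_apply, ← Measure.restrict_univ (μ := pointKernel W hW ξ), ← hU,
      ← iUnion_disjointed, Measure.restrict_iUnion (disjoint_disjointed W) hD]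
    simp [Kernel.restrict_apply]
  rw [this]
  have : ∀ m, IsSFiniteKernel (Kernel.restrict (pointKernel W hW) (hD m)) := by
    intro m
    refine isSFiniteKernel_of_lt_top _ fun ξ => ?_
    rw [Kernel.restrict_apply, Measure.restrict_apply_univ]
    exact (measure_mono (disjointed_subset W m)).trans_lt (locallyFinitePart_apply_lt_top W ξ m)
  infer_instance

lemma measurable_add_dirac : Measurable fun p : X × Measure X => p.2 + Measure.dirac p.1 := by
  refine Measure.measurable_of_measurable_coe _ fun s hs => ?_
  simp only [Measure.add_apply]
  exact ((Measure.measurable_coe hs).comp measurable_snd).add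
    ((Measure.measurable_coe hs).comp (Measure.measurable_dirac.comp measurable_fst))

/-- Events that constrain finitely many evaluations form a π-system generating the σ-algebra, so
equality of measures need only be tested on them. -/
lemma generateFrom_measure_cylinders : (inferInstance : MeasurableSpace (Measure X)) =
    MeasurableSpace.generateFrom (piiUnionInter
      (fun s : {s : Set X // MeasurableSet s} => {t : Set (Measure X) |
        MeasurableSet[(borel ℝ≥0∞).comap fun ξ => ξ s.1] t}) univ) := by
  have := generateFrom_piiUnionInter_measurableSet
    (fun s : {s : Set X // MeasurableSet s} => (borel ℝ≥0∞).comap fun ξ : Measure X => ξ s.1) univ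
  rw [this]
  simp only [mem_univ, iSup_pos]
  rw [iSup_subtype]
  rfl

lemma IsPoissonPointProcess.ae_lt_top (hη : IsPoissonPointProcess P η μ)
    {B : Set X} (hB : MeasurableSet B) (hμ : μ B ≠ ⊤) : ∀ᵐ ω ∂P, η ω B < ⊤ := by
  rw [ae_iff]
  have h := (hη.poisson B hB).measure_eq (p := fun t => ¬ t < ⊤)
    (by simp)
  rw [h, poissonLaw, if_neg hμ, Measure.map_apply (measurable_of_countable _)
    (by simp)]
  simp [preimage]


/-- Both sides integrate `F` against a measure on `X × Measure X`. The two measures agree on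
products of a set inside a window with a cylinder, by
`IsPoissonPointProcess.lintegral_mul_cylinder`, and these products form a generating π-system with
an exhaustion of finite measure. -/
theorem IsPoissonPointProcess.lintegral_mecke [IsProbabilityMeasure P] [SFinite μ]
    (hη : IsPoissonPointProcess P η μ) {W : ℕ → Set X} (hW : ∀ m, MeasurableSet (W m))
    (hU : ⋃ m, W m = univ) (hμ : ∀ m, μ (W m) ≠ ⊤) {F : X × Measure X → ℝ≥0∞}
    (hF : Measurable F) :
    ∫⁻ ω, ∫⁻ x, F (x, η ω) ∂locallyFinitePart W (η ω) ∂P =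
      ∫⁻ x, ∫⁻ ω, F (x, η ω + Measure.dirac x) ∂P ∂μ := by
  have := isSFiniteKernel_pointKernel hW hU
  have hfin : ∀ᵐ ω ∂P, locallyFinitePart W (η ω) = η ω := by
    have : ∀ᵐ ω ∂P, ∀ m, η ω (W m) < ⊤ := ae_all_iff.2 fun m => hη.ae_lt_top (hW m) (hμ m)
    filter_upwards [this] with ω hω using locallyFinitePart_of_lt_top hω
  set κ : Kernel Ω X := (pointKernel W hW).comap η hη.measurable with hκ
  have hm1 : Measurable fun q : Ω × X => (q.2, η q.1) :=
    measurable_snd.prodMk (hη.measurable.comp measurable_fst)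
  have hm2 : Measurable fun q : X × Ω => (q.1, η q.2 + Measure.dirac q.1) :=
    measurable_fst.prodMk (measurable_add_dirac.comp
      (measurable_fst.prodMk (hη.measurable.comp measurable_snd)))
  have key : (P ⊗ₘ κ).map (fun q => (q.2, η q.1)) =
      (μ.prod P).map fun q => (q.1, η q.2 + Measure.dirac q.1) := by
    set D := piiUnionInter (fun s : {s : Set X // MeasurableSet s} => {t : Set (Measure X) |
        MeasurableSet[(borel ℝ≥0∞).comap fun ξ => ξ s.1] t}) univ with hD
    have hDpi : IsPiSystem D := isPiSystem_piiUnionInter _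
      (fun s => @MeasurableSpace.isPiSystem_measurableSet _ (_)) _
    have hDuniv : univ ∈ D := ⟨∅, by simp, fun _ => univ, by simp, by simp⟩
    have hlaw : ∀ A : Set X, MeasurableSet A → ∀ C ∈ D, ∀ m,
        ((P ⊗ₘ κ).map (fun q => (q.2, η q.1))) ((A ∩ W m) ×ˢ C) =
        ((μ.prod P).map fun q => (q.1, η q.2 + Measure.dirac q.1)) ((A ∩ W m) ×ˢ C) := by
      rintro A hA C ⟨t, -, f, hf, rfl⟩ m
      choose! S hS hSf using hf
      have hCm : MeasurableSet (⋂ s ∈ t, f s) := by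
        refine Finset.measurableSet_biInter _ fun s hs => ?_
        rw [← hSf s hs]
        exact Measure.measurable_coe s.2 (hS s hs)
      have hAm : MeasurableSet (A ∩ W m) := hA.inter (hW m)
      -- The index `none` carries the set for the marked point, the indices `some s` the sets whose
      -- counts define the cylinder.
      let B : Option t → Set X := fun o => o.elim (A ∩ W m) fun s => s.1.1
      have hB : ∀ o, MeasurableSet (B o) := by
        rintro (_ | s)
        · exact hAm
        · exact s.1.2
      let R : Set (Option t → ℝ≥0∞) := {g | ∀ s : t, g (some s) ∈ S s.1}
      have hR : MeasurableSet R := by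
        have : R = ⋂ s : t, {g | g (some s) ∈ S s.1} := by ext; simp [R]
        rw [this]
        exact MeasurableSet.iInter fun s => measurable_pi_apply _ (hS s.1 s.2)
      have hRC : ∀ ξ : Measure X, (fun o => ξ (B o)) ∈ R ↔ ξ ∈ ⋂ s ∈ t, f s := by
        intro ξ
        simp only [mem_iInter, R, mem_ofPred_eq, B, Option.elim]
        constructor
        · intro h s hs
          rw [← hSf s hs]
          exact h ⟨s, hs⟩
        · rintro h ⟨s, hs⟩
          have := h s hs
          rw [← hSf s hs] at this
          exact this
      have h := hη.lintegral_mul_cylinder hB none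
        (ne_top_of_le_ne_top (hμ m) (measure_mono inter_subset_right))
        (Φ := R.indicator 1) (measurable_one.indicator hR)
      have hind : ∀ ξ : Measure X, R.indicator (1 : (Option t → ℝ≥0∞) → ℝ≥0∞) (fun o => ξ (B o)) =
          (⋂ s ∈ t, f s).indicator 1 ξ := by
        intro ξ
        by_cases hc : ξ ∈ ⋂ s ∈ t, f s
        · rw [indicator_of_mem hc, indicator_of_mem ((hRC ξ).2 hc)]
          rfl
        · rw [indicator_of_notMem hc, indicator_of_notMem (mt (hRC ξ).1 hc)]
      simp only [hind] at h
      rw [Measure.map_apply hm1 (hAm.prod hCm), Measure.map_apply hm2 (hAm.prod hCm),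
        Measure.compProd_apply (hm1 (hAm.prod hCm)), Measure.prod_apply (hm2 (hAm.prod hCm))]
      calc _ = ∫⁻ ω, η ω (A ∩ W m) * (⋂ s ∈ t, f s).indicator 1 (η ω) ∂P := by
            refine lintegral_congr_ae ?_
            filter_upwards [hfin] with ω hω
            have : (κ ω) = η ω := hω
            rw [this]
            by_cases hc : η ω ∈ ⋂ s ∈ t, f s
            · rw [indicator_of_mem hc]
              simp only [Pi.one_apply, mul_one]
              congr 1
              ext x
              simp only [mem_preimage, mem_prod, and_iff_left hc]
            · rw [indicator_of_notMem hc, mul_zero]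
              convert measure_empty (μ := η ω)
              ext x
              simp only [mem_preimage, mem_prod, hc, and_false, mem_empty_iff_false]
        _ = _ := h
        _ = _ := by
            rw [← lintegral_indicator (hB none)]
            refine lintegral_congr fun x => ?_
            by_cases hx : x ∈ A ∩ W m
            · rw [indicator_of_mem (show x ∈ B none from hx)]
              have hCx : MeasurableSet {ω | η ω + Measure.dirac x ∈ ⋂ s ∈ t, f s} :=
                (measurable_add_dirac.comp (measurable_const.prodMk hη.measurable)) hCm
              rw [show (fun ω => (⋂ s ∈ t, f s).indicator (1 : Measure X → ℝ≥0∞)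
                  (η ω + Measure.dirac x)) =
                {ω | η ω + Measure.dirac x ∈ ⋂ s ∈ t, f s}.indicator 1 from rfl,
                lintegral_indicator_one hCx]
              congr 1
              ext ω
              simp only [mem_preimage, mem_prod, hx, true_and, mem_ofPred_eq]
            · rw [indicator_of_notMem (show x ∉ B none from hx)]
              symm
              convert measure_empty (μ := P)
              ext ω
              simp only [mem_preimage, mem_prod, hx, false_and, mem_empty_iff_false]
    refine Measure.ext_of_generateFrom_of_iUnion
      (image2 (· ×ˢ ·) {A : Set X | ∃ A', MeasurableSet A' ∧ ∃ m, A = A' ∩ W m} D)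
      (fun m => W m ×ˢ univ) ?_ ?_ ?_ ?_ ?_ ?_
    · symm
      refine generateFrom_eq_prod ?_ generateFrom_measure_cylinders.symm ?_
        ⟨fun _ => univ, fun _ => hDuniv, iUnion_const _⟩
      · refine le_antisymm (MeasurableSpace.generateFrom_le ?_) fun s hs => ?_
        · rintro _ ⟨A, hA, m, rfl⟩
          exact hA.inter (hW m)
        · rw [← inter_univ s, ← hU, inter_iUnion]
          refine MeasurableSet.iUnion fun m => MeasurableSpace.measurableSet_generateFrom ?_
          exact ⟨s, hs, m, rfl⟩
      · exact ⟨W, fun m => ⟨univ, .univ, m, by simp⟩, hU⟩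
    · refine IsPiSystem.prod ?_ hDpi
      rintro _ ⟨A, hA, m, rfl⟩ _ ⟨A', hA', m', rfl⟩ -
      exact ⟨A ∩ (A' ∩ W m'), hA.inter (hA'.inter (hW m')), m, by ext; simp; tauto⟩
    · rw [← iUnion_prod_const, hU, univ_prod_univ]
    · intro m
      exact ⟨W m, ⟨univ, .univ, m, by simp⟩, univ, hDuniv, rfl⟩
    · intro m
      have h := hlaw univ .univ univ hDuniv m
      rw [univ_inter] at h
      rw [h, Measure.map_apply hm2 ((hW m).prod .univ)]
      have : (fun q : X × Ω => (q.1, η q.2 + Measure.dirac q.1)) ⁻¹' (W m ×ˢ univ) =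
        W m ×ˢ univ := by ext; simp
      rw [this, Measure.prod_prod]
      simpa using hμ m
    · rintro _ ⟨_, ⟨A, hA, m, rfl⟩, C, hC, rfl⟩
      exact hlaw A hA C hC m
  have h1 := lintegral_map (μ := P ⊗ₘ κ) hF hm1
  have h2 := lintegral_map (μ := μ.prod P) hF hm2
  have h3 := Measure.lintegral_compProd (μ := P) (κ := κ) (hF.comp hm1)
  have h4 := lintegral_prod (μ := μ) (ν := P) _ (hF.comp hm2).aemeasurable
  simp only [Function.comp_apply] at h3 h4
  rw [key, h2, h3, h4] at h1
  exact h1.symm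

end Mecke

end

noncomputable section

/-! ### The Mecke formula for tuples of distinct points -/

section MultivariateMecke

variable {Ω X : Type*} [MeasurableSpace Ω] [MeasurableSpace X]

lemma measurable_finCons (k : ℕ) :
    Measurable fun p : X × (Fin k → X) => (Fin.cons p.1 p.2 : Fin (k + 1) → X) := by
  refine measurable_pi_lambda _ fun i => ?_
  refine Fin.cases ?_ (fun j => ?_) i
  · simpa using measurable_fst
  · simp only [Fin.cons_succ]
    fun_prop

/-- The `k`-fold product of a measure that is finite on the sets `W m`, as a kernel. -/
def tupleKernel (W : ℕ → Set X) (hW : ∀ m, MeasurableSet (W m)) :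
    (k : ℕ) → Kernel (Measure X) (Fin k → X)
  | 0 => Kernel.const _ (Measure.dirac Fin.elim0)
  | k + 1 => (pointKernel W hW ×ₖ tupleKernel W hW k).map fun p => Fin.cons p.1 p.2

variable {W : ℕ → Set X} {hW : ∀ m, MeasurableSet (W m)}

lemma isSFiniteKernel_tupleKernel (hU : ⋃ m, W m = univ) (k : ℕ) :
    IsSFiniteKernel (tupleKernel W hW k) := by
  induction k with
  | zero => unfold tupleKernel; infer_instance
  | succ k ih =>
    have := isSFiniteKernel_pointKernel hW hU
    unfold tupleKernel
    infer_instance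

lemma lintegral_tupleKernel_zero (ξ : Measure X) {f : (Fin 0 → X) → ℝ≥0∞} (hf : Measurable f) :
    ∫⁻ y, f y ∂tupleKernel W hW 0 ξ = f Fin.elim0 := by
  simp only [tupleKernel, Kernel.const_apply]
  rw [lintegral_dirac' _ hf]

lemma lintegral_tupleKernel_succ (hU : ⋃ m, W m = univ) (k : ℕ) (ξ : Measure X)
    {f : (Fin (k + 1) → X) → ℝ≥0∞} (hf : Measurable f) :
    ∫⁻ y, f y ∂tupleKernel W hW (k + 1) ξ =
      ∫⁻ x, ∫⁻ y, f (Fin.cons x y) ∂tupleKernel W hW k ξ ∂locallyFinitePart W ξ := by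
  have := isSFiniteKernel_pointKernel hW hU
  have := isSFiniteKernel_tupleKernel (hW := hW) hU k
  rw [tupleKernel, Kernel.map_apply _ (measurable_finCons k),
    lintegral_map hf (measurable_finCons k)]
  exact Kernel.lintegral_prod _ _ _ (hf.comp (measurable_finCons k))

/-- The extra atom only adds tuples that contain `a`, where `f` vanishes. In the induction for the
multivariate formula this removes the point that was just added by the formula for one point. -/
lemma lintegral_tupleKernel_add_dirac (hU : ⋃ m, W m = univ) (k : ℕ) {ξ : Measure X}
    (hξ : ∀ m, ξ (W m) < ⊤) (a : X) {f : (Fin k → X) → ℝ≥0∞} (hf : Measurable f)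
    (h0 : ∀ y, (∃ i, y i = a) → f y = 0) :
    ∫⁻ y, f y ∂tupleKernel W hW k (ξ + Measure.dirac a) = ∫⁻ y, f y ∂tupleKernel W hW k ξ := by
  induction k with
  | zero => rw [lintegral_tupleKernel_zero _ hf, lintegral_tupleKernel_zero _ hf]
  | succ k ih =>
    have := isSFiniteKernel_tupleKernel (hW := hW) hU k
    have hξ' : ∀ m, (ξ + Measure.dirac a) (W m) < ⊤ := fun m => by
      simp [hξ m]
    have hfc : ∀ x, Measurable fun y : Fin k → X => f (Fin.cons x y) := fun x =>
      hf.comp ((measurable_finCons k).comp (measurable_const.prodMk measurable_id))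
    have hm : Measurable fun x => ∫⁻ y, f (Fin.cons x y) ∂tupleKernel W hW k ξ :=
      Measurable.lintegral_prod_right' (f := fun p : X × (Fin k → X) => f (Fin.cons p.1 p.2))
        (hf.comp (measurable_finCons k))
    rw [lintegral_tupleKernel_succ hU _ _ hf, lintegral_tupleKernel_succ hU _ _ hf,
      locallyFinitePart_of_lt_top hξ, locallyFinitePart_of_lt_top hξ']
    have e : ∀ x, ∫⁻ y, f (Fin.cons x y) ∂tupleKernel W hW k (ξ + Measure.dirac a) =
        ∫⁻ y, f (Fin.cons x y) ∂tupleKernel W hW k ξ := fun x =>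
      ih (hfc x) fun y ⟨i, hi⟩ => h0 _ ⟨i.succ, by simpa using hi⟩
    simp only [e]
    rw [lintegral_add_measure, lintegral_dirac' _ hm]
    have : ∀ y : Fin k → X, f (Fin.cons a y) = 0 := fun y => h0 _ ⟨0, rfl⟩
    simp [this]

variable {P : Measure Ω} {η : Ω → Measure X} {μ : Measure X}

/-- Induction on `k`, extracting the first entry by the formula for one point. The product kernel
also charges tuples with repeated entries; the hypothesis that `F` vanishes on them is what lets the
first point be ignored when the remaining entries are chosen. -/
theorem IsPoissonPointProcess.lintegral_tupleKernel [IsProbabilityMeasure P] [SigmaFinite μ]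
    (hη : IsPoissonPointProcess P η μ) (hW : ∀ m, MeasurableSet (W m))
    (hU : ⋃ m, W m = univ) (hμ : ∀ m, μ (W m) ≠ ⊤) (k : ℕ)
    {F : (Fin k → X) × Measure X → ℝ≥0∞} (hF : Measurable F)
    (hinj : ∀ y ξ, ¬ Function.Injective y → F (y, ξ) = 0) :
    ∫⁻ ω, ∫⁻ y, F (y, η ω) ∂tupleKernel W hW k (η ω) ∂P =
      ∫⁻ y, ∫⁻ ω, F (y, η ω + ∑ i, Measure.dirac (y i)) ∂P ∂Measure.pi fun _ => μ := by
  induction k with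
  | zero =>
    have : ∀ ξ, Measurable fun y => F (y, ξ) :=
      fun ξ => hF.comp (measurable_id.prodMk measurable_const)
    simp only [fun ω => lintegral_tupleKernel_zero (hW := hW) (η ω) (this (η ω)),
      Measure.pi_of_empty _ Fin.elim0]
    rw [lintegral_dirac]
    simp
  | succ k ih =>
    have := isSFiniteKernel_tupleKernel (hW := hW) hU k
    have hlf : ∀ᵐ ω ∂P, ∀ m, η ω (W m) < ⊤ := ae_all_iff.2 fun m => hη.ae_lt_top (hW m) (hμ m)
    have hmc : ∀ ξ, Measurable fun y => F (y, ξ) := fun ξ =>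
      hF.comp (measurable_id.prodMk measurable_const)
    have hG : Measurable fun p : X × Measure X =>
        ∫⁻ y, F (Fin.cons p.1 y, p.2) ∂tupleKernel W hW k p.2 := by
      have := Measurable.lintegral_kernel_prod_right (κ := (tupleKernel W hW k).comap
        (Prod.snd : X × Measure X → Measure X) measurable_snd)
        (f := fun p y => F (Fin.cons p.1 y, p.2))
        (hF.comp (((measurable_finCons k).comp ((measurable_fst.comp measurable_fst).prodMk
          measurable_snd)).prodMk (measurable_snd.comp measurable_fst)))
      exact this
    have hadd : ∀ x, Measurable fun ξ : Measure X => ξ + Measure.dirac x := fun x =>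
      measurable_add_dirac.comp (measurable_const.prodMk measurable_id)
    have hcons : ∀ x, Measurable fun y : Fin k → X => (Fin.cons x y : Fin (k + 1) → X) := fun x =>
      (measurable_finCons k).comp (measurable_const.prodMk measurable_id)
    have hsum : Measurable fun p : (Fin (k + 1) → X) × Ω =>
        F (p.1, η p.2 + ∑ i, Measure.dirac (p.1 i)) := by
      refine hF.comp (measurable_fst.prodMk ?_)
      refine Measure.measurable_of_measurable_coe _ fun s hs => ?_
      simp only [Measure.add_apply, Measure.finsetSum_apply]
      refine ((hη.measurable_apply hs).comp measurable_snd).add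
        (Finset.measurable_sum _ fun i _ => ?_)
      exact (Measure.measurable_coe hs).comp (Measure.measurable_dirac.comp
        ((measurable_pi_apply i).comp measurable_fst))
    have hRm : Measurable fun y : Fin (k + 1) → X =>
        ∫⁻ ω, F (y, η ω + ∑ i, Measure.dirac (y i)) ∂P := hsum.lintegral_prod_right'
    have hpi := (measurePreserving_piFinSuccAbove (fun _ : Fin (k + 1) => μ) 0).symm
    calc _ = ∫⁻ ω, ∫⁻ x, (fun p : X × Measure X =>
              ∫⁻ y, F (Fin.cons p.1 y, p.2) ∂tupleKernel W hW k p.2) (x, η ω)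
              ∂locallyFinitePart W (η ω) ∂P := by
          simp only [fun ω => lintegral_tupleKernel_succ (hW := hW) hU k (η ω) (hmc (η ω))]
      _ = _ := hη.lintegral_mecke hW hU hμ hG
      _ = ∫⁻ x, ∫⁻ ω, ∫⁻ y, F (Fin.cons x y, η ω + Measure.dirac x)
            ∂tupleKernel W hW k (η ω) ∂P ∂μ := by
          refine lintegral_congr fun x => lintegral_congr_ae ?_
          filter_upwards [hlf] with ω hω
          -- A remaining entry equal to `x` would make the whole tuple non-injective.
          refine lintegral_tupleKernel_add_dirac hU k hω x ((hmc _).comp (hcons x)) ?_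
          rintro y ⟨i, hi⟩
          refine hinj _ _ fun h => ?_
          have := h (a₁ := 0) (a₂ := i.succ) (by simpa using hi.symm)
          exact (Fin.succ_ne_zero i) this.symm
      _ = ∫⁻ x, ∫⁻ y, ∫⁻ ω, F (Fin.cons x y, (η ω + ∑ i, Measure.dirac (y i)) + Measure.dirac x)
            ∂P ∂(Measure.pi fun _ => μ) ∂μ := by
          refine lintegral_congr fun x => ?_
          refine ih (F := fun p => F (Fin.cons x p.1, p.2 + Measure.dirac x))
            (hF.comp (((hcons x).comp measurable_fst).prodMk ((hadd x).comp measurable_snd))) ?_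
          intro y ξ hy
          refine hinj _ _ fun h => hy ?_
          exact (Fin.cons_injective_iff.1 h).2
      _ = _ := by
          rw [← hpi.map_eq, lintegral_map_equiv, lintegral_prod]
          · refine lintegral_congr fun x => lintegral_congr fun y => lintegral_congr fun ω => ?_
            simp only [MeasurableEquiv.piFinSuccAbove_symm_apply, Fin.insertNthEquiv_apply,
              Fin.insertNth_zero', Fin.sum_univ_succ, Fin.cons_zero, Fin.cons_succ]
            rw [add_assoc, add_comm (∑ i, _)]
            congr 2
            exact (Fin.insertNth_zero' x y).symm
          · exact (hRm.comp (MeasurableEquiv.measurable _)).aemeasurable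

end MultivariateMecke

/-! ### Counting measures are sums of point masses -/

section Atoms

variable {X : Type*} [MetricSpace X] [SecondCountableTopology X] [MeasurableSpace X] [BorelSpace X]

/-- By outer regularity each point has an open neighbourhood of mass less than one, hence of mass
zero; second countability passes from local to global. -/
lemma eq_zero_of_integer_valued {ξ : Measure X} [IsFiniteMeasure ξ]
    (hi : ∀ B : Set X, MeasurableSet B → ∃ k : ℕ∞, ξ B = (k : ℝ≥0∞)) (h0 : ∀ x, ξ {x} = 0) :
    ξ = 0 := by
  rw [← Measure.measure_univ_eq_zero]
  refine measure_null_of_locally_null _ fun x _ => ?_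
  obtain ⟨U, hxU, hU, hlt⟩ := Set.exists_isOpen_lt_of_lt {x} 1 (by rw [h0]; exact one_pos)
  refine ⟨U, by simpa using hU.mem_nhds (hxU rfl), ?_⟩
  obtain ⟨k, hk⟩ := hi U hU.measurableSet
  rw [hk] at hlt ⊢
  have : k < 1 := by exact_mod_cast hlt
  simpa using this

lemma IsCountingMeasure.one_le_of_mem_points {ξ : Measure X} (hξ : IsCountingMeasure ξ) {x : X}
    (hx : x ∈ points ξ) : 1 ≤ ξ {x} := by
  obtain ⟨k, hk⟩ := hξ.integer_valued {x} (measurableSet_singleton x)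
  have h0 : ξ {x} ≠ 0 := hx
  rw [hk] at h0 ⊢
  have : k ≠ 0 := by rintro rfl; simp at h0
  exact_mod_cast Order.one_le_iff_ne_zero.2 this

lemma IsCountingMeasure.finite_points_inter {ξ : Measure X} (hξ : IsCountingMeasure ξ) {B : Set X}
    (hfin : ξ B ≠ ⊤) : (points ξ ∩ B).Finite := by
  have h := Measure.finite_const_le_meas_of_disjoint_iUnion (ι := X) (ξ.restrict B) (ε := 1)
    one_pos (As := fun x => {x}) (fun x => measurableSet_singleton x)
    (fun x y hxy => by simpa using hxy) (by
      refine ne_top_of_le_ne_top hfin ?_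
      rw [← Measure.restrict_apply_univ (μ := ξ)]
      exact measure_mono (subset_univ _))
  refine h.subset ?_
  rintro x ⟨hx, hxB⟩
  change 1 ≤ (ξ.restrict B) {x}
  rw [Measure.restrict_apply (measurableSet_singleton x),
    inter_eq_left.2 (singleton_subset_iff.2 hxB)]
  exact hξ.one_le_of_mem_points hx

variable {W : ℕ → Set X}

lemma IsCountingMeasure.countable_points {ξ : Measure X} (hξ : IsCountingMeasure ξ)
    (hU : ⋃ m, W m = univ) (hfin : ∀ m, ξ (W m) < ⊤) :
    (points ξ).Countable := by
  rw [← inter_univ (points ξ), ← hU, inter_iUnion]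
  exact countable_iUnion fun m => (hξ.finite_points_inter (hfin m).ne).countable

/-- Inside a window the part off the atoms is a finite integer-valued measure without atoms, hence
zero. -/
lemma IsCountingMeasure.measure_compl_points {ξ : Measure X} (hξ : IsCountingMeasure ξ)
    (hW : ∀ m, MeasurableSet (W m)) (hU : ⋃ m, W m = univ) (hfin : ∀ m, ξ (W m) < ⊤) :
    ξ (points ξ)ᶜ = 0 := by
  have hc := hξ.countable_points hU hfin
  rw [← inter_univ (points ξ)ᶜ, ← hU, inter_iUnion, measure_iUnion_null_iff]
  intro m
  have hm : MeasurableSet ((points ξ)ᶜ ∩ W m) := hc.measurableSet.compl.inter (hW m)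
  rw [← Measure.restrict_eq_zero]
  have : IsFiniteMeasure (ξ.restrict ((points ξ)ᶜ ∩ W m)) :=
    ⟨by rw [Measure.restrict_apply_univ]; exact (measure_mono inter_subset_right).trans_lt (hfin m)⟩
  refine eq_zero_of_integer_valued (fun B hB => ?_) fun x => ?_
  · rw [Measure.restrict_apply hB]
    exact hξ.integer_valued _ (hB.inter hm)
  · rw [Measure.restrict_apply (measurableSet_singleton x)]
    by_cases hx : x ∈ points ξ
    · convert measure_empty (μ := ξ)
      ext y
      simp only [mem_inter_iff, mem_singleton_iff, mem_compl_iff, mem_empty_iff_false, iff_false]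
      rintro ⟨rfl, h, -⟩
      exact h hx
    · refine measure_mono_null inter_subset_left ?_
      simpa [points] using hx

lemma IsCountingMeasure.lintegral_eq_tsum {ξ : Measure X} (hξ : IsCountingMeasure ξ)
    (hW : ∀ m, MeasurableSet (W m)) (hU : ⋃ m, W m = univ) (hfin : ∀ m, ξ (W m) < ⊤)
    (hs : ∀ x, ξ {x} ≤ 1) (f : X → ℝ≥0∞) : ∫⁻ x, f x ∂ξ = ∑' x : points ξ, f x := by
  have hc := hξ.countable_points hU hfin
  have hr : ξ.restrict (points ξ) = ξ :=
    Measure.restrict_eq_self_of_ae_mem (hξ.measure_compl_points hW hU hfin)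
  conv_lhs => rw [← hr]
  rw [lintegral_countable _ hc]
  refine tsum_congr fun x => ?_
  rw [le_antisymm (hs x) (hξ.one_le_of_mem_points x.2), mul_one]

lemma IsCountingMeasure.apply_eq_zero_iff {ξ : Measure X} (hξ : IsCountingMeasure ξ)
    (hW : ∀ m, MeasurableSet (W m)) (hU : ⋃ m, W m = univ) (hfin : ∀ m, ξ (W m) < ⊤)
    (B : Set X) : ξ B = 0 ↔ ∀ x ∈ points ξ, x ∉ B := by
  constructor
  · intro h x hx hxB
    exact hx (measure_mono_null (singleton_subset_iff.2 hxB) h)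
  · intro h
    exact measure_mono_null (fun x hx hxp => h x hxp hx) (hξ.measure_compl_points hW hU hfin)

lemma IsCountingMeasure.lintegral_tupleKernel_eq_tsum {ξ : Measure X} (hξ : IsCountingMeasure ξ)
    (hW : ∀ m, MeasurableSet (W m)) (hU : ⋃ m, W m = univ) (hfin : ∀ m, ξ (W m) < ⊤)
    (hs : ∀ x, ξ {x} ≤ 1) (k : ℕ) {f : (Fin k → X) → ℝ≥0∞} (hf : Measurable f) :
    ∫⁻ y, f y ∂tupleKernel W hW k ξ = ∑' x : Fin k → points ξ, f fun i => x i := by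
  induction k with
  | zero =>
    rw [lintegral_tupleKernel_zero _ hf,
      tsum_eq_single Fin.elim0 (fun b hb => (hb (Subsingleton.elim _ _)).elim)]
    congr 1
    exact Subsingleton.elim _ _
  | succ k ih =>
    rw [lintegral_tupleKernel_succ hU _ _ hf, locallyFinitePart_of_lt_top hfin,
      hξ.lintegral_eq_tsum hW hU hfin hs, ← (Fin.consEquiv fun _ => points ξ).tsum_eq,
      ENNReal.tsum_prod']
    refine tsum_congr fun x => ?_
    have hfc : Measurable fun y : Fin k → X => f (Fin.cons x.1 y) :=
      hf.comp ((measurable_finCons k).comp (measurable_const.prodMk measurable_id))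
    rw [ih hfc]
    refine tsum_congr fun y => ?_
    congr 1
    funext i
    refine Fin.cases ?_ (fun j => ?_) i <;> simp [Fin.consEquiv]

/-- Apply the Mecke formula to the indicator of `ξ {x} > 1`. Since `μ {x} = 0`, almost surely `η`
does not charge `x`, so `η + δ_x` has mass one there and the right side vanishes. Simplicity is what
identifies integrals against `η` with sums over the set of its points. -/
lemma IsPoissonPointProcess.ae_simple {Ω : Type*} [MeasurableSpace Ω] {P : Measure Ω}
    [IsProbabilityMeasure P] {η : Ω → Measure X} {μ : Measure X} [SFinite μ] [NullSingletonClass μ]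
    (hη : IsPoissonPointProcess P η μ) (hW : ∀ m, MeasurableSet (W m))
    (hU : ⋃ m, W m = univ) (hμ : ∀ m, μ (W m) ≠ ⊤) : ∀ᵐ ω ∂P, ∀ x, η ω {x} ≤ 1 := by
  have hK := isSFiniteKernel_pointKernel hW hU
  have hlf : ∀ᵐ ω ∂P, ∀ m, η ω (W m) < ⊤ := ae_all_iff.2 fun m => hη.ae_lt_top (hW m) (hμ m)
  have hm : Measurable fun p : X × Measure X => locallyFinitePart W p.2 {p.1} := by
    have := Kernel.measurable_kernel_prodMk_left (κ := (pointKernel W hW).comap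
        (Prod.snd : X × Measure X → Measure X) measurable_snd)
        (t := {q | q.2 = q.1.1}) (measurableSet_eq_fun measurable_snd
          (measurable_fst.comp measurable_fst))
    exact this
  have hs : MeasurableSet {p : X × Measure X | 1 < locallyFinitePart W p.2 {p.1}} :=
    hm measurableSet_Ioi
  set F : X × Measure X → ℝ≥0∞ := {p | 1 < locallyFinitePart W p.2 {p.1}}.indicator 1 with hFdef
  have hF : Measurable F := measurable_one.indicator hs
  have h := hη.lintegral_mecke hW hU hμ hF
  have hR : ∫⁻ x, ∫⁻ ω, F (x, η ω + Measure.dirac x) ∂P ∂μ = 0 := by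
    have : ∀ x, ∫⁻ ω, F (x, η ω + Measure.dirac x) ∂P = 0 := by
      intro x
      have hFx : Measurable fun ω => F (x, η ω + Measure.dirac x) := hF.comp
        (measurable_const.prodMk
          (measurable_add_dirac.comp (measurable_const.prodMk hη.measurable)))
      rw [lintegral_eq_zero_iff hFx]
      have hz : ∀ᵐ ω ∂P, η ω {x} = 0 := by
        rw [ae_iff]
        have := (hη.poisson {x} (measurableSet_singleton x)).measure_eq (p := fun t => ¬ t = 0)
          (measurableSet_singleton (0 : ℝ≥0∞)).compl
        rw [this, measure_singleton]
        change poissonLaw 0 {0}ᶜ = 0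
        rw [prob_compl_eq_zero_iff (measurableSet_singleton 0), poissonLaw_singleton_zero (by simp)]
        simp
      filter_upwards [hlf, hz] with ω hω hz
      refine indicator_of_notMem ?_ _
      rw [mem_ofPred_eq, locallyFinitePart_of_lt_top]
      · simp [hz]
      · intro m
        rw [Measure.add_apply]
        exact ENNReal.add_lt_top.2 ⟨hω m, measure_lt_top _ _⟩
    simp [this]
  rw [hR] at h
  have hLm : Measurable fun ω => ∫⁻ x, F (x, η ω) ∂locallyFinitePart W (η ω) := by
    have := Measurable.lintegral_kernel_prod_right (κ := (pointKernel W hW).comap η hη.measurable)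
      (f := fun ω x => F (x, η ω))
      (hF.comp (measurable_snd.prodMk (hη.measurable.comp measurable_fst)))
    exact this
  rw [lintegral_eq_zero_iff hLm] at h
  filter_upwards [h, hlf] with ω hω hω2 x
  by_contra hlt
  rw [not_le] at hlt
  simp only [Pi.zero_apply] at hω
  have hFω : Measurable fun x => F (x, η ω) := hF.comp (measurable_id.prodMk measurable_const)
  rw [locallyFinitePart_of_lt_top hω2, lintegral_eq_zero_iff hFω] at hω
  rw [Filter.EventuallyEq, ae_iff] at hω
  -- A multiple atom `x` belongs to a set that is null for `η ω`, contradicting its positive mass.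
  have : η ω {x} = 0 := by
    refine measure_mono_null ?_ hω
    rintro y rfl
    simp only [mem_ofPred_eq, hFdef]
    rw [indicator_of_mem]
    · simp
    · simpa [locallyFinitePart_of_lt_top hω2] using hlt
  simp [this] at hlt

end Atoms

end

noncomputable section

/-! ### Geometry of the dual tessellation -/

section Geometry

open scoped Topology

variable {n : ℕ}

/-- The windows `{(v, h) : ‖v‖² / 2 + h ≤ m}`, which exhaust the space and have finite intensity. -/
def window (n m : ℕ) : Set (EuclideanSpace ℝ (Fin n) × ℝ) := {x | ‖x.1‖ ^ 2 / 2 + x.2 ≤ m}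

/-- Deterministic properties of the realizations of the Poisson process: finitely many points in
each window, points in every half-space, and no point besides `x_0, …, x_n` on the paraboloid
through affinely independent points `x_0, …, x_n`. -/
structure IsGeneric (S : Set (EuclideanSpace ℝ (Fin n) × ℝ)) : Prop where
  finite : ∀ m, (S ∩ window n m).Finite
  halfspace : ∀ e : EuclideanSpace ℝ (Fin n), e ≠ 0 → ∀ c : ℝ, ∃ x ∈ S, c < inner ℝ e x.1
  mem_range : ∀ x : Fin (n + 1) → EuclideanSpace ℝ (Fin n) × ℝ, (∀ i, x i ∈ S) →
    AffineIndependent ℝ (fun i => (x i).1) → ∀ w K, (∀ i, power w (x i) = K) →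
    ∀ q ∈ S, power w q = K → q ∈ range x

/-- The points `x_0, …, x_n` of `S` are the vertices of a simplex dual to the point `p`. -/
structure IsDualSimplex (S : Set (EuclideanSpace ℝ (Fin n) × ℝ)) (p : EuclideanSpace ℝ (Fin n) × ℝ)
    (x : Fin (n + 1) → EuclideanSpace ℝ (Fin n) × ℝ) : Prop where
  mem : ∀ i, x i ∈ S
  indep : AffineIndependent ℝ (fun i => (x i).1)
  power_eq : ∀ i, power p.1 (x i) = -p.2
  le_power : ∀ q ∈ S, -p.2 ≤ power p.1 q

/-- The quadratic terms in `w` cancel, so comparing the powers of two weighted points is an affine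
condition on `w`. -/
lemma power_sub_power (w z : EuclideanSpace ℝ (Fin n)) (q x : EuclideanSpace ℝ (Fin n) × ℝ) :
    power w q - power w x = power z q - power z x - 2 * inner ℝ (w - z) (q.1 - x.1) := by
  simp only [power, ← real_inner_self_eq_norm_sq, inner_sub_left, inner_sub_right]
  rw [real_inner_comm w q.1, real_inner_comm w x.1, real_inner_comm z q.1, real_inner_comm z x.1]
  ring

lemma continuous_power (q : EuclideanSpace ℝ (Fin n) × ℝ) : Continuous fun w => power w q := by
  unfold power
  fun_prop

/-- From `‖v‖² / 2 ≤ ‖w‖² + ‖w - v‖²` it follows that a point whose power at some `w` in the ball is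
at most `c` lies in a fixed window. -/
lemma finite_power_le {S : Set (EuclideanSpace ℝ (Fin n) × ℝ)}
    (hS : ∀ m, (S ∩ window n m).Finite) (z : EuclideanSpace ℝ (Fin n)) (r c : ℝ) :
    {q ∈ S | ∃ w ∈ Metric.ball z r, power w q ≤ c}.Finite := by
  obtain ⟨m, hm⟩ := exists_nat_ge (c + (‖z‖ + r) ^ 2)
  refine (hS m).subset ?_
  rintro q ⟨hq, w, hw, hwc⟩
  refine ⟨hq, ?_⟩
  have hw' : ‖w‖ ≤ ‖z‖ + r := by
    have h1 : ‖w - z‖ < r := by simpa [dist_eq_norm] using hw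
    have h2 : ‖w‖ ≤ ‖z‖ + ‖w - z‖ := by
      simpa using norm_add_le z (w - z)
    linarith
  have h3 : ‖q.1‖ ≤ ‖w‖ + ‖w - q.1‖ := by
    have := norm_sub_le w (w - q.1)
    simpa using this
  have h4 : ‖q.1‖ ^ 2 ≤ (‖w‖ + ‖w - q.1‖) ^ 2 := by gcongr
  have h5 : ‖w‖ ^ 2 ≤ (‖z‖ + r) ^ 2 := by gcongr
  simp only [window, mem_ofPred_eq]
  simp only [power] at hwc
  nlinarith [sq_nonneg (‖w‖ - ‖w - q.1‖)]

/-- Only finitely many `q` have power at most `power z x + 1` somewhere in the unit ball around `z`;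
for these continuity suffices, and near `z` all others exceed the power of `x` anyway. -/
lemma eventually_power_lt {S : Set (EuclideanSpace ℝ (Fin n) × ℝ)}
    (hS : ∀ m, (S ∩ window n m).Finite) (z : EuclideanSpace ℝ (Fin n))
    (x : EuclideanSpace ℝ (Fin n) × ℝ) :
    ∀ᶠ w in 𝓝 z, ∀ q ∈ S, power z x < power z q → power w x < power w q := by
  have h1 : ∀ᶠ w in 𝓝 z, power w x < power z x + 1 :=
    (continuous_power x).continuousAt.eventually_lt continuousAt_const (by simp)
  have h2 := (Filter.eventually_all_finite (l := 𝓝 z)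
    (p := fun q w => power z x < power z q → power w x < power w q)
    (finite_power_le hS z 1 (power z x + 1))).2 (fun q _ => by
      by_cases h : power z x < power z q
      · filter_upwards [(continuous_power x).continuousAt.eventually_lt
          (continuous_power q).continuousAt h] with w hw _ using hw
      · simp [h])
  filter_upwards [h1, h2, Metric.ball_mem_nhds z one_pos] with w hw1 hw2 hw3 q hq hlt
  by_cases hc : power w q ≤ power z x + 1
  · exact hw2 q ⟨hq, w, hw3, hc⟩ hlt
  · linarith

/-- The points of least power at a vertex must affinely span the space. Otherwise some direction `e`
is orthogonal to all their differences, and a small step along `e` or `-e` stays in the cell, so the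
vertex is the midpoint of a segment in the cell and not extreme. -/
lemma exists_isDualSimplex {S : Set (EuclideanSpace ℝ (Fin n) × ℝ)}
    (hS : ∀ m, (S ∩ window n m).Finite) {p : EuclideanSpace ℝ (Fin n) × ℝ}
    (hp : p ∈ dualPoints S) : ∃ x, IsDualSimplex S p x := by
  obtain ⟨⟨C, ⟨x0, hx0, rfl, -⟩, hz⟩, hleast⟩ := hp
  rw [mem_extremePoints] at hz
  obtain ⟨hzc, hext⟩ := hz
  have hle : ∀ q ∈ S, -p.2 ≤ power p.1 q := fun q hq => hleast.2 (mem_image_of_mem _ hq)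
  have hx0K : power p.1 x0 = -p.2 := by
    obtain ⟨q, hq, hqK⟩ := hleast.1
    exact le_antisymm (hqK ▸ hzc q hq) (hle x0 hx0)
  set M : Set (EuclideanSpace ℝ (Fin n) × ℝ) := {q ∈ S | power p.1 q = -p.2} with hM
  have hMfin : M.Finite := (finite_power_le hS p.1 1 (-p.2)).subset fun q hq =>
    ⟨hq.1, p.1, Metric.mem_ball_self one_pos, hq.2.le⟩
  have hx0M : x0 ∈ M := ⟨hx0, hx0K⟩
  have hspan : affineSpan ℝ (Prod.fst '' M) = ⊤ := by
    rw [AffineSubspace.affineSpan_eq_top_iff_vectorSpan_eq_top_of_nonempty _ _ _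
      ⟨x0.1, mem_image_of_mem _ hx0M⟩]
    by_contra hne
    rw [← Submodule.orthogonal_eq_bot_iff] at hne
    obtain ⟨e, he, he0⟩ := Submodule.exists_mem_ne_zero_of_ne_bot hne
    have horth : ∀ q ∈ M, inner ℝ e (q.1 - x0.1) = 0 := fun q hq =>
      Submodule.inner_left_of_mem_orthogonal
        (vsub_mem_vectorSpan ℝ (mem_image_of_mem _ hq) (mem_image_of_mem _ hx0M)) he
    have hev : ∀ᶠ t : ℝ in 𝓝 0, p.1 + t • e ∈ laguerreCell x0 S := by
      have hcont : Filter.Tendsto (fun t : ℝ => p.1 + t • e) (𝓝 0) (𝓝 p.1) := by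
        have : Continuous fun t : ℝ => p.1 + t • e := by fun_prop
        simpa using this.tendsto 0
      filter_upwards [hcont.eventually (eventually_power_lt hS p.1 x0)] with t ht q hq
      by_cases hqM : power p.1 q = -p.2
      · have h := power_sub_power (p.1 + t • e) p.1 q x0
        rw [add_sub_cancel_left, inner_smul_left, horth q ⟨hq, hqM⟩, hqM, hx0K] at h
        simp at h
        linarith
      · exact (ht q hq (hx0K ▸ lt_of_le_of_ne (hle q hq) (Ne.symm hqM))).le
    obtain ⟨ε, hε, hball⟩ := Metric.eventually_nhds_iff.1 hev
    have h1 : p.1 + (ε / 2) • e ∈ laguerreCell x0 S := hball (by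
      simp [abs_of_pos hε, hε.lt])
    have h2 : p.1 + (-(ε / 2)) • e ∈ laguerreCell x0 S := hball (by
      simp [abs_of_pos hε, hε.lt])
    have h3 := hext _ h1 _ h2 ⟨1 / 2, 1 / 2, by norm_num, by norm_num, by norm_num, by module⟩
    have h4 : (ε / 2) • e = 0 := by simpa using h3.1
    rcases smul_eq_zero.1 h4 with h | h
    · linarith
    · exact he0 h
  obtain ⟨t, htM, htspan, hti⟩ := exists_affineIndependent ℝ (EuclideanSpace ℝ (Fin n))
    (Prod.fst '' M)
  rw [hspan] at htspan
  have : Fintype t := ((hMfin.image _).subset htM).fintype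
  have hcard : Fintype.card t = n + 1 := by
    have := (hti.affineSpan_eq_top_iff_card_eq_finrank_add_one).1 (by simpa using htspan)
    simpa using this
  choose g hgM hg using fun u : t => htM u.2
  let φ : Fin (n + 1) ≃ t := (Fintype.equivFinOfCardEq hcard).symm
  refine ⟨fun i => g (φ i), fun i => (hgM _).1, ?_, fun i => (hgM _).2, hle⟩
  have : (fun i => (g (φ i)).1) = (Subtype.val : t → _) ∘ φ := funext fun i => hg _
  rw [this]
  exact hti.comp_embedding φ.toEmbedding

/-- The affine basis formed by `n + 1` affinely independent points. -/
def affineBasisOfIndep {v : Fin (n + 1) → EuclideanSpace ℝ (Fin n)} (hv : AffineIndependent ℝ v) :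
    AffineBasis (Fin (n + 1)) ℝ (EuclideanSpace ℝ (Fin n)) :=
  ⟨v, hv, (hv.affineSpan_eq_top_iff_card_eq_finrank_add_one).2 (by simp)⟩

lemma affineBasisOfIndep_apply {v : Fin (n + 1) → EuclideanSpace ℝ (Fin n)}
    (hv : AffineIndependent ℝ v) (i : Fin (n + 1)) : affineBasisOfIndep hv i = v i := rfl

lemma exists_gradient_coord (b : AffineBasis (Fin (n + 1)) ℝ (EuclideanSpace ℝ (Fin n)))
    (i : Fin (n + 1)) :
    ∃ e : EuclideanSpace ℝ (Fin n), ∀ u w, inner ℝ e (u - w) = b.coord i u - b.coord i w := by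
  refine ⟨(InnerProductSpace.toDual ℝ _).symm (LinearMap.toContinuousLinearMap (b.coord i).linear),
    fun u w => ?_⟩
  rw [InnerProductSpace.toDual_symm_apply]
  have := (b.coord i).linearMap_vsub u w
  simpa using this

lemma eq_zero_of_inner_sub_eq_zero {v : Fin (n + 1) → EuclideanSpace ℝ (Fin n)}
    (hv : AffineIndependent ℝ v) (i : Fin (n + 1)) {u : EuclideanSpace ℝ (Fin n)}
    (h : ∀ j, inner ℝ u (v j - v i) = 0) : u = 0 := by
  have hs : vectorSpan ℝ (range v) = ⊤ :=
    hv.vectorSpan_eq_top_of_card_eq_finrank_add_one (by simp)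
  rw [vectorSpan_range_eq_span_range_vsub_right ℝ v i] at hs
  have : u ∈ (⊤ : Submodule ℝ (EuclideanSpace ℝ (Fin n)))ᗮ := by
    rw [← hs, Submodule.mem_orthogonal']
    intro w hw
    induction hw using Submodule.span_induction with
    | mem w hw => obtain ⟨j, rfl⟩ := hw; exact h j
    | zero => simp
    | add a b _ _ ha hb => rw [inner_add_right, ha, hb, add_zero]
    | smul c a _ ha => rw [inner_smul_right, ha, mul_zero]
  simpa using this

/-- The apex is an extreme point because the cell of `x 0` is bounded there by `n` independent
half-spaces. The cell has interior because, by genericity, the only competitors at the apex are the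
other `x i`, and a single direction makes all of them worse. -/
lemma IsDualSimplex.mem_dualPoints {S : Set (EuclideanSpace ℝ (Fin n) × ℝ)} (hS : IsGeneric S)
    {p : EuclideanSpace ℝ (Fin n) × ℝ} {x : Fin (n + 1) → EuclideanSpace ℝ (Fin n) × ℝ}
    (h : IsDualSimplex S p x) : p ∈ dualPoints S := by
  have hzc : p.1 ∈ laguerreCell (x 0) S := fun q hq => by
    rw [h.power_eq]; exact h.le_power q hq
  refine ⟨⟨laguerreCell (x 0) S, ⟨x 0, h.mem 0, rfl, ?_⟩, ?_⟩,
    ⟨x 0, h.mem 0, h.power_eq 0⟩, by rintro _ ⟨q, hq, rfl⟩; exact h.le_power q hq⟩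
  -- Moving by `t • e`, with `e` the gradient of the barycentric coordinate of `x 0`, puts the power
  -- of every other `x i` above that of `x 0` by `2t`.
  · obtain ⟨e, he⟩ := exists_gradient_coord (affineBasisOfIndep h.indep) 0
    have hcont : Filter.Tendsto (fun t : ℝ => p.1 + t • e) (𝓝[>] 0) (𝓝 p.1) := by
      have : Continuous fun t : ℝ => p.1 + t • e := by fun_prop
      simpa using (this.tendsto 0).mono_left nhdsWithin_le_nhds
    obtain ⟨t, ht, ht0⟩ := ((hcont.eventually (eventually_power_lt hS.finite p.1 (x 0))).and
      self_mem_nhdsWithin).exists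
    have ht0 : 0 < t := ht0
    refine ⟨p.1 + t • e, ?_⟩
    rw [mem_interior_iff_mem_nhds]
    filter_upwards [eventually_power_lt hS.finite (p.1 + t • e) (x 0)] with w hw q hq
    by_cases hq0 : q = x 0
    · rw [hq0]
    refine (hw q hq ?_).le
    by_cases hqM : power p.1 q = -p.2
    · obtain ⟨i, rfl⟩ := hS.mem_range x h.mem h.indep p.1 _ h.power_eq q hq hqM
      have hi : i ≠ 0 := fun hi => hq0 (by rw [hi])
      have h1 := power_sub_power (p.1 + t • e) p.1 (x i) (x 0)
      have h2 := he (x i).1 (x 0).1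
      rw [← affineBasisOfIndep_apply h.indep i, ← affineBasisOfIndep_apply h.indep 0,
        AffineBasis.coord_apply_ne _ (Ne.symm hi), AffineBasis.coord_apply_eq] at h2
      simp only [affineBasisOfIndep_apply] at h2
      rw [add_sub_cancel_left, inner_smul_left, h2, h.power_eq, h.power_eq] at h1
      simp at h1
      linarith
    · refine ht q hq ?_
      rw [h.power_eq]
      exact lt_of_le_of_ne (h.le_power q hq) (Ne.symm hqM)
  · rw [mem_extremePoints_iff_left]
    refine ⟨hzc, fun a ha b hb hab => ?_⟩
    obtain ⟨s, t, hs, ht, hst, hz⟩ := hab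
    -- The constraint from `x i` is an equality at the apex, which lies strictly between `a` and
    -- `b`; holding at both ends, it forces the inner product to have both signs.
    have hzero : ∀ i, inner ℝ (a - b) ((x i).1 - (x 0).1) = 0 := by
      intro i
      have h1 := power_sub_power a p.1 (x i) (x 0)
      have h2 := power_sub_power b p.1 (x i) (x 0)
      rw [h.power_eq, h.power_eq] at h1 h2
      have h3 := ha (x i) (h.mem i)
      have h4 := hb (x i) (h.mem i)
      have hap : a - p.1 = t • (a - b) := by
        rw [← hz]
        have : s = 1 - t := by linarith
        subst this
        module
      have hbp : b - p.1 = (-s) • (a - b) := by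
        rw [← hz]
        have : t = 1 - s := by linarith
        subst this
        module
      rw [hap, inner_smul_left] at h1
      rw [hbp, inner_smul_left] at h2
      simp at h1 h2
      refine le_antisymm ?_ ?_
      · by_contra hc
        have := mul_pos ht (not_le.1 hc)
        linarith
      · by_contra hc
        have := mul_neg_of_pos_of_neg hs (not_le.1 hc)
        linarith
    have hab : a - b = 0 := eq_zero_of_inner_sub_eq_zero h.indep 0 hzero
    have : a = b := sub_eq_zero.1 hab
    rw [← hz, ← this, ← add_smul, hst, one_smul]

/-- Pair a dependence among the new points, based at `u`, with the gradient of the `i`-th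
coordinate. As the weights sum to zero, what remains is the weight at `i` times the coordinate of
`u`, so that weight vanishes and the dependence is one among the old points. -/
lemma affineIndependent_update {v : Fin (n + 1) → EuclideanSpace ℝ (Fin n)}
    (hv : AffineIndependent ℝ v) (i : Fin (n + 1)) {u : EuclideanSpace ℝ (Fin n)}
    (hu : (affineBasisOfIndep hv).coord i u ≠ 0) :
    AffineIndependent ℝ (Function.update v i u) := by
  classical
  obtain ⟨e, he⟩ := exists_gradient_coord (affineBasisOfIndep hv) i
  rw [affineIndependent_iff_of_fintype]
  intro w hw0 hw
  rw [Finset.weightedVSub_eq_weightedVSubOfPoint_of_sum_eq_zero _ _ _ hw0 u,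
    Finset.weightedVSubOfPoint_apply] at hw
  simp only [vsub_eq_sub] at hw
  have key : w i = 0 := by
    by_contra hwi
    have hc : ∀ j, inner ℝ e (Function.update v i u j - u) =
        if j = i then 0 else -(affineBasisOfIndep hv).coord i u := by
      intro j
      split_ifs with hj
      · subst hj; simp
      · rw [Function.update_of_ne hj, he, ← affineBasisOfIndep_apply hv j,
          AffineBasis.coord_apply_ne _ (Ne.symm hj), zero_sub]
    have h1 := congrArg (fun y => inner ℝ e y) hw
    simp only [inner_sum, inner_smul_right, hc, inner_zero_right] at h1
    have h2 : ∑ j, w j * (if j = i then 0 else -(affineBasisOfIndep hv).coord i u) =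
        w i * (affineBasisOfIndep hv).coord i u := by
      have : ∀ j, w j * (if j = i then 0 else -(affineBasisOfIndep hv).coord i u) =
          -(w j * (affineBasisOfIndep hv).coord i u) +
          if j = i then w i * (affineBasisOfIndep hv).coord i u else 0 := by
        intro j
        split_ifs with hj
        · subst hj; ring
        · ring
      simp only [this, Finset.sum_add_distrib, Finset.sum_neg_distrib, ← Finset.sum_mul, hw0]
      simp
    rw [h2] at h1
    rcases mul_eq_zero.1 h1 with h | h
    · exact hwi h
    · exact hu h
  have hall := (affineIndependent_iff_of_fintype ℝ v).1 hv w hw0 (by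
    rw [Finset.weightedVSub_eq_weightedVSubOfPoint_of_sum_eq_zero _ _ _ hw0 u,
      Finset.weightedVSubOfPoint_apply, ← hw]
    refine Finset.sum_congr rfl fun j _ => ?_
    by_cases hj : j = i
    · subst hj; simp [key]
    · rw [Function.update_of_ne hj]; rfl)
  exact hall

lemma convex_power_le (p p' : EuclideanSpace ℝ (Fin n) × ℝ) :
    Convex ℝ {w | power w p ≤ power w p'} := by
  have : {w | power w p ≤ power w p'} =
      {w | inner ℝ (p'.1 - p.1) w ≤ (power 0 p' - power 0 p) / 2} := by
    ext w
    have h := power_sub_power w 0 p' p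
    rw [sub_zero, real_inner_comm] at h
    simp only [mem_ofPred_eq]
    constructor <;> intro <;> linarith
  rw [this]
  exact convex_halfSpace_le (IsLinearMap.mk (fun x y => inner_add_right _ _ _)
    (fun c x => inner_smul_right _ _ _)) _

/-- The cell of the dual tessellation at a dual point is the convex hull of the points whose
Laguerre cells meet there. -/
theorem IsDualSimplex.laguerreCell_eq (hn : 0 < n) {S : Set (EuclideanSpace ℝ (Fin n) × ℝ)}
    (hS : IsGeneric S) {p : EuclideanSpace ℝ (Fin n) × ℝ}
    {x : Fin (n + 1) → EuclideanSpace ℝ (Fin n) × ℝ} (h : IsDualSimplex S p x) :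
    laguerreCell p (dualPoints S) = convexHull ℝ (range fun i => (x i).1) := by
  have : Nontrivial (Fin (n + 1)) := Fin.nontrivial_iff_two_le.2 (by omega)
  refine Subset.antisymm ?_ ?_
  · intro w hw
    set b := affineBasisOfIndep h.indep with hb
    have hbr : (range fun i => (x i).1) = range b := rfl
    rw [hbr, b.convexHull_eq_nonneg_coord]
    -- Suppose `w` lies beyond the facet opposite `x i`. The idea is to walk from `p.1` along the
    -- outer normal `e` of this facet. The facet vertices keep a common power, and the walk stops
    -- when some point `q1` beyond the facet first reaches it. Exchanging `x i` for `q1` gives a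
    -- neighbouring dual point, at which `w` has smaller power than at `p`.
    intro i
    by_contra hneg
    rw [not_le] at hneg
    obtain ⟨e', he'⟩ := exists_gradient_coord b i
    set e := -e' with hedef
    have he : ∀ u w, inner ℝ e (u - w) = b.coord i w - b.coord i u := by
      intro u w
      rw [hedef, inner_neg_left, he']
      ring
    obtain ⟨j, hj⟩ := exists_ne i
    have hbj : ∀ k, b k = (x k).1 := fun k => rfl
    have hcj : ∀ k, k ≠ i → b.coord i (x k).1 = 0 := fun k hk => by
      rw [← hbj, AffineBasis.coord_apply_ne _ (Ne.symm hk)]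
    have hci : b.coord i (x i).1 = 1 := by rw [← hbj, AffineBasis.coord_apply_eq]
    have he0 : e ≠ 0 := by
      intro h0
      have := he (x i).1 (x j).1
      rw [h0, inner_zero_left, hci, hcj j hj] at this
      norm_num at this
    have hg : ∀ q : EuclideanSpace ℝ (Fin n) × ℝ, inner ℝ e (q.1 - (x j).1) = -b.coord i q.1 := by
      intro q
      rw [he, hcj j hj, zero_sub]
    have hdiff : ∀ (t : ℝ) (q : EuclideanSpace ℝ (Fin n) × ℝ),
        power (p.1 + t • e) q - power (p.1 + t • e) (x j) =
          power p.1 q + p.2 + 2 * t * b.coord i q.1 := by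
      intro t q
      rw [power_sub_power _ p.1, add_sub_cancel_left, inner_smul_left, hg, h.power_eq]
      simp
      ring
    obtain ⟨q0, hq0, hq0e⟩ := hS.halfspace e he0 (inner ℝ e (x j).1)
    set U : Set (EuclideanSpace ℝ (Fin n) × ℝ) := {q ∈ S | b.coord i q.1 < 0} with hU
    have hq0U : q0 ∈ U := by
      refine ⟨hq0, ?_⟩
      have := hg q0
      rw [inner_sub_right] at this
      linarith
    -- `τ q` is the time at which the power of `q` meets that of the facet vertices, obtained by
    -- solving `hdiff` for zero.
    set τ : EuclideanSpace ℝ (Fin n) × ℝ → ℝ :=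
      fun q => (power p.1 q + p.2) / (-(2 * b.coord i q.1)) with hτ
    have hτU : ∀ q ∈ U, ∀ t, t ≤ τ q ↔ 0 ≤ power p.1 q + p.2 + 2 * t * b.coord i q.1 := by
      intro q hq t
      rw [hτ, le_div_iff₀ (by linarith [hq.2])]
      constructor <;> intro <;> linarith
    -- Points reached no later than `q0` have power at most that of `x j` at time `τ q0`, so local
    -- finiteness provides a first one.
    have hfin : {q ∈ U | τ q ≤ τ q0}.Finite := by
      refine (finite_power_le hS.finite (p.1 + τ q0 • e) 1
        (power (p.1 + τ q0 • e) (x j))).subset ?_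
      rintro q ⟨hq, hqt⟩
      refine ⟨hq.1, _, Metric.mem_ball_self one_pos, ?_⟩
      have h1 := hdiff (τ q0) q
      have h2 : power p.1 q + p.2 + 2 * τ q0 * b.coord i q.1 ≤ 0 := by
        have : τ q = (power p.1 q + p.2) / (-(2 * b.coord i q.1)) := rfl
        rw [this, div_le_iff₀ (by linarith [hq.2])] at hqt
        linarith
      linarith
    obtain ⟨q1, ⟨hq1U, hq1t⟩, hq1min⟩ := Set.exists_min_image _ τ hfin ⟨q0, hq0U, le_rfl⟩
    have hmin : ∀ q ∈ U, τ q1 ≤ τ q := by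
      intro q hq
      by_cases hc : τ q ≤ τ q0
      · exact hq1min q ⟨hq, hc⟩
      · linarith
    set t := τ q1 with ht
    -- At time zero only the `x k` have the common power, and their `i`-th coordinates are `0` or
    -- `1`, not negative.
    have htpos : 0 < t := by
      refine div_pos ?_ (by linarith [hq1U.2])
      have h1 := h.le_power q1 hq1U.1
      rcases h1.lt_or_eq with h2 | h2
      · linarith
      · exfalso
        obtain ⟨k, rfl⟩ := hS.mem_range x h.mem h.indep p.1 _ h.power_eq q1 hq1U.1 h2.symm
        have h3 := hq1U.2
        by_cases hk : k = i
        · rw [hk, hci] at h3; linarith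
        · rw [hcj k hk] at h3; linarith
    have hq1eq : power p.1 q1 + p.2 + 2 * t * b.coord i q1.1 = 0 := by
      have h1 : t * (-(2 * b.coord i q1.1)) = power p.1 q1 + p.2 :=
        div_mul_cancel₀ _ (by linarith [hq1U.2])
      linarith
    set p' : EuclideanSpace ℝ (Fin n) × ℝ := (p.1 + t • e, -power (p.1 + t • e) (x j)) with hp'
    have hdual : IsDualSimplex S p' (Function.update x i q1) := by
      refine ⟨fun k => ?_, ?_, fun k => ?_, fun q hq => ?_⟩
      · by_cases hk : k = i
        · subst hk; simpa using hq1U.1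
        · rw [Function.update_of_ne hk]; exact h.mem k
      · have : (fun k => (Function.update x i q1 k).1) =
            Function.update (fun k => (x k).1) i q1.1 := by
          funext k
          by_cases hk : k = i
          · subst hk; simp
          · simp [hk]
        rw [this]
        exact affineIndependent_update h.indep i hq1U.2.ne
      · simp only [hp', neg_neg]
        by_cases hk : k = i
        · subst hk
          have := hdiff t q1
          rw [Function.update_self]
          linarith
        · have := hdiff t (x k)
          rw [h.power_eq, hcj k hk] at this
          rw [Function.update_of_ne hk]
          linarith
      · simp only [hp', neg_neg]
        have h1 := hdiff t q
        by_cases hqU : b.coord i q.1 < 0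
        · have := (hτU q ⟨hq, hqU⟩ t).1 (hmin q ⟨hq, hqU⟩)
          linarith
        · have h2 := h.le_power q hq
          have h3 := mul_nonneg htpos.le (not_lt.1 hqU)
          linarith
    have hcon := hw p' (hdual.mem_dualPoints hS)
    have hw2 : inner ℝ e (w - (x j).1) = -b.coord i w := hg (w, 0)
    have hxj : power p.1 (x j) = -p.2 := h.power_eq j
    -- With `hw2` the difference is `2t` times the negative coordinate of `w`, so `p'` beats `p` at
    -- `w`.
    have e1 : power w p' - power w p = -(2 * t * inner ℝ e (w - (x j).1)) := by
      have hp2 : p.2 = -power p.1 (x j) := by rw [hxj, neg_neg]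
      simp only [hp', power]
      rw [hp2]
      simp only [power]
      have a1 : w - (p.1 + t • e) = (w - p.1) - t • e := by abel
      have a2 : p.1 + t • e - (x j).1 = (p.1 - (x j).1) + t • e := by abel
      have a3 : w - (x j).1 = (w - p.1) + (p.1 - (x j).1) := by abel
      rw [a1, a2, a3, norm_sub_sq_real, norm_add_sq_real, inner_smul_right, inner_smul_right,
        inner_add_right, real_inner_comm e, real_inner_comm e]
      ring
    rw [hw2] at e1
    have := mul_neg_of_pos_of_neg htpos hneg
    linarith
  -- At a vertex the roles are dual: the power of `(x i).1` with respect to `p` is minus the weight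
  -- of `x i`, and with respect to any dual point it is at least that. Convexity extends the
  -- comparison to the hull.
  · intro w hw p' hp'
    refine convexHull_min ?_ (convex_power_le p p') hw
    rintro _ ⟨i, rfl⟩
    have h1 := h.power_eq i
    have h2 : -p'.2 ≤ power p'.1 (x i) := hp'.2.2 (mem_image_of_mem _ (h.mem i))
    simp only [power, mem_ofPred_eq] at h1 h2 ⊢
    rw [norm_sub_rev (x i).1 p.1, norm_sub_rev (x i).1 p'.1]
    linarith

lemma IsDualSimplex.centredCell_eq (hn : 0 < n) {S : Set (EuclideanSpace ℝ (Fin n) × ℝ)}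
    (hS : IsGeneric S) {p : EuclideanSpace ℝ (Fin n) × ℝ}
    {x : Fin (n + 1) → EuclideanSpace ℝ (Fin n) × ℝ} (h : IsDualSimplex S p x) :
    centredCell S p = convexHull ℝ (range fun i => (x i).1 - p.1) := by
  rw [centredCell, h.laguerreCell_eq hn hS]
  have := (AffineMap.id ℝ (EuclideanSpace ℝ (Fin n)) -
    AffineMap.const ℝ (EuclideanSpace ℝ (Fin n)) p.1).image_convexHull
    (range fun i => (x i).1)
  rw [← range_comp] at this
  exact this

end Geometry

end

noncomputable section

/-! ### The volume of a simplex -/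

section SimplexVolume

variable {n : ℕ}

/-- The simplex `{t ≥ 0, ∑ t ≤ s}`. -/
def cornerSimplex (n : ℕ) (s : ℝ) : Set (Fin n → ℝ) := {t | (∀ i, 0 ≤ t i) ∧ ∑ i, t i ≤ s}

lemma isClosed_cornerSimplex (n : ℕ) (s : ℝ) : IsClosed (cornerSimplex n s) := by
  have : cornerSimplex n s = (⋂ i, {t | 0 ≤ t i}) ∩ {t | ∑ i, t i ≤ s} := by
    ext; simp [cornerSimplex]
  rw [this]
  refine (isClosed_iInter fun i => isClosed_le continuous_const (continuous_apply i)).inter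
    (isClosed_le (by fun_prop) continuous_const)

lemma volume_cornerSimplex (n : ℕ) {s : ℝ} (hs : 0 ≤ s) :
    volume (cornerSimplex n s) = ENNReal.ofReal (s ^ n / n.factorial) := by
  induction n generalizing s with
  | zero =>
    have : cornerSimplex 0 s = univ := by ext; simp [cornerSimplex, hs]
    rw [this, volume_pi, Measure.pi_of_empty _ Fin.elim0]
    simp
  | succ n ih =>
    have hpi := (volume_preserving_piFinSuccAbove (fun _ : Fin (n + 1) => ℝ) 0).symm
    rw [← hpi.measure_preimage (isClosed_cornerSimplex _ _).measurableSet.nullMeasurableSet,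
      Measure.volume_eq_prod, Measure.prod_apply (hpi.measurable
        (isClosed_cornerSimplex _ _).measurableSet)]
    have hslice : ∀ a : ℝ, volume (Prod.mk a ⁻¹' ((MeasurableEquiv.piFinSuccAbove
        (fun _ : Fin (n + 1) => ℝ) 0).symm ⁻¹' cornerSimplex (n + 1) s)) =
        (Icc 0 s).indicator (fun a => ENNReal.ofReal ((s - a) ^ n / n.factorial)) a := by
      intro a
      have hset : (Prod.mk a ⁻¹' ((MeasurableEquiv.piFinSuccAbove
        (fun _ : Fin (n + 1) => ℝ) 0).symm ⁻¹' cornerSimplex (n + 1) s)) =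
          {t | 0 ≤ a ∧ t ∈ cornerSimplex n (s - a)} := by
        ext t
        have : (MeasurableEquiv.piFinSuccAbove (fun _ : Fin (n + 1) => ℝ) 0).symm (a, t) =
          Fin.cons a t := Fin.insertNth_zero' a t
        simp only [mem_preimage, this, cornerSimplex, mem_ofPred_eq, Fin.forall_fin_succ,
          Fin.sum_univ_succ, Fin.cons_zero, Fin.cons_succ, and_assoc, le_sub_iff_add_le']
      rw [hset]
      by_cases ha : a ∈ Icc 0 s
      · rw [indicator_of_mem ha, ← ih (sub_nonneg.2 ha.2)]
        simp [ha.1]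
      · rw [indicator_of_notMem ha]
        convert measure_empty (μ := volume)
        ext t
        simp only [mem_ofPred_eq, mem_empty_iff_false, iff_false, cornerSimplex]
        rintro ⟨h0, h1, h2⟩
        exact ha ⟨h0, by linarith [Finset.sum_nonneg fun i (_ : i ∈ Finset.univ) => h1 i]⟩
    simp only [hslice]
    rw [lintegral_indicator measurableSet_Icc, ← ofReal_integral_eq_lintegral_ofReal]
    · congr 1
      rw [integral_Icc_eq_integral_Ioc, ← intervalIntegral.integral_of_le hs,
        intervalIntegral.integral_div, intervalIntegral.integral_comp_sub_left (fun x => x ^ n) s]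
      rw [integral_pow, Nat.factorial_succ]
      have : (n.factorial : ℝ) ≠ 0 := by positivity
      push_cast
      field_simp
      simp
    · exact (by fun_prop : Continuous fun a : ℝ =>
        (s - a) ^ n / n.factorial).continuousOn.integrableOn_compact
        isCompact_Icc
    · refine (ae_restrict_iff' measurableSet_Icc).2 (Filter.Eventually.of_forall fun a ha => ?_)
      have := sub_nonneg.2 ha.2
      simp only [Pi.zero_apply]
      positivity

/-- The matrix with rows `v_i - v_0`, `i = 1, …, n`. -/
def edgeMatrix (v : Fin (n + 1) → EuclideanSpace ℝ (Fin n)) : Matrix (Fin n) (Fin n) ℝ :=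
  Matrix.of fun i j => v i.succ j - v 0 j

lemma convexHull_range_eq_image (v : Fin (n + 1) → EuclideanSpace ℝ (Fin n)) :
    convexHull ℝ (range v) =
      (fun t : Fin n → ℝ => v 0 + ∑ i, t i • (v i.succ - v 0)) '' cornerSimplex n 1 := by
  rw [convexHull_range_eq_exists_affineCombination]
  ext w
  constructor
  · rintro ⟨s, c, hc0, hc1, rfl⟩
    classical
    let c' : Fin (n + 1) → ℝ := fun i => if i ∈ s then c i else 0
    have hc0' : ∀ i, 0 ≤ c' i := fun i => by
      simp only [c']; split_ifs with h
      · exact hc0 i h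
      · exact le_rfl
    have hc1' : ∑ i, c' i = 1 := by simp [c', hc1]
    refine ⟨fun i => c' i.succ, ⟨fun i => hc0' _, ?_⟩, ?_⟩
    · rw [Fin.sum_univ_succ] at hc1'
      linarith [hc0' 0]
    · rw [Finset.affineCombination_eq_linear_combination _ _ _ hc1]
      have h1 : ∑ i ∈ s, c i • v i = ∑ i, c' i • v i := by
        simp [c', ite_smul]
      rw [h1, Fin.sum_univ_succ]
      rw [Fin.sum_univ_succ] at hc1'
      have : c' 0 = 1 - ∑ i : Fin n, c' i.succ := by linarith
      rw [this]
      simp only [smul_sub, Finset.sum_sub_distrib, ← Finset.sum_smul]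
      module
  · rintro ⟨t, ⟨ht0, ht1⟩, rfl⟩
    have hsum : ∑ i, (Fin.cons (1 - ∑ i, t i) t : Fin (n + 1) → ℝ) i = 1 := by
      rw [Fin.sum_univ_succ]; simp
    refine ⟨Finset.univ, Fin.cons (1 - ∑ i, t i) t, ?_, hsum, ?_⟩
    · intro i _
      refine Fin.cases ?_ (fun j => ?_) i
      · simpa using ht1
      · simpa using ht0 j
    · rw [Finset.affineCombination_eq_linear_combination _ _ _ hsum, Fin.sum_univ_succ]
      simp only [Fin.cons_zero, Fin.cons_succ, smul_sub, Finset.sum_sub_distrib, ← Finset.sum_smul]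
      module

lemma volume_convexHull_range (v : Fin (n + 1) → EuclideanSpace ℝ (Fin n)) :
    volume (convexHull ℝ (range v)) = ENNReal.ofReal (|(edgeMatrix v).det| / n.factorial) := by
  have himg : convexHull ℝ (range v) = (fun w => v 0 + w) '' ((WithLp.toLp 2) ''
      (Matrix.toLin' (edgeMatrix v).transpose '' cornerSimplex n 1)) := by
    rw [convexHull_range_eq_image, image_image, image_image]
    refine image_congr fun t _ => ?_
    congr 1
    ext j
    simp [Matrix.toLin'_apply, Matrix.mulVec, dotProduct, edgeMatrix, mul_comm]
  rw [himg, image_add_left, measure_preimage_add, ← WithLp.coe_symm_linearEquiv 2 ℝ]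
  rw [show ((WithLp.linearEquiv 2 ℝ (Fin n → ℝ)).symm : (Fin n → ℝ) → EuclideanSpace ℝ (Fin n)) =
    (MeasurableEquiv.toLp 2 (Fin n → ℝ)) from rfl, MeasurableEquiv.image_eq_preimage_symm,
    (EuclideanSpace.volume_preserving_symm_measurableEquiv_toLp (Fin n)).measure_preimage_equiv,
    Measure.addHaar_image_linearMap, volume_cornerSimplex n zero_le_one, LinearMap.det_toLin',
    Matrix.det_transpose, ← ENNReal.ofReal_mul (abs_nonneg _)]
  congr 1
  ring

/-- The matrix with rows `(1, 2 v_i)`. -/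
def liftMatrix (v : Fin (n + 1) → EuclideanSpace ℝ (Fin n)) :
    Matrix (Fin (n + 1)) (Fin (n + 1)) ℝ :=
  Matrix.of fun i => Fin.cons 1 fun j => 2 * v i j

/-- Subtract the first row from the others and expand along the first column; each of the `n`
remaining columns carries a factor `2`. -/
lemma det_liftMatrix (v : Fin (n + 1) → EuclideanSpace ℝ (Fin n)) :
    (liftMatrix v).det = 2 ^ n * (edgeMatrix v).det := by
  have h : (liftMatrix v).det = (Matrix.of (Fin.cons (liftMatrix v 0)
      (fun i : Fin n => liftMatrix v i.succ - liftMatrix v 0)) :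
        Matrix (Fin (n + 1)) (Fin (n + 1)) ℝ).det := by
    refine Matrix.det_eq_of_forall_row_eq_smul_add_const (Fin.cons 0 fun _ => 1) 0 rfl ?_
    intro i j
    refine Fin.cases ?_ (fun i => ?_) i <;> simp
  rw [h, Matrix.det_succ_column_zero, Fin.sum_univ_succ, Finset.sum_eq_zero]
  · simp only [Fin.val_zero, pow_zero, one_mul, add_zero]
    have : (Matrix.submatrix (Matrix.of (Fin.cons (liftMatrix v 0)
      (fun i : Fin n => liftMatrix v i.succ - liftMatrix v 0)) :
        Matrix (Fin (n + 1)) (Fin (n + 1)) ℝ) (Fin.succAbove 0) Fin.succ) =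
        (2 : ℝ) • edgeMatrix v := by
      ext i j
      simp [liftMatrix, edgeMatrix]
      ring
    rw [this, Matrix.det_smul]
    simp [liftMatrix]
  · intro i _
    simp [liftMatrix]

/-- With `u 0 = K - ‖z‖²` and tail `z`, the condition that `(v, h)` has power `K` at `z` becomes the
linear equation `u 0 + 2⟨z, v⟩ = ‖v‖² + h`. Finding the apex of `n + 1` points is thus a linear
system with this matrix. -/
lemma liftMatrix_mulVec (v : Fin (n + 1) → EuclideanSpace ℝ (Fin n)) (u : Fin (n + 1) → ℝ)
    (i : Fin (n + 1)) :
    (liftMatrix v).mulVec u i = u 0 + 2 * inner ℝ (WithLp.toLp 2 (Fin.tail u)) (v i) := by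
  simp [liftMatrix, Matrix.mulVec, dotProduct, Fin.sum_univ_succ, PiLp.inner_apply, Fin.tail,
    Finset.mul_sum, mul_assoc]

/-- A right kernel vector of the lifted matrix yields a vector orthogonal to all edges, while an
affine dependence is a left kernel vector. -/
lemma affineIndependent_iff_det_ne_zero (v : Fin (n + 1) → EuclideanSpace ℝ (Fin n)) :
    AffineIndependent ℝ v ↔ (edgeMatrix v).det ≠ 0 := by
  have hdet : (edgeMatrix v).det ≠ 0 ↔ (liftMatrix v).det ≠ 0 := by
    rw [det_liftMatrix]; simp
  rw [hdet]
  constructor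
  · intro hv h0
    obtain ⟨u, hu, hMu⟩ := Matrix.exists_mulVec_eq_zero_iff.2 h0
    have h1 : ∀ i, u 0 + 2 * inner ℝ (WithLp.toLp 2 (Fin.tail u)) (v i) = 0 := fun i => by
      rw [← liftMatrix_mulVec, hMu]; rfl
    have h2 : WithLp.toLp 2 (Fin.tail u) = 0 := eq_zero_of_inner_sub_eq_zero hv 0 fun j => by
      rw [inner_sub_right]
      linarith [h1 j, h1 0]
    have h3 : u 0 = 0 := by simpa [h2] using h1 0
    refine hu (funext fun i => ?_)
    refine Fin.cases h3 (fun j => ?_) i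
    have := congrArg (fun w : EuclideanSpace ℝ (Fin n) => w j) h2
    simpa [Fin.tail] using this
  · intro hdet
    rw [affineIndependent_iff_of_fintype]
    intro w hw0 hw
    by_contra hne
    push Not at hne
    refine hdet (Matrix.exists_vecMul_eq_zero_iff.1 ⟨w, fun h => ?_, ?_⟩)
    · obtain ⟨i, hi⟩ := hne
      exact hi (congrFun h i)
    · rw [Finset.weightedVSub_eq_linear_combination _ hw0] at hw
      funext j
      refine Fin.cases ?_ (fun j => ?_) j
      · simpa [Matrix.vecMul, dotProduct, liftMatrix] using hw0
      · have := congrArg (fun w : EuclideanSpace ℝ (Fin n) => 2 * w j) hw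
        simp [Finset.mul_sum] at this
        simp [Matrix.vecMul, dotProduct, liftMatrix]
        rw [← this]
        exact Finset.sum_congr rfl fun i _ => by ring

/-- The dual point of the weighted points with coordinates `v` and weights `h`. -/
def apexOfCoord (u : Fin (n + 1) → ℝ) : EuclideanSpace ℝ (Fin n) × ℝ :=
  (WithLp.toLp 2 (Fin.tail u),
    -(u 0 + ‖(WithLp.toLp 2 (Fin.tail u) : EuclideanSpace ℝ (Fin n))‖ ^ 2))

/-- The coordinates of the paraboloid through the points `x_0, …, x_n`. -/
def apexCoord (x : Fin (n + 1) → EuclideanSpace ℝ (Fin n) × ℝ) : Fin (n + 1) → ℝ :=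
  (liftMatrix fun i => (x i).1)⁻¹.mulVec fun i => ‖(x i).1‖ ^ 2 + (x i).2

/-- The point `(z, -K)` for which all the points `x_i` have the power `K` at `z`. -/
def apex (x : Fin (n + 1) → EuclideanSpace ℝ (Fin n) × ℝ) : EuclideanSpace ℝ (Fin n) × ℝ :=
  apexOfCoord (apexCoord x)

lemma power_apexOfCoord (u : Fin (n + 1) → ℝ) (q : EuclideanSpace ℝ (Fin n) × ℝ) :
    power (apexOfCoord u).1 q + (apexOfCoord u).2 =
      ‖q.1‖ ^ 2 + q.2 - (u 0 + 2 * inner ℝ (apexOfCoord u).1 q.1) := by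
  simp only [power, apexOfCoord]
  rw [norm_sub_sq_real]
  ring

lemma power_apex {x : Fin (n + 1) → EuclideanSpace ℝ (Fin n) × ℝ}
    (hx : AffineIndependent ℝ fun i => (x i).1) (i : Fin (n + 1)) :
    power (apex x).1 (x i) = -(apex x).2 := by
  have hdet : IsUnit (liftMatrix fun i => (x i).1).det := by
    rw [det_liftMatrix]
    exact isUnit_iff_ne_zero.2 (mul_ne_zero (by positivity)
      ((affineIndependent_iff_det_ne_zero _).1 hx))
  have h := power_apexOfCoord (apexCoord x) (x i)
  have h2 := liftMatrix_mulVec (fun i => (x i).1) (apexCoord x) i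
  rw [apexCoord, Matrix.mulVec_mulVec, Matrix.mul_nonsing_inv _ hdet, Matrix.one_mulVec] at h2
  have h3 : (apexOfCoord (apexCoord x)).1 = WithLp.toLp 2 (Fin.tail (apexCoord x)) := rfl
  rw [h3] at h
  simp only [apex]
  unfold apexCoord at *
  rw [h3]
  linarith

lemma eq_of_power_eq {x : Fin (n + 1) → EuclideanSpace ℝ (Fin n) × ℝ}
    (hx : AffineIndependent ℝ fun i => (x i).1) {p p' : EuclideanSpace ℝ (Fin n) × ℝ}
    (h : ∀ i, power p.1 (x i) = -p.2) (h' : ∀ i, power p'.1 (x i) = -p'.2) : p = p' := by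
  have h1 : p'.1 - p.1 = 0 := eq_zero_of_inner_sub_eq_zero hx 0 fun j => by
    have := power_sub_power p'.1 p.1 (x j) (x 0)
    rw [h, h, h', h'] at this
    linarith
  have h2 : p'.1 = p.1 := sub_eq_zero.1 h1
  have h3 := h 0
  have h4 := h' 0
  rw [h2] at h4
  exact Prod.ext h2.symm (by linarith)

end SimplexVolume

/-! ### Sums over dual points as sums over tuples -/

section Counting

variable {n : ℕ}

/-- Genericity makes the contact points of a dual point unique as a set, so each dual point arises
from exactly `(n + 1)!` orderings, all with the same apex. -/
lemma tsum_dualPoints {S : Set (EuclideanSpace ℝ (Fin n) × ℝ)} (hS : IsGeneric S)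
    (Ψ : (Fin (n + 1) → EuclideanSpace ℝ (Fin n) × ℝ) → ℝ≥0∞)
    (Φ : EuclideanSpace ℝ (Fin n) × ℝ → ℝ≥0∞)
    (hΨ : ∀ x, IsDualSimplex S (apex x) x → Ψ x = Φ (apex x))
    (hΨ0 : ∀ x, (∀ i, x i ∈ S) → ¬ IsDualSimplex S (apex x) x → Ψ x = 0) :
    ∑' x : Fin (n + 1) → S, Ψ (fun i => x i) = (n + 1).factorial * ∑' p : dualPoints S, Φ p := by
  classical
  choose X hX using fun p : dualPoints S => exists_isDualSimplex hS.finite p.2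
  have hXp : ∀ p, apex (X p) = p.1 := fun p =>
    eq_of_power_eq (hX p).indep (power_apex (hX p).indep) (hX p).power_eq
  have hinjX : ∀ p, Function.Injective (X p) := fun p i j hij =>
    (hX p).indep.injective (by simp only [hij])
  have hperm : ∀ p (σ : Equiv.Perm (Fin (n + 1))), IsDualSimplex S p.1 (X p ∘ σ) := fun p σ =>
    ⟨fun i => (hX p).mem _, (hX p).indep.comp_embedding σ.toEmbedding, fun i => (hX p).power_eq _,
      (hX p).le_power⟩
  have hpermapex : ∀ p (σ : Equiv.Perm (Fin (n + 1))), apex (X p ∘ σ) = p.1 := fun p σ =>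
    eq_of_power_eq (hperm p σ).indep (power_apex (hperm p σ).indep) (hperm p σ).power_eq
  let D : Set (Fin (n + 1) → S) := {x | IsDualSimplex S (apex fun i => (x i).1) fun i => (x i).1}
  let f : dualPoints S × Equiv.Perm (Fin (n + 1)) → D := fun q =>
    ⟨fun i => ⟨X q.1 (q.2 i), (hX q.1).mem _⟩, by
      change IsDualSimplex S (apex (X q.1 ∘ q.2)) (X q.1 ∘ q.2)
      rw [hpermapex]
      exact hperm q.1 q.2⟩
  have hf : Function.Bijective f := by
    constructor
    · rintro ⟨p, σ⟩ ⟨p', σ'⟩ h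
      have hfun : X p ∘ σ = X p' ∘ σ' := by
        funext i
        exact congrArg Subtype.val (congrFun (congrArg Subtype.val h) i)
      have hp : p = p' := by
        apply Subtype.ext
        rw [← hpermapex p σ, ← hpermapex p' σ', hfun]
      subst hp
      have hσ : σ = σ' := Equiv.ext fun i => hinjX p (congrFun hfun i)
      rw [hσ]
    · rintro ⟨x, hx⟩
      have hx : IsDualSimplex S (apex fun i => (x i).1) fun i => (x i).1 := hx
      let p : dualPoints S := ⟨_, hx.mem_dualPoints hS⟩
      have hr : ∀ i, (x i).1 ∈ range (X p) := fun i =>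
        hS.mem_range _ (hX p).mem (hX p).indep _ _ (hX p).power_eq _ (hx.mem i) (hx.power_eq i)
      choose g hg using hr
      have hginj : Function.Injective g := by
        intro i j hij
        have : (x i).1 = (x j).1 := by rw [← hg i, ← hg j, hij]
        exact hx.indep.injective (by simp only [this])
      refine ⟨(p, Equiv.ofBijective g (Finite.injective_iff_bijective.1 hginj)), ?_⟩
      apply Subtype.ext
      funext i
      apply Subtype.ext
      exact hg i
  have h1 : ∑' x : Fin (n + 1) → S, Ψ (fun i => x i) = ∑' x : D, Φ (apex fun i => (x.1 i).1) := by
    rw [tsum_subtype D fun x : Fin (n + 1) → S => Φ (apex fun i => (x i).1)]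
    refine tsum_congr fun x => ?_
    by_cases hx : x ∈ D
    · rw [indicator_of_mem hx, hΨ _ hx]
    · rw [indicator_of_notMem hx, hΨ0 _ (fun i => (x i).2) hx]
  rw [h1, ← (Equiv.ofBijective f hf).tsum_eq, ENNReal.tsum_prod', ← ENNReal.tsum_mul_left]
  refine tsum_congr fun p => ?_
  have : ∀ σ, Φ (apex fun i => ((f (p, σ)).1 i).1) = Φ p := fun σ => by
    rw [← hpermapex p σ]; rfl
  simp only [Equiv.ofBijective_apply, this]
  rw [tsum_fintype, Finset.sum_const, Finset.card_univ, Fintype.card_perm, Fintype.card_fin,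
    nsmul_eq_mul]

end Counting

end

noncomputable section

/-! ### The intensity measure -/

section Intensity

variable {n : ℕ} {c : ℝ}

/-- The measure with density `c e^(h/2)` at `(v, h)`. -/
def expIntensity (n : ℕ) (c : ℝ) : Measure (EuclideanSpace ℝ (Fin n) × ℝ) :=
  volume.withDensity fun x => ENNReal.ofReal (c * Real.exp (x.2 / 2))

lemma measurable_expIntensity_density :
    Measurable fun x : EuclideanSpace ℝ (Fin n) × ℝ => ENNReal.ofReal (c * Real.exp (x.2 / 2)) := by
  fun_prop

instance sigmaFinite_expIntensity : SigmaFinite (expIntensity n c) :=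
  SigmaFinite.withDensity_ofReal _

instance nullSingletonClass_expIntensity : NullSingletonClass (expIntensity n c) := by
  unfold expIntensity
  rw [Measure.volume_eq_prod]
  infer_instance

lemma expIntensity_apply {B : Set (EuclideanSpace ℝ (Fin n) × ℝ)} (hB : MeasurableSet B) :
    expIntensity n c B =
      ∫⁻ v, ∫⁻ h in {h | (v, h) ∈ B}, ENNReal.ofReal (c * Real.exp (h / 2)) := by
  rw [expIntensity, withDensity_apply _ hB, ← lintegral_indicator hB, Measure.volume_eq_prod,
    lintegral_prod _ ((measurable_expIntensity_density.indicator hB).aemeasurable)]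
  refine lintegral_congr fun v => ?_
  have hBv : MeasurableSet {h | (v, h) ∈ B} := measurable_prodMk_left hB
  rw [← lintegral_indicator hBv]
  rfl

lemma lintegral_Iic_exp_half (hc : 0 ≤ c) (a : ℝ) :
    ∫⁻ h in Iic a, ENNReal.ofReal (c * Real.exp (h / 2)) =
      ENNReal.ofReal (2 * c * Real.exp (a / 2)) := by
  have hintg : IntegrableOn (fun h : ℝ => c * Real.exp (h / 2)) (Iic a) := by
    have := (integrableOn_exp_mul_Iic (a := 1 / 2) (by norm_num) a).const_mul c
    refine this.congr (Filter.Eventually.of_forall fun h => ?_)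
    simp only
    ring_nf
  rw [← ofReal_integral_eq_lintegral_ofReal hintg
    (Filter.Eventually.of_forall fun h => by simp only [Pi.zero_apply]; positivity)]
  congr 1
  rw [integral_const_mul]
  have := integral_exp_mul_Iic (a := 1 / 2) (by norm_num) a
  have e : ∀ h : ℝ, Real.exp (h / 2) = Real.exp (1 / 2 * h) := fun h => by ring_nf
  simp only [e]
  rw [this]
  ring

lemma integrable_exp_neg_mul_norm_sq {V : Type*} [NormedAddCommGroup V] [InnerProductSpace ℝ V]
    [FiniteDimensional ℝ V] [MeasurableSpace V] [BorelSpace V] {b : ℝ} (hb : 0 < b) :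
    Integrable fun v : V => Real.exp (-b * ‖v‖ ^ 2) := by
  -- The integral of a non-integrable function is `0` by convention, whereas this one has a positive
  -- value.
  refine not_imp_comm.1 integral_undef ?_
  rw [GaussianFourier.integral_rexp_neg_mul_sq_norm hb]
  positivity

lemma lintegral_exp_neg_mul_norm_sq {V : Type*} [NormedAddCommGroup V] [InnerProductSpace ℝ V]
    [FiniteDimensional ℝ V] [MeasurableSpace V] [BorelSpace V] {b : ℝ} (hb : 0 < b) :
    ∫⁻ v : V, ENNReal.ofReal (Real.exp (-b * ‖v‖ ^ 2)) =
      ENNReal.ofReal ((Real.pi / b) ^ (Module.finrank ℝ V / 2 : ℝ)) := by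
  rw [← ofReal_integral_eq_lintegral_ofReal (integrable_exp_neg_mul_norm_sq hb)
    (Filter.Eventually.of_forall fun h => by simp only [Pi.zero_apply]; positivity),
    GaussianFourier.integral_rexp_neg_mul_sq_norm hb]

lemma measurableSet_window (m : ℕ) : MeasurableSet (window n m) :=
  measurableSet_le (by fun_prop) measurable_const

lemma iUnion_window : ⋃ m, window n m = univ := by
  refine eq_univ_of_forall fun x => ?_
  obtain ⟨m, hm⟩ := exists_nat_ge (‖x.1‖ ^ 2 / 2 + x.2)
  exact mem_iUnion.2 ⟨m, hm⟩

/-- The quadratic term in the window turns the integral over heights into a Gaussian in `v`, with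
finite mass. -/
lemma expIntensity_window_ne_top (hc : 0 ≤ c) (m : ℕ) : expIntensity n c (window n m) ≠ ⊤ := by
  rw [expIntensity_apply (measurableSet_window m)]
  have : ∀ v : EuclideanSpace ℝ (Fin n), ∫⁻ h in {h | (v, h) ∈ window n m},
      ENNReal.ofReal (c * Real.exp (h / 2)) =
      ENNReal.ofReal (2 * c * Real.exp (m / 2)) *
        ENNReal.ofReal (Real.exp (-(1 / 4) * ‖v‖ ^ 2)) := by
    intro v
    have hs : {h | (v, h) ∈ window n m} = Iic ((m : ℝ) - ‖v‖ ^ 2 / 2) := by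
      ext h
      simp only [window, mem_ofPred_eq, mem_Iic]
      constructor <;> intro <;> linarith
    rw [hs, lintegral_Iic_exp_half hc, ← ENNReal.ofReal_mul (by positivity), mul_assoc (2 * c),
      ← Real.exp_add]
    ring_nf
  simp only [this]
  rw [lintegral_const_mul _ (by fun_prop), lintegral_exp_neg_mul_norm_sq (by norm_num)]
  exact ENNReal.mul_ne_top ENNReal.ofReal_ne_top ENNReal.ofReal_ne_top

lemma measurable_power (z : EuclideanSpace ℝ (Fin n)) : Measurable fun q => power z q := by
  unfold power
  fun_prop

/-- Integrating out the height gives `2c e^((K - ‖v - z‖²)/2)`, and the Gaussian integral over `v`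
gives `(2π)^(n/2)`. Translation removes `z`, so the void probability depends on `K` only. -/
lemma expIntensity_power_lt (hc : 0 ≤ c) (z : EuclideanSpace ℝ (Fin n)) (K : ℝ) :
    expIntensity n c {q | power z q < K} =
      ENNReal.ofReal (2 * c * (2 * Real.pi) ^ ((n : ℝ) / 2) * Real.exp (K / 2)) := by
  rw [expIntensity_apply (measurableSet_lt (measurable_power z) measurable_const)]
  have : ∀ v : EuclideanSpace ℝ (Fin n), ∫⁻ h in {h | (v, h) ∈ {q | power z q < K}},
      ENNReal.ofReal (c * Real.exp (h / 2)) =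
      ENNReal.ofReal (2 * c * Real.exp (K / 2)) *
        ENNReal.ofReal (Real.exp (-(1 / 2) * ‖v - z‖ ^ 2)) := by
    intro v
    have hs : {h | (v, h) ∈ {q | power z q < K}} = Iio (K - ‖v - z‖ ^ 2) := by
      ext h
      simp only [power, mem_ofPred_eq, mem_Iio, norm_sub_rev z v]
      constructor <;> intro <;> linarith
    rw [hs, setLIntegral_congr Iio_ae_eq_Iic, lintegral_Iic_exp_half hc,
      ← ENNReal.ofReal_mul (by positivity), mul_assoc (2 * c), ← Real.exp_add]
    ring_nf
  simp only [this]
  rw [lintegral_const_mul _ (by fun_prop), lintegral_sub_right_eq_self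
    (fun v => ENNReal.ofReal (Real.exp (-(1 / 2) * ‖v‖ ^ 2))) z,
    lintegral_exp_neg_mul_norm_sq (by norm_num), ← ENNReal.ofReal_mul (by positivity)]
  congr 1
  rw [finrank_euclideanSpace_fin, show Real.pi / (1 / 2) = 2 * Real.pi by ring]
  ring

lemma expIntensity_power_eq (z : EuclideanSpace ℝ (Fin n)) (K : ℝ) :
    expIntensity n c {q | power z q = K} = 0 := by
  rw [expIntensity_apply (measurableSet_eq_fun (measurable_power z) measurable_const)]
  have : ∀ v : EuclideanSpace ℝ (Fin n), ∫⁻ h in {h | (v, h) ∈ {q | power z q = K}},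
      ENNReal.ofReal (c * Real.exp (h / 2)) = 0 := by
    intro v
    refine setLIntegral_measure_zero _ _ ?_
    have hs : {h | (v, h) ∈ {q | power z q = K}} = {K - ‖z - v‖ ^ 2} := by
      ext h
      simp only [power, mem_ofPred_eq, mem_singleton_iff]
      constructor <;> intro <;> linarith
    rw [hs, measure_singleton]
  simp only [this, lintegral_zero]

lemma expIntensity_cylinder_eq_top (hc : 0 < c) {U : Set (EuclideanSpace ℝ (Fin n))}
    (hU : MeasurableSet U) (hU0 : volume U ≠ 0) : expIntensity n c (U ×ˢ univ) = ⊤ := by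
  have h1 : ∫⁻ x in U ×ˢ Ici (0 : ℝ), ENNReal.ofReal c ≤
      expIntensity n c (U ×ˢ univ) := by
    rw [expIntensity, withDensity_apply _ (hU.prod .univ)]
    refine (setLIntegral_mono measurable_expIntensity_density fun x hx => ?_).trans
      (lintegral_mono_set (prod_mono_right (subset_univ _)))
    refine ENNReal.ofReal_le_ofReal ?_
    have : 1 ≤ Real.exp (x.2 / 2) := Real.one_le_exp (by have := hx.2; simp at this; linarith)
    nlinarith
  rw [setLIntegral_const, Measure.volume_eq_prod, Measure.prod_prod, Real.volume_Ici,
    ENNReal.mul_top hU0, ENNReal.mul_top (by simpa using hc)] at h1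
  exact top_le_iff.1 h1

end Intensity

/-! ### Measurability of the apex -/

section ApexMeasurable

variable {n : ℕ}

lemma continuous_liftMatrix :
    Continuous fun v : Fin (n + 1) → EuclideanSpace ℝ (Fin n) => liftMatrix v := by
  refine continuous_matrix fun i j => ?_
  refine Fin.cases ?_ (fun j => ?_) j
  · simpa [liftMatrix] using continuous_const
  · simp only [liftMatrix, Matrix.of_apply, Fin.cons_succ]
    fun_prop

lemma continuous_det_edgeMatrix :
    Continuous fun v : Fin (n + 1) → EuclideanSpace ℝ (Fin n) => (edgeMatrix v).det := by
  refine Continuous.matrix_det (continuous_matrix fun i j => ?_)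
  simp only [edgeMatrix, Matrix.of_apply]
  fun_prop

/-- The matrix inverse equals `det⁻¹` times the adjugate, also for singular matrices with `0⁻¹ = 0`,
so no case distinction is needed. -/
lemma measurable_apexCoord : Measurable (apexCoord (n := n)) := by
  refine measurable_pi_lambda _ fun i => ?_
  have : ∀ x : Fin (n + 1) → EuclideanSpace ℝ (Fin n) × ℝ, apexCoord x i =
      (liftMatrix fun i => (x i).1).det⁻¹ * (liftMatrix fun i => (x i).1).adjugate.mulVec
        (fun i => ‖(x i).1‖ ^ 2 + (x i).2) i := by
    intro x
    rw [apexCoord, Matrix.inv_def, Ring.inverse_eq_inv', Matrix.smul_mulVec, Pi.smul_apply,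
      smul_eq_mul]
  simp only [this]
  have hc : Continuous fun x : Fin (n + 1) → EuclideanSpace ℝ (Fin n) × ℝ =>
      liftMatrix fun i => (x i).1 := continuous_liftMatrix.comp (by fun_prop)
  refine (hc.matrix_det.measurable.inv).mul ?_
  have h2 := hc.matrix_adjugate.matrix_mulVec
    (B := fun x : Fin (n + 1) → EuclideanSpace ℝ (Fin n) × ℝ =>
    fun i => ‖(x i).1‖ ^ 2 + (x i).2) (by fun_prop)
  exact ((continuous_apply i).comp h2).measurable

lemma measurable_apexOfCoord : Measurable (apexOfCoord (n := n)) := by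
  unfold apexOfCoord Fin.tail
  fun_prop

lemma measurable_apex : Measurable (apex (n := n)) :=
  measurable_apexOfCoord.comp measurable_apexCoord

lemma measurable_power_apex : Measurable fun p : (Fin (n + 1) → EuclideanSpace ℝ (Fin n) × ℝ) ×
    (EuclideanSpace ℝ (Fin n) × ℝ) => power (apex p.1).1 p.2 + (apex p.1).2 := by
  have h : Measurable fun p : (Fin (n + 1) → EuclideanSpace ℝ (Fin n) × ℝ) ×
    (EuclideanSpace ℝ (Fin n) × ℝ) => apex p.1 := measurable_apex.comp measurable_fst
  exact (((h.fst.sub measurable_snd.fst).norm.pow_const 2).add measurable_snd.snd).add h.snd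

lemma measurableSet_indep : MeasurableSet {x : Fin (n + 1) → EuclideanSpace ℝ (Fin n) × ℝ |
    AffineIndependent ℝ fun i => (x i).1} := by
  simp only [affineIndependent_iff_det_ne_zero]
  exact ((continuous_det_edgeMatrix.comp (by fun_prop)).measurable
    (measurableSet_singleton 0)).compl

end ApexMeasurable

end

noncomputable section

/-! ### Almost sure properties of the Poisson process, and the Mecke formula for dual points -/

section AlmostSure

variable {n : ℕ} {c : ℝ} {Ω : Type*} [MeasurableSpace Ω] {P : Measure Ω}
  {ζ : Ω → Measure (EuclideanSpace ℝ (Fin n) × ℝ)}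

lemma IsPoissonPointProcess.ae_window_lt_top (hc : 0 < c)
    (hζ : IsPoissonPointProcess P ζ (expIntensity n c)) :
    ∀ᵐ ω ∂P, ∀ m, ζ ω (window n m) < ⊤ :=
  ae_all_iff.2 fun m => hζ.ae_lt_top (measurableSet_window m) (expIntensity_window_ne_top hc.le m)

lemma IsPoissonPointProcess.ae_eq_top {X : Type*} [MeasurableSpace X] {η : Ω → Measure X}
    {μ : Measure X} (hη : IsPoissonPointProcess P η μ) {B : Set X} (hB : MeasurableSet B)
    (hμ : μ B = ⊤) : ∀ᵐ ω ∂P, η ω B = ⊤ := by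
  rw [ae_iff]
  rw [(hη.poisson B hB).measure_eq (p := fun t => ¬ t = ⊤) (measurableSet_singleton ⊤).compl,
    poissonLaw, if_pos hμ]
  change Measure.dirac ⊤ {⊤}ᶜ = 0
  simp

lemma IsPoissonPointProcess.ae_eq_zero {X : Type*} [MeasurableSpace X] {η : Ω → Measure X}
    {μ : Measure X} (hη : IsPoissonPointProcess P η μ) {B : Set X} (hB : MeasurableSet B)
    (hμ : μ B = 0) : ∀ᵐ ω ∂P, η ω B = 0 := by
  rw [ae_iff]
  rw [(hη.poisson B hB).measure_eq (p := fun t => ¬ t = 0) (measurableSet_singleton 0).compl, hμ]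
  change poissonLaw 0 {0}ᶜ = 0
  rw [prob_compl_eq_zero_iff (measurableSet_singleton 0), poissonLaw_singleton_zero (by simp)]
  simp

/-- The cylinder over any ball has infinite intensity, so almost surely all cylinders over unit
balls with centres in a countable dense set are hit, and every open half-space contains such a ball.
-/
lemma IsPoissonPointProcess.ae_halfspace (hc : 0 < c)
    (hζ : IsPoissonPointProcess P ζ (expIntensity n c)) :
    ∀ᵐ ω ∂P, ∀ e : EuclideanSpace ℝ (Fin n), e ≠ 0 → ∀ a : ℝ,
      ∃ x ∈ points (ζ ω), a < inner ℝ e x.1 := by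
  have h : ∀ᵐ ω ∂P, ∀ k : ℕ,
      ζ ω (Metric.ball (denseSeq (EuclideanSpace ℝ (Fin n)) k) 1 ×ˢ univ) = ⊤ :=
    ae_all_iff.2 fun k => hζ.ae_eq_top (measurableSet_ball.prod .univ)
      (expIntensity_cylinder_eq_top hc measurableSet_ball (Metric.measure_ball_pos _ _ one_pos).ne')
  filter_upwards [h, hζ.ae_window_lt_top hc] with ω hω hfin e he a
  have he' : 0 < ‖e‖ := norm_pos_iff.2 he
  -- Chosen so that `⟨e, y⟩ = a + 2‖e‖`; a point at distance less than `2` from `y` is then still in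
  -- the half-space.
  let y : EuclideanSpace ℝ (Fin n) := ((a + 2 * ‖e‖) / ‖e‖ ^ 2) • e
  obtain ⟨k, hk⟩ := (denseRange_denseSeq (EuclideanSpace ℝ (Fin n))).exists_dist_lt y one_pos
  have hne : ζ ω (Metric.ball (denseSeq (EuclideanSpace ℝ (Fin n)) k) 1 ×ˢ univ) ≠ 0 := by
    rw [hω k]; simp
  rw [Ne, (hζ.counting ω).apply_eq_zero_iff measurableSet_window iUnion_window hfin] at hne
  push Not at hne
  obtain ⟨x, hx, hxb⟩ := hne
  refine ⟨x, hx, ?_⟩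
  have hdist : ‖x.1 - y‖ < 2 := by
    rw [← dist_eq_norm]
    have h1 := hxb.1
    rw [Metric.mem_ball] at h1
    have h2 := dist_triangle x.1 (denseSeq _ k) y
    rw [dist_comm y] at hk
    linarith
  have h3 : inner ℝ e y = a + 2 * ‖e‖ := by
    simp only [y, inner_smul_right, real_inner_self_eq_norm_sq]
    field_simp
  have h4 : inner ℝ e x.1 = inner ℝ e y + inner ℝ e (x.1 - y) := by
    rw [← inner_add_right, add_sub_cancel]
  have h5 : |inner ℝ e (x.1 - y)| ≤ ‖e‖ * ‖x.1 - y‖ := abs_real_inner_le_norm _ _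
  have h6 := (abs_le.1 h5).1
  nlinarith

lemma injective_of_affineIndependent_fst {x : Fin (n + 1) → EuclideanSpace ℝ (Fin n) × ℝ}
    (hx : AffineIndependent ℝ fun i => (x i).1) : Function.Injective x :=
  fun i j hij => hx.injective (by simp only [hij])

/-- The points on the paraboloid through `x_0, …, x_n`, other than these points. -/
def paraboloid (x : Fin (n + 1) → EuclideanSpace ℝ (Fin n) × ℝ) :
    Set (EuclideanSpace ℝ (Fin n) × ℝ) :=
  {q | power (apex x).1 q + (apex x).2 = 0 ∧ ∀ i, q ≠ x i}

/-- The points strictly below the paraboloid through `x_0, …, x_n`. -/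
def belowParaboloid (x : Fin (n + 1) → EuclideanSpace ℝ (Fin n) × ℝ) :
    Set (EuclideanSpace ℝ (Fin n) × ℝ) :=
  {q | power (apex x).1 q + (apex x).2 < 0}

lemma measurable_locallyFinitePart_section {X Y : Type*} [MeasurableSpace X] [MeasurableSpace Y]
    {W : ℕ → Set X} (hW : ∀ m, MeasurableSet (W m)) (hU : ⋃ m, W m = univ) {D : Set (Y × X)}
    (hD : MeasurableSet D) :
    Measurable fun p : Y × Measure X => locallyFinitePart W p.2 {q | (p.1, q) ∈ D} := by
  have hK := isSFiniteKernel_pointKernel hW hU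
  exact Kernel.measurable_kernel_prodMk_left (κ := (pointKernel W hW).comap
        (Prod.snd : Y × Measure X → Measure X) measurable_snd)
        (t := {r | (r.1.1, r.2) ∈ D}) ((measurable_fst.fst.prodMk measurable_snd) hD)

lemma measurableSet_paraboloid : MeasurableSet {p : (Fin (n + 1) → EuclideanSpace ℝ (Fin n) × ℝ) ×
    (EuclideanSpace ℝ (Fin n) × ℝ) | p.2 ∈ paraboloid p.1} := by
  have : {p : (Fin (n + 1) → EuclideanSpace ℝ (Fin n) × ℝ) × (EuclideanSpace ℝ (Fin n) × ℝ) |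
      p.2 ∈ paraboloid p.1} = {p | power (apex p.1).1 p.2 + (apex p.1).2 = 0} ∩
        ⋂ i, {p | p.2 = p.1 i}ᶜ := by
    ext; simp [paraboloid]
  rw [this]
  refine (measurable_power_apex (measurableSet_singleton 0)).inter
    (MeasurableSet.iInter fun i => (measurableSet_eq_fun measurable_snd
      ((measurable_pi_apply i).comp measurable_fst)).compl)

lemma measurableSet_belowParaboloid :
    MeasurableSet {p : (Fin (n + 1) → EuclideanSpace ℝ (Fin n) × ℝ) ×
      (EuclideanSpace ℝ (Fin n) × ℝ) | p.2 ∈ belowParaboloid p.1} :=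
  measurable_power_apex measurableSet_Iio

variable [IsProbabilityMeasure P]

/-- By the Mecke formula the expected number of further points on the paraboloid through a tuple is
an integral of the intensity of the paraboloid, which is zero because each vertical line meets it in
a single height. -/
lemma IsPoissonPointProcess.ae_mem_range (hc : 0 < c)
    (hζ : IsPoissonPointProcess P ζ (expIntensity n c)) :
    ∀ᵐ ω ∂P, ∀ x : Fin (n + 1) → EuclideanSpace ℝ (Fin n) × ℝ, (∀ i, x i ∈ points (ζ ω)) →
    AffineIndependent ℝ (fun i => (x i).1) → ∀ w K, (∀ i, power w (x i) = K) →
    ∀ q ∈ points (ζ ω), power w q = K → q ∈ range x := by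
  set W := window n
  have hW : ∀ m, MeasurableSet (W m) := measurableSet_window
  have hU : ⋃ m, W m = univ := iUnion_window
  have hμ := expIntensity_window_ne_top (n := n) hc.le
  have hT := isSFiniteKernel_tupleKernel (hW := hW) hU (n + 1)
  set F : (Fin (n + 1) → EuclideanSpace ℝ (Fin n) × ℝ) ×
      Measure (EuclideanSpace ℝ (Fin n) × ℝ) → ℝ≥0∞ := fun p =>
    {x : Fin (n + 1) → EuclideanSpace ℝ (Fin n) × ℝ |
      AffineIndependent ℝ fun i => (x i).1}.indicator 1 p.1 *
      locallyFinitePart W p.2 (paraboloid p.1) with hF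
  have hFm : Measurable F := ((measurable_one.indicator measurableSet_indep).comp
    measurable_fst).mul (measurable_locallyFinitePart_section hW hU measurableSet_paraboloid)
  have hinj : ∀ y ξ, ¬ Function.Injective y → F (y, ξ) = 0 := by
    intro y ξ hy
    simp only [hF]
    rw [indicator_of_notMem (fun h => hy (injective_of_affineIndependent_fst h)), zero_mul]
  have h := hζ.lintegral_tupleKernel hW hU hμ (n + 1) hFm hinj
  have hR : ∀ y : Fin (n + 1) → EuclideanSpace ℝ (Fin n) × ℝ,
      ∫⁻ ω, F (y, ζ ω + ∑ i, Measure.dirac (y i)) ∂P = 0 := by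
    intro y
    have hpm : MeasurableSet (paraboloid y) := measurable_prodMk_left measurableSet_paraboloid
    have hz : ∀ᵐ ω ∂P, ζ ω (paraboloid y) = 0 := by
      refine hζ.ae_eq_zero hpm (measure_mono_null (fun q hq => ?_)
        (expIntensity_power_eq (c := c) (apex y).1 (-(apex y).2)))
      have := hq.1
      simp only [mem_ofPred_eq]
      linarith
    rw [lintegral_congr_ae (g := fun _ => 0), lintegral_zero]
    filter_upwards [hz, hζ.ae_window_lt_top hc] with ω hω hfin
    simp only [hF]
    rw [locallyFinitePart_of_lt_top]
    · rw [Measure.add_apply, hω, Measure.finsetSum_apply, Finset.sum_eq_zero]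
      · simp
      · intro i _
        rw [Measure.dirac_apply' _ hpm, indicator_of_notMem]
        exact fun hi => hi.2 i rfl
    · intro m
      rw [Measure.add_apply, Measure.finsetSum_apply]
      exact ENNReal.add_lt_top.2 ⟨hfin m, ENNReal.sum_lt_top.2 fun i _ => measure_lt_top _ _⟩
  simp only [hR, lintegral_zero] at h
  have hLm : Measurable fun ω => ∫⁻ y, F (y, ζ ω) ∂tupleKernel W hW (n + 1) (ζ ω) :=
    Measurable.lintegral_kernel_prod_right (κ := (tupleKernel W hW (n + 1)).comap ζ hζ.measurable)
      (f := fun ω y => F (y, ζ ω))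
      (hFm.comp (measurable_snd.prodMk (hζ.measurable.comp measurable_fst)))
  rw [lintegral_eq_zero_iff hLm] at h
  filter_upwards [h, hζ.ae_window_lt_top hc, hζ.ae_simple hW hU hμ] with ω hω hfin hs
  have hFω : Measurable fun y => F (y, ζ ω) := hFm.comp (measurable_id.prodMk measurable_const)
  rw [(hζ.counting ω).lintegral_tupleKernel_eq_tsum hW hU hfin hs _ hFω] at hω
  simp only [Pi.zero_apply, ENNReal.tsum_eq_zero] at hω
  intro x hx hind w K hpow q hq hqK
  have h1 := hω fun i => ⟨x i, hx i⟩
  simp only [hF] at h1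
  rw [indicator_of_mem (show x ∈ {x : Fin (n + 1) → EuclideanSpace ℝ (Fin n) × ℝ |
      AffineIndependent ℝ fun i => (x i).1} from hind), Pi.one_apply, one_mul,
    locallyFinitePart_of_lt_top hfin,
    (hζ.counting ω).apply_eq_zero_iff hW hU hfin] at h1
  by_contra hqr
  refine h1 q hq ⟨?_, fun i hi => hqr ⟨i, hi.symm⟩⟩
  have h2 : apex x = (w, -K) := eq_of_power_eq hind (power_apex hind) (by simpa using hpow)
  rw [h2]
  simp [hqK]

lemma IsPoissonPointProcess.ae_isGeneric (hc : 0 < c)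
    (hζ : IsPoissonPointProcess P ζ (expIntensity n c)) :
    ∀ᵐ ω ∂P, IsGeneric (points (ζ ω)) := by
  filter_upwards [hζ.ae_window_lt_top hc, hζ.ae_halfspace hc, hζ.ae_mem_range hc] with ω h1 h2 h3
  exact ⟨fun m => (hζ.counting ω).finite_points_inter (h1 m).ne, h2, h3⟩

/-- The expectation of a sum over the dual points, as an integral over `n + 1` points. -/
theorem IsPoissonPointProcess.lintegral_tsum_dualPoints (hc : 0 < c)
    (hζ : IsPoissonPointProcess P ζ (expIntensity n c))
    {g : (Fin (n + 1) → EuclideanSpace ℝ (Fin n) × ℝ) → ℝ≥0∞} (hg : Measurable g)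
    (Φ : Ω → EuclideanSpace ℝ (Fin n) × ℝ → ℝ≥0∞)
    (hΦ : ∀ ω, IsGeneric (points (ζ ω)) → ∀ x, IsDualSimplex (points (ζ ω)) (apex x) x →
      g x = Φ ω (apex x)) :
    ((n + 1).factorial : ℝ≥0∞) * ∫⁻ ω, ∑' p : dualPoints (points (ζ ω)), Φ ω p ∂P =
      ∫⁻ x, {x : Fin (n + 1) → EuclideanSpace ℝ (Fin n) × ℝ |
        AffineIndependent ℝ fun i => (x i).1}.indicator
        (fun x => g x * ENNReal.ofReal (Real.exp (-(2 * c * (2 * Real.pi) ^ ((n : ℝ) / 2) *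
          Real.exp (-(apex x).2 / 2))))) x ∂Measure.pi fun _ => expIntensity n c := by
  set W := window n
  have hW : ∀ m, MeasurableSet (W m) := measurableSet_window
  have hU : ⋃ m, W m = univ := iUnion_window
  have hμ := expIntensity_window_ne_top (n := n) hc.le
  -- `F` selects the tuples that form a dual simplex: independence, and no point of the process
  -- strictly below the paraboloid.
  set F : (Fin (n + 1) → EuclideanSpace ℝ (Fin n) × ℝ) ×
      Measure (EuclideanSpace ℝ (Fin n) × ℝ) → ℝ≥0∞ := fun p =>
    {x : Fin (n + 1) → EuclideanSpace ℝ (Fin n) × ℝ |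
      AffineIndependent ℝ fun i => (x i).1}.indicator g p.1 *
      ({0} : Set ℝ≥0∞).indicator 1 (locallyFinitePart W p.2 (belowParaboloid p.1)) with hF
  have hFm : Measurable F := ((hg.indicator measurableSet_indep).comp
    measurable_fst).mul ((measurable_one.indicator (measurableSet_singleton 0)).comp
      (measurable_locallyFinitePart_section hW hU measurableSet_belowParaboloid))
  have hinj : ∀ y ξ, ¬ Function.Injective y → F (y, ξ) = 0 := by
    intro y ξ hy
    simp only [hF]
    rw [indicator_of_notMem (fun h => hy (injective_of_affineIndependent_fst h)), zero_mul]
  have h := hζ.lintegral_tupleKernel hW hU hμ (n + 1) hFm hinj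
  have hL : ∀ᵐ ω ∂P, ∫⁻ y, F (y, ζ ω) ∂tupleKernel W hW (n + 1) (ζ ω) =
      (n + 1).factorial * ∑' p : dualPoints (points (ζ ω)), Φ ω p := by
    filter_upwards [hζ.ae_isGeneric hc, hζ.ae_window_lt_top hc, hζ.ae_simple hW hU hμ]
      with ω hgen hfin hs
    have hFω : Measurable fun y => F (y, ζ ω) := hFm.comp (measurable_id.prodMk measurable_const)
    rw [(hζ.counting ω).lintegral_tupleKernel_eq_tsum hW hU hfin hs _ hFω]
    have hbelow : ∀ x, ζ ω (belowParaboloid x) = 0 ↔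
        ∀ q ∈ points (ζ ω), -(apex x).2 ≤ power (apex x).1 q := by
      intro x
      rw [(hζ.counting ω).apply_eq_zero_iff hW hU hfin]
      refine forall₂_congr fun q _ => ?_
      simp only [belowParaboloid, mem_ofPred_eq, not_lt]
      constructor <;> intro <;> linarith
    refine tsum_dualPoints hgen (fun x => F (x, ζ ω)) (Φ ω) ?_ ?_
    · intro x hx
      simp only [hF]
      rw [indicator_of_mem (show x ∈ {x : Fin (n + 1) → EuclideanSpace ℝ (Fin n) × ℝ |
        AffineIndependent ℝ fun i => (x i).1} from hx.indep), hΦ ω hgen x hx,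
        locallyFinitePart_of_lt_top hfin, (hbelow x).2 hx.le_power]
      simp
    · intro x hxS hx
      simp only [hF]
      by_cases hind : AffineIndependent ℝ fun i => (x i).1
      · rw [locallyFinitePart_of_lt_top hfin, indicator_of_notMem (s := {0}), mul_zero]
        intro h0
        exact hx ⟨hxS, hind, power_apex hind, (hbelow x).1 h0⟩
      · rw [indicator_of_notMem (show x ∉ {x : Fin (n + 1) → EuclideanSpace ℝ (Fin n) × ℝ |
          AffineIndependent ℝ fun i => (x i).1} from hind), zero_mul]
  rw [← lintegral_const_mul' _ _ (by simp), ← lintegral_congr_ae hL, h]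
  refine lintegral_congr fun x => ?_
  by_cases hind : AffineIndependent ℝ fun i => (x i).1
  swap
  · simp only [hF]
    rw [indicator_of_notMem (show x ∉ {x : Fin (n + 1) → EuclideanSpace ℝ (Fin n) × ℝ |
      AffineIndependent ℝ fun i => (x i).1} from hind), indicator_of_notMem (show x ∉
      {x : Fin (n + 1) → EuclideanSpace ℝ (Fin n) × ℝ |
      AffineIndependent ℝ fun i => (x i).1} from hind)]
    simp
  rw [indicator_of_mem (show x ∈ {x : Fin (n + 1) → EuclideanSpace ℝ (Fin n) × ℝ |
        AffineIndependent ℝ fun i => (x i).1} from hind)]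
  have hbm : MeasurableSet (belowParaboloid x) :=
    measurable_prodMk_left measurableSet_belowParaboloid
  have hae : ∀ᵐ ω ∂P, F (x, ζ ω + ∑ i, Measure.dirac (x i)) =
      g x * ({0} : Set ℝ≥0∞).indicator 1 (ζ ω (belowParaboloid x)) := by
    filter_upwards [hζ.ae_window_lt_top hc] with ω hfin
    simp only [hF]
    rw [indicator_of_mem (show x ∈ {x : Fin (n + 1) → EuclideanSpace ℝ (Fin n) × ℝ |
        AffineIndependent ℝ fun i => (x i).1} from hind), locallyFinitePart_of_lt_top]
    -- The added points lie on the paraboloid and not strictly below it, so they do not spoil the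
    -- void event.
    · rw [Measure.add_apply, Measure.finsetSum_apply, Finset.sum_eq_zero, add_zero]
      intro i _
      rw [Measure.dirac_apply' _ hbm, indicator_of_notMem]
      simp only [belowParaboloid, mem_ofPred_eq, power_apex hind]
      simp
    · intro m
      rw [Measure.add_apply, Measure.finsetSum_apply]
      exact ENNReal.add_lt_top.2 ⟨hfin m, ENNReal.sum_lt_top.2 fun i _ => measure_lt_top _ _⟩
  have hm0 : Measurable fun ω => ({0} : Set ℝ≥0∞).indicator (1 : ℝ≥0∞ → ℝ≥0∞)
      (ζ ω (belowParaboloid x)) :=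
    (measurable_one.indicator (measurableSet_singleton 0)).comp (hζ.measurable_apply hbm)
  rw [lintegral_congr_ae hae, lintegral_const_mul _ hm0]
  congr 1
  have hvoid : expIntensity n c (belowParaboloid x) =
      ENNReal.ofReal (2 * c * (2 * Real.pi) ^ ((n : ℝ) / 2) * Real.exp (-(apex x).2 / 2)) := by
    rw [← expIntensity_power_lt hc.le (apex x).1]
    congr 1
    ext q
    simp only [belowParaboloid, mem_ofPred_eq]
    constructor <;> intro <;> linarith
  have hlaw := (hζ.poisson _ hbm).map_eq
  have e := lintegral_map (μ := P) (f := ({0} : Set ℝ≥0∞).indicator (1 : ℝ≥0∞ → ℝ≥0∞))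
    (measurable_one.indicator (measurableSet_singleton 0)) (hζ.measurable_apply hbm)
  rw [← e, hlaw, lintegral_indicator_one (measurableSet_singleton 0),
    poissonLaw_singleton_zero (by rw [hvoid]; exact ENNReal.ofReal_ne_top), hvoid,
    ENNReal.toReal_ofReal (by positivity)]

end AlmostSure

end

noncomputable section

/-! ### Change of variables -/

section ChangeOfVariables

lemma lintegral_pi_fin_succ {X : Type*} [MeasurableSpace X] (k : ℕ) (μ : Fin (k + 1) → Measure X)
    [∀ i, SigmaFinite (μ i)] {f : (Fin (k + 1) → X) → ℝ≥0∞} (hf : Measurable f) :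
    ∫⁻ x, f x ∂Measure.pi μ =
      ∫⁻ a, ∫⁻ y, f (Fin.cons a y) ∂(Measure.pi fun i => μ i.succ) ∂μ 0 := by
  have hpi := (measurePreserving_piFinSuccAbove μ 0).symm
  have hfm : Measurable fun q => f ((MeasurableEquiv.piFinSuccAbove (fun _ => X) 0).symm q) :=
    hf.comp (MeasurableEquiv.measurable _)
  rw [← hpi.map_eq, lintegral_map_equiv, lintegral_prod _ hfm.aemeasurable]
  refine lintegral_congr fun x => lintegral_congr fun y => ?_
  congr 1
  exact Fin.insertNth_zero' x y

lemma lintegral_pi_prod {X : Type*} [MeasurableSpace X] (k : ℕ) (μ : Fin k → Measure X)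
    [∀ i, SigmaFinite (μ i)] {f : Fin k → X → ℝ≥0∞} (hf : ∀ i, Measurable (f i)) :
    ∫⁻ x, ∏ i, f i (x i) ∂Measure.pi μ = ∏ i, ∫⁻ a, f i a ∂μ i := by
  induction k with
  | zero => simp
  | succ k ih =>
    have hfm : Measurable fun x : Fin (k + 1) → X => ∏ i, f i (x i) :=
      Finset.measurable_prod _ fun i _ => (hf i).comp (measurable_pi_apply i)
    rw [lintegral_pi_fin_succ k μ hfm]
    simp only [Fin.prod_univ_succ, Fin.cons_zero, Fin.cons_succ]
    have hm : Measurable fun y : Fin k → X => ∏ i, f i.succ (y i) :=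
      Finset.measurable_prod _ fun i _ => (hf i.succ).comp (measurable_pi_apply i)
    simp only [lintegral_const_mul _ hm, ih (fun i => μ i.succ) fun i => hf i.succ]
    rw [lintegral_mul_const _ (hf 0)]

lemma pi_withDensity {X : Type*} [MeasurableSpace X] (k : ℕ) (μ : Measure X) [SigmaFinite μ]
    {ρ : X → ℝ≥0∞} (hρ : Measurable ρ) [SigmaFinite (μ.withDensity ρ)] :
    Measure.pi (fun _ : Fin k => μ.withDensity ρ) =
      (Measure.pi fun _ : Fin k => μ).withDensity fun x => ∏ i, ρ (x i) := by
  refine Measure.pi_eq fun s hs => ?_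
  rw [withDensity_apply _ (MeasurableSet.univ_pi hs), Measure.restrict_pi_pi,
    lintegral_pi_prod k _ fun _ => hρ]
  simp only [withDensity_apply _ (hs _)]

lemma lintegral_affine_change {ι : Type*} [Fintype ι] [DecidableEq ι] {M : Matrix ι ι ℝ}
    (hM : M.det ≠ 0) (b : ι → ℝ) {f : (ι → ℝ) → ℝ≥0∞} (hf : Measurable f) :
    ∫⁻ h, f h = ENNReal.ofReal |M.det| * ∫⁻ u, f (M.mulVec u - b) := by
  have hfb : Measurable fun h => f (h - b) := hf.comp (measurable_id.sub_const b)
  have hlin : Measurable (Matrix.toLin' M) := (LinearMap.continuous_on_pi _).measurable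
  have h1 := lintegral_map (μ := volume) hfb hlin
  rw [Real.map_matrix_volume_pi_eq_smul_volume_pi hM, lintegral_smul_measure, smul_eq_mul,
    lintegral_sub_right_eq_self f b] at h1
  simp only [Matrix.toLin'_apply] at h1
  rw [← h1, ← mul_assoc, ← ENNReal.ofReal_mul (abs_nonneg _), ← abs_mul, mul_inv_cancel₀ hM]
  simp

variable {n : ℕ} {c : ℝ}

lemma apexCoord_of_affine {v : Fin (n + 1) → EuclideanSpace ℝ (Fin n)}
    (hv : (edgeMatrix v).det ≠ 0) (u : Fin (n + 1) → ℝ) :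
    apexCoord (fun i => (v i, (liftMatrix v).mulVec u i - ‖v i‖ ^ 2)) = u := by
  have hdet : IsUnit (liftMatrix v).det := by
    rw [det_liftMatrix]
    exact isUnit_iff_ne_zero.2 (mul_ne_zero (by positivity) hv)
  simp only [apexCoord, add_sub_cancel]
  change (liftMatrix v)⁻¹.mulVec ((liftMatrix v).mulVec u) = u
  rw [Matrix.mulVec_mulVec, Matrix.nonsing_inv_mul _ hdet, Matrix.one_mulVec]

/-- This is the height at `v i` of the paraboloid with the apex encoded by `u`; it makes the product
of the densities `e^(h/2)` split into a power of `e^(K/2)` and a Gaussian weight. -/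
lemma liftMatrix_mulVec_sub_norm_sq (v : Fin (n + 1) → EuclideanSpace ℝ (Fin n))
    (u : Fin (n + 1) → ℝ) (i : Fin (n + 1)) :
    (liftMatrix v).mulVec u i - ‖v i‖ ^ 2 = -(apexOfCoord u).2 - ‖v i - (apexOfCoord u).1‖ ^ 2 := by
  rw [liftMatrix_mulVec, norm_sub_sq_real, real_inner_comm]
  simp only [apexOfCoord]
  ring

lemma edgeMatrix_sub_const (v : Fin (n + 1) → EuclideanSpace ℝ (Fin n))
    (z : EuclideanSpace ℝ (Fin n)) : edgeMatrix (fun i => v i - z) = edgeMatrix v := by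
  ext i j
  simp [edgeMatrix]

/-- The passage from `u` to `(z, K)` is the shear `K = u 0 + ‖z‖²`, so it preserves volume. -/
lemma lintegral_apexOfCoord {χ : EuclideanSpace ℝ (Fin n) → ℝ≥0∞} (hχ : Measurable χ)
    {φ : ℝ → ℝ≥0∞} (hφ : Measurable φ) :
    ∫⁻ u : Fin (n + 1) → ℝ, χ (apexOfCoord u).1 * φ (-(apexOfCoord u).2) =
      (∫⁻ z, χ z) * ∫⁻ K, φ K := by
  have hm := measurable_apexOfCoord (n := n)
  have hfm : Measurable fun u : Fin (n + 1) → ℝ => χ (apexOfCoord u).1 * φ (-(apexOfCoord u).2) :=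
    (hχ.comp hm.fst).mul (hφ.comp hm.snd.neg)
  rw [volume_pi, lintegral_pi_fin_succ n _ hfm]
  simp only [apexOfCoord, Fin.tail_cons, Fin.cons_zero, neg_neg]
  rw [lintegral_lintegral_swap]
  · have : ∀ t : Fin n → ℝ, ∫⁻ a : ℝ, χ (WithLp.toLp 2 t) *
        φ (a + ‖(WithLp.toLp 2 t : EuclideanSpace ℝ (Fin n))‖ ^ 2) =
        χ (WithLp.toLp 2 t) * ∫⁻ K, φ K := by
      intro t
      rw [lintegral_const_mul _ (by fun_prop), lintegral_add_right_eq_self φ]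
    simp only [this]
    rw [lintegral_mul_const _ (by fun_prop), ← volume_pi,
      (PiLp.volume_preserving_toLp (Fin n)).lintegral_comp hχ]
  · refine Measurable.aemeasurable ?_
    fun_prop

/-- Integration with respect to `n + 1` points of the process in the coordinates given by the
apex of the paraboloid through the points. -/
theorem lintegral_pi_expIntensity (hc : 0 ≤ c)
    {G : (Fin (n + 1) → EuclideanSpace ℝ (Fin n)) → ℝ≥0∞} (hG : Measurable G)
    {χ : EuclideanSpace ℝ (Fin n) → ℝ≥0∞} (hχ : Measurable χ)
    {ψ : ℝ → ℝ≥0∞} (hψ : Measurable ψ) :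
    ∫⁻ x, {x : Fin (n + 1) → EuclideanSpace ℝ (Fin n) × ℝ |
        AffineIndependent ℝ fun i => (x i).1}.indicator
        (fun x => G (fun i => (x i).1 - (apex x).1) * χ (apex x).1 * ψ (-(apex x).2)) x
        ∂(Measure.pi fun _ => expIntensity n c) =
      ENNReal.ofReal (2 ^ n * c ^ (n + 1)) *
        ((∫⁻ z, χ z) * ∫⁻ K, ψ K * ENNReal.ofReal (Real.exp ((n + 1) * K / 2))) *
        ∫⁻ y, ENNReal.ofReal |(edgeMatrix y).det| * G y *
          ENNReal.ofReal (∏ i, Real.exp (-‖y i‖ ^ 2 / 2)) := by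
  have hap := measurable_apex (n := n)
  have hapc := measurable_apexOfCoord (n := n)
  have hdetm : Measurable fun v : Fin (n + 1) → EuclideanSpace ℝ (Fin n) => (edgeMatrix v).det :=
    continuous_det_edgeMatrix.measurable
  set f : (Fin (n + 1) → EuclideanSpace ℝ (Fin n) × ℝ) → ℝ≥0∞ :=
    {x : Fin (n + 1) → EuclideanSpace ℝ (Fin n) × ℝ |
        AffineIndependent ℝ fun i => (x i).1}.indicator
        (fun x => G (fun i => (x i).1 - (apex x).1) * χ (apex x).1 * ψ (-(apex x).2)) with hf
  have hfm : Measurable f := by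
    refine Measurable.indicator ?_ measurableSet_indep
    refine ((hG.comp ?_).mul (hχ.comp hap.fst)).mul (hψ.comp hap.snd.neg)
    exact measurable_pi_lambda _ fun i => (measurable_pi_apply i).fst.sub hap.fst
  have hρ : Measurable fun x : EuclideanSpace ℝ (Fin n) × ℝ =>
      ENNReal.ofReal (c * Real.exp (x.2 / 2)) := measurable_expIntensity_density
  have hρp : Measurable fun x : Fin (n + 1) → EuclideanSpace ℝ (Fin n) × ℝ =>
      ∏ i, ENNReal.ofReal (c * Real.exp ((x i).2 / 2)) :=
    Finset.measurable_prod _ fun i _ => hρ.comp (measurable_pi_apply i)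
  have hsf : SigmaFinite ((volume : Measure (EuclideanSpace ℝ (Fin n) × ℝ)).withDensity
    fun x => ENNReal.ofReal (c * Real.exp (x.2 / 2))) := sigmaFinite_expIntensity
  have hmp := measurePreserving_arrowProdEquivProdArrow (EuclideanSpace ℝ (Fin n)) ℝ (Fin (n + 1))
    (fun _ => volume) (fun _ => volume)
  have hmps := hmp.symm
  set H : (Fin (n + 1) → EuclideanSpace ℝ (Fin n)) × (Fin (n + 1) → ℝ) → ℝ≥0∞ := fun q =>
    ENNReal.ofReal (2 ^ n * c ^ (n + 1)) * ((χ (apexOfCoord q.2).1 *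
      (ψ (-(apexOfCoord q.2).2) *
        ENNReal.ofReal (Real.exp ((n + 1) * (-(apexOfCoord q.2).2) / 2)))) *
      (ENNReal.ofReal |(edgeMatrix fun i => q.1 i - (apexOfCoord q.2).1).det| *
        G (fun i => q.1 i - (apexOfCoord q.2).1) *
          ENNReal.ofReal (∏ i, Real.exp (-‖q.1 i - (apexOfCoord q.2).1‖ ^ 2 / 2)))) with hH
  have hsub : Measurable fun q : (Fin (n + 1) → EuclideanSpace ℝ (Fin n)) × (Fin (n + 1) → ℝ) =>
      fun i => q.1 i - (apexOfCoord q.2).1 :=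
    measurable_pi_lambda _ fun i => ((measurable_pi_apply i).comp measurable_fst).sub
      (hapc.comp measurable_snd).fst
  have hprodm : Measurable fun y : Fin (n + 1) → EuclideanSpace ℝ (Fin n) =>
      ENNReal.ofReal |(edgeMatrix y).det| * G y *
          ENNReal.ofReal (∏ i, Real.exp (-‖y i‖ ^ 2 / 2)) := by
    refine (hdetm.norm.ennreal_ofReal.mul hG).mul (Measurable.ennreal_ofReal ?_)
    fun_prop
  have hψe : Measurable fun K : ℝ => ψ K * ENNReal.ofReal (Real.exp ((n + 1) * K / 2)) := by
    fun_prop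
  have hA : Measurable fun u : Fin (n + 1) → ℝ => χ (apexOfCoord u).1 *
      (ψ (-(apexOfCoord u).2) *
        ENNReal.ofReal (Real.exp ((n + 1) * (-(apexOfCoord u).2) / 2))) :=
    (hχ.comp hapc.fst).mul (hψe.comp hapc.snd.neg)
  have hHm : Measurable H :=
    ((hA.comp measurable_snd).mul (hprodm.comp hsub)).const_mul _
  calc _ = ∫⁻ x, f x * ∏ i, ENNReal.ofReal (c * Real.exp ((x i).2 / 2))
          ∂(Measure.pi fun _ => volume) := by
        unfold expIntensity
        rw [pi_withDensity (n + 1) volume hρ, lintegral_withDensity_eq_lintegral_mul _ hρp hfm]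
        simp only [Pi.mul_apply, mul_comm]
    _ = ∫⁻ v : Fin (n + 1) → EuclideanSpace ℝ (Fin n), ∫⁻ h : Fin (n + 1) → ℝ,
          f (fun i => (v i, h i)) * ∏ i, ENNReal.ofReal (c * Real.exp (h i / 2)) := by
        have e1 := hmps.map_eq
        rw [show (Measure.pi fun _ : Fin (n + 1) =>
          (volume : Measure (EuclideanSpace ℝ (Fin n) × ℝ))) = Measure.pi fun _ =>
          (volume : Measure (EuclideanSpace ℝ (Fin n))).prod (volume : Measure ℝ) from rfl,
          ← e1, lintegral_map_equiv]
        exact lintegral_prod _ ((hfm.mul hρp).comp (MeasurableEquiv.measurable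
          (MeasurableEquiv.arrowProdEquivProdArrow (EuclideanSpace ℝ (Fin n)) ℝ
            (Fin (n + 1))).symm)).aemeasurable
    _ = ∫⁻ v : Fin (n + 1) → EuclideanSpace ℝ (Fin n), ∫⁻ u : Fin (n + 1) → ℝ, H (v, u) := by
        refine lintegral_congr fun v => ?_
        -- Degenerate positions contribute zero on both sides; for the others `h = M u - ‖v‖²` is an
        -- invertible substitution with Jacobian `2^n |det|`.
        by_cases hv : (edgeMatrix v).det = 0
        · have h1 : ∀ h : Fin (n + 1) → ℝ, f (fun i => (v i, h i)) = 0 := fun h =>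
            indicator_of_notMem (fun hi => (affineIndependent_iff_det_ne_zero v).1 hi hv) _
          have h2 : ∀ u, H (v, u) = 0 := fun u => by
            simp only [hH, edgeMatrix_sub_const, hv]
            simp
          simp [h1, h2]
        · have hdet : (liftMatrix v).det ≠ 0 := by
            rw [det_liftMatrix]
            exact mul_ne_zero (by positivity) hv
          have hfv : Measurable fun h : Fin (n + 1) → ℝ => f (fun i => (v i, h i)) *
              ∏ i, ENNReal.ofReal (c * Real.exp (h i / 2)) :=
            (hfm.mul hρp).comp (measurable_pi_lambda _ fun i =>
              measurable_const.prodMk (measurable_pi_apply i))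
          have hHv : Measurable fun u => H (v, u) :=
            hHm.comp (measurable_const.prodMk measurable_id)
          rw [lintegral_affine_change hdet (fun i => ‖v i‖ ^ 2) hfv, ← lintegral_const_mul']
          swap
          · exact ENNReal.ofReal_ne_top
          refine lintegral_congr fun u => ?_
          have hap : apex (fun i => (v i, ((liftMatrix v).mulVec u - fun i => ‖v i‖ ^ 2) i)) =
              apexOfCoord u := by
            rw [apex]
            congr 1
            exact apexCoord_of_affine hv u
          have hfeq : f (fun i => (v i, ((liftMatrix v).mulVec u - fun i => ‖v i‖ ^ 2) i)) =
              G (fun i => v i - (apexOfCoord u).1) * χ (apexOfCoord u).1 *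
                ψ (-(apexOfCoord u).2) := by
            rw [hf, indicator_of_mem
              (by exact (affineIndependent_iff_det_ne_zero v).2 hv), hap]
          rw [hfeq]
          have hprod : ∏ i, ENNReal.ofReal
              (c * Real.exp (((liftMatrix v).mulVec u - fun i => ‖v i‖ ^ 2) i / 2)) =
              ENNReal.ofReal (c ^ (n + 1)) *
              ENNReal.ofReal (Real.exp ((n + 1) * (-(apexOfCoord u).2) / 2)) *
              ENNReal.ofReal (∏ i, Real.exp (-‖v i - (apexOfCoord u).1‖ ^ 2 / 2)) := by
            rw [← ENNReal.ofReal_prod_of_nonneg (fun i _ => by positivity),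
              ← ENNReal.ofReal_mul (by positivity), ← ENNReal.ofReal_mul (by positivity)]
            congr 1
            simp only [Pi.sub_apply, liftMatrix_mulVec_sub_norm_sq]
            have : ∀ i, c * Real.exp ((-(apexOfCoord u).2 - ‖v i - (apexOfCoord u).1‖ ^ 2) / 2) =
                c * Real.exp (-(apexOfCoord u).2 / 2) *
                  Real.exp (-‖v i - (apexOfCoord u).1‖ ^ 2 / 2) := by
              intro i
              rw [mul_assoc, ← Real.exp_add]
              ring_nf
            simp only [this]
            rw [Finset.prod_mul_distrib, Finset.prod_const, Finset.card_univ, Fintype.card_fin,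
              mul_pow, ← Real.exp_nat_mul]
            congr 3
            push_cast
            ring
          rw [hprod, det_liftMatrix, abs_mul, abs_of_nonneg (by positivity : (0:ℝ) ≤ 2 ^ n),
            ENNReal.ofReal_mul (by positivity)]
          simp only [hH, edgeMatrix_sub_const]
          rw [ENNReal.ofReal_mul (by positivity)]
          ring
    _ = ∫⁻ u : Fin (n + 1) → ℝ, ∫⁻ v : Fin (n + 1) → EuclideanSpace ℝ (Fin n), H (v, u) :=
        lintegral_lintegral_swap hHm.aemeasurable
    _ = ∫⁻ u : Fin (n + 1) → ℝ, ENNReal.ofReal (2 ^ n * c ^ (n + 1)) * ((χ (apexOfCoord u).1 *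
          (ψ (-(apexOfCoord u).2) *
            ENNReal.ofReal (Real.exp ((n + 1) * (-(apexOfCoord u).2) / 2)))) *
          ∫⁻ y, ENNReal.ofReal |(edgeMatrix y).det| * G y *
            ENNReal.ofReal (∏ i, Real.exp (-‖y i‖ ^ 2 / 2))) := by
        refine lintegral_congr fun u => ?_
        simp only [hH]
        have hs : Measurable fun v : Fin (n + 1) → EuclideanSpace ℝ (Fin n) =>
            fun i => v i - (apexOfCoord u).1 := by fun_prop
        rw [lintegral_const_mul']
        · congr 1
          refine (lintegral_const_mul _ (hprodm.comp hs)).trans ?_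
          congr 1
          -- All positions are shifted by the apex; the edge determinant does not notice, and the
          -- integral ceases to depend on `u`.
          exact lintegral_sub_right_eq_self (fun y : Fin (n + 1) → EuclideanSpace ℝ (Fin n) =>
            ENNReal.ofReal |(edgeMatrix y).det| * G y *
            ENNReal.ofReal (∏ i, Real.exp (-‖y i‖ ^ 2 / 2))) (fun _ => (apexOfCoord u).1)
        · exact ENNReal.ofReal_ne_top
    _ = _ := by
        rw [lintegral_const_mul _ (hA.mul_const _), lintegral_mul_const _ hA,
          lintegral_apexOfCoord hχ hψe]
        ring

end ChangeOfVariables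

end

noncomputable section

/-! ### Moments of Gaussian determinants -/

section GaussianDeterminant

lemma measurePreserving_swap (m k : ℕ) :
    MeasurePreserving (fun (x : Fin k → Fin m → ℝ) (i : Fin m) (j : Fin k) => x j i) := by
  refine ⟨by fun_prop, ?_⟩
  symm
  refine Measure.pi_eq_generateFrom (C := fun _ : Fin m =>
    pi univ '' pi univ fun _ : Fin k => {s : Set ℝ | MeasurableSet s}) (fun _ => generateFrom_pi)
    (fun _ => isPiSystem_pi) (fun _ => Measure.FiniteSpanningSetsIn.pi
      (fun _ => (volume : Measure ℝ).toFiniteSpanningSetsIn)) ?_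
  intro s hs
  choose t ht hts using hs
  have hs : s = fun i => pi univ (t i) := funext fun i => (hts i).symm
  subst hs
  have htm : ∀ i j, MeasurableSet (t i j) := fun i j => ht i j (mem_univ j)
  rw [Measure.map_apply (by fun_prop)
    (MeasurableSet.univ_pi fun i => MeasurableSet.univ_pi fun j => htm i j)]
  have : (fun (x : Fin k → Fin m → ℝ) (i : Fin m) (j : Fin k) => x j i) ⁻¹'
      (pi univ fun i => pi univ (t i)) = pi univ fun j => pi univ fun i => t i j := by
    ext x
    simp only [mem_preimage, mem_pi, mem_univ, forall_const]
    exact forall_comm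
  rw [this]
  simp only [volume_pi, Measure.pi_pi]
  exact Finset.prod_comm

/-- The transpose of a tuple of vectors. -/
def transposeTuple {m k : ℕ} (x : Fin k → EuclideanSpace ℝ (Fin m)) :
    Fin m → EuclideanSpace ℝ (Fin k) := fun i => WithLp.toLp 2 fun j => x j i

lemma measurePreserving_transposeTuple (m k : ℕ) :
    MeasurePreserving (transposeTuple (m := m) (k := k)) := by
  have h1 : MeasurePreserving (fun (x : Fin k → EuclideanSpace ℝ (Fin m)) (j : Fin k) =>
      WithLp.ofLp (x j)) := volume_preserving_pi fun _ => PiLp.volume_preserving_ofLp (Fin m)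
  have h2 : MeasurePreserving (fun (x : Fin m → Fin k → ℝ) (i : Fin m) =>
      (WithLp.toLp 2 (x i) : EuclideanSpace ℝ (Fin k))) :=
    volume_preserving_pi fun _ => PiLp.volume_preserving_toLp (Fin k)
  exact h2.comp ((measurePreserving_swap m k).comp h1)

/-- The unnormalized Gaussian density of a tuple of vectors. -/
def gaussWeight {m k : ℕ} (x : Fin k → EuclideanSpace ℝ (Fin m)) : ℝ≥0∞ :=
  ENNReal.ofReal (∏ i, Real.exp (-‖x i‖ ^ 2 / 2))

lemma measurable_gaussWeight {m k : ℕ} : Measurable (gaussWeight (m := m) (k := k)) := by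
  unfold gaussWeight
  fun_prop

lemma gaussWeight_transposeTuple {m k : ℕ} (x : Fin k → EuclideanSpace ℝ (Fin m)) :
    gaussWeight (transposeTuple x) = gaussWeight x := by
  simp only [gaussWeight, ← Real.exp_sum, EuclideanSpace.norm_sq_eq, transposeTuple,
    ← Finset.sum_div, Finset.sum_neg_distrib]
  rw [Finset.sum_comm]

lemma gaussWeight_cons {m k : ℕ} (u : EuclideanSpace ℝ (Fin m))
    (x : Fin k → EuclideanSpace ℝ (Fin m)) :
    gaussWeight (Fin.cons u x : Fin (k + 1) → EuclideanSpace ℝ (Fin m)) =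
      ENNReal.ofReal (Real.exp (-‖u‖ ^ 2 / 2)) * gaussWeight x := by
  rw [gaussWeight, gaussWeight, Fin.prod_univ_succ, ENNReal.ofReal_mul (by positivity)]
  simp

/-- The determinant of the matrix whose rows are the given vectors. -/
def rowDet {m : ℕ} (x : Fin m → EuclideanSpace ℝ (Fin m)) : ℝ :=
  (Matrix.of fun i j => x i j).det

lemma continuous_rowDet {m : ℕ} : Continuous (rowDet (m := m)) := by
  refine Continuous.matrix_det (continuous_matrix fun i j => ?_)
  simp only [Matrix.of_apply]
  fun_prop

lemma rowDet_transposeTuple {m : ℕ} (x : Fin m → EuclideanSpace ℝ (Fin m)) :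
    rowDet (transposeTuple x) = rowDet x := by
  rw [rowDet, rowDet, ← Matrix.det_transpose]
  rfl

/-- The square of the determinant is the Gram determinant, which sees inner products only. -/
lemma abs_rowDet_isometry {m : ℕ}
    (O : EuclideanSpace ℝ (Fin m) ≃ₗᵢ[ℝ] EuclideanSpace ℝ (Fin m))
    (x : Fin m → EuclideanSpace ℝ (Fin m)) : |rowDet fun i => O (x i)| = |rowDet x| := by
  have hsq : ∀ x : Fin m → EuclideanSpace ℝ (Fin m), rowDet x ^ 2 =
      (Matrix.of fun i j => inner ℝ (x i) (x j)).det := by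
    intro x
    rw [rowDet, sq]
    nth_rewrite 2 [← Matrix.det_transpose]
    rw [← Matrix.det_mul]
    congr 1
    ext i j
    simp [Matrix.mul_apply, PiLp.inner_apply, mul_comm]
  rw [← sq_eq_sq_iff_abs_eq_abs, hsq, hsq]
  simp only [LinearIsometryEquiv.inner_map_map]

lemma rowDet_cons_smul_single {m : ℕ} (r : ℝ) (x : Fin m → EuclideanSpace ℝ (Fin (m + 1))) :
    rowDet (Fin.cons (r • EuclideanSpace.single 0 1) x : Fin (m + 1) → _) =
      r * rowDet (fun i => WithLp.toLp 2 fun j => x i j.succ) := by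
  rw [rowDet, Matrix.det_succ_row_zero, Fin.sum_univ_succ, Finset.sum_eq_zero]
  · simp [rowDet, Matrix.submatrix]
  · intro i _
    simp

lemma exists_isometry_map_eq {m : ℕ} (u : EuclideanSpace ℝ (Fin (m + 1))) :
    ∃ O : EuclideanSpace ℝ (Fin (m + 1)) ≃ₗᵢ[ℝ] EuclideanSpace ℝ (Fin (m + 1)),
      O u = ‖u‖ • EuclideanSpace.single 0 1 := by
  refine ⟨(ℝ ∙ (u - ‖u‖ • EuclideanSpace.single 0 1))ᗮ.reflection, ?_⟩
  refine Submodule.reflection_sub ?_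
  simp [norm_smul]

lemma lintegral_gauss_vector (m : ℕ) :
    ∫⁻ u : EuclideanSpace ℝ (Fin m), ENNReal.ofReal (Real.exp (-‖u‖ ^ 2 / 2)) =
      ENNReal.ofReal ((2 * Real.pi) ^ ((m : ℝ) / 2)) := by
  have h := lintegral_exp_neg_mul_norm_sq (V := EuclideanSpace ℝ (Fin m)) (b := 1 / 2) (by norm_num)
  rw [finrank_euclideanSpace_fin, show Real.pi / (1 / 2) = 2 * Real.pi by ring] at h
  rw [← h]
  refine lintegral_congr fun u => ?_
  ring_nf

/-- The integral of `φ (|det|)` over square matrices with independent Gaussian rows. -/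
def gaussDetIntegral (φ : ℝ → ℝ≥0∞) (m : ℕ) : ℝ≥0∞ :=
  ∫⁻ x : Fin m → EuclideanSpace ℝ (Fin m), φ |rowDet x| * gaussWeight x

/-- An isometry takes `u` to `‖u‖` times the first unit vector and leaves the Gaussian weight
unchanged. The determinant is then `‖u‖` times the minor without the first column. The
multiplicative form of `φ` covers both powers and the indicator of zero. -/
lemma lintegral_rowDet_cons {m : ℕ} {φ κ : ℝ → ℝ≥0∞} (hφ : Measurable φ)
    (hφκ : ∀ s t, 0 < s → 0 ≤ t → φ (s * t) = κ s * φ t)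
    {u : EuclideanSpace ℝ (Fin (m + 1))} (hu : u ≠ 0) (hκ : κ ‖u‖ ≠ ⊤) :
    ∫⁻ x : Fin m → EuclideanSpace ℝ (Fin (m + 1)),
        φ |rowDet (Fin.cons u x : Fin (m + 1) → _)| * gaussWeight x =
      κ ‖u‖ * (ENNReal.ofReal ((2 * Real.pi) ^ ((m : ℝ) / 2)) * gaussDetIntegral φ m) := by
  obtain ⟨O, hO⟩ := exists_isometry_map_eq u
  have hmd : Measurable (rowDet (m := m)) := continuous_rowDet.measurable
  have hmd' : Measurable (rowDet (m := m + 1)) := continuous_rowDet.measurable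
  have hrot : MeasurePreserving (fun (x : Fin m → EuclideanSpace ℝ (Fin (m + 1))) i => O (x i)) :=
    volume_preserving_pi fun _ => O.measurePreserving
  have hf : Measurable fun x : Fin m → EuclideanSpace ℝ (Fin (m + 1)) =>
      φ |rowDet (Fin.cons (‖u‖ • EuclideanSpace.single 0 1) x : Fin (m + 1) → _)| * gaussWeight x :=
    ((hφ.comp (hmd'.comp ((measurable_finCons m).comp
      (measurable_const.prodMk measurable_id))).norm).mul measurable_gaussWeight)
  have e1 : ∫⁻ x : Fin m → EuclideanSpace ℝ (Fin (m + 1)),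
      φ |rowDet (Fin.cons u x : Fin (m + 1) → _)| * gaussWeight x =
      ∫⁻ x : Fin m → EuclideanSpace ℝ (Fin (m + 1)),
      φ |rowDet (Fin.cons (‖u‖ • EuclideanSpace.single 0 1) x : Fin (m + 1) → _)| *
        gaussWeight x := by
    rw [← hrot.lintegral_comp hf]
    refine lintegral_congr fun x => ?_
    congr 1
    · rw [← abs_rowDet_isometry O, ← hO]
      congr 3
      funext i
      refine Fin.cases ?_ (fun j => ?_) i <;> simp
    · simp [gaussWeight]
  have hg : Measurable fun y : Fin (m + 1) → EuclideanSpace ℝ (Fin m) =>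
      φ |rowDet (fun i => y i.succ)| * gaussWeight y :=
    (hφ.comp (hmd.comp (measurable_pi_lambda _ fun i => measurable_pi_apply i.succ)).norm).mul
      measurable_gaussWeight
  have hgd : Measurable fun x : Fin m → EuclideanSpace ℝ (Fin m) =>
      φ |rowDet x| * gaussWeight x := (hφ.comp hmd.norm).mul measurable_gaussWeight
  have e2 : ∀ x : Fin m → EuclideanSpace ℝ (Fin (m + 1)),
      φ |rowDet (Fin.cons (‖u‖ • EuclideanSpace.single 0 1) x : Fin (m + 1) → _)| *
        gaussWeight x = κ ‖u‖ * (fun y : Fin (m + 1) → EuclideanSpace ℝ (Fin m) =>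
      φ |rowDet (fun i => y i.succ)| * gaussWeight y) (transposeTuple x) := by
    intro x
    simp only [gaussWeight_transposeTuple]
    rw [rowDet_cons_smul_single, abs_mul, abs_norm, hφκ _ _ (norm_pos_iff.2 hu) (abs_nonneg _),
      mul_assoc]
    congr 4
    rw [← rowDet_transposeTuple]
    rfl
  rw [e1]
  simp only [e2]
  -- After transposition the first vector collects the first coordinates, which the minor does not
  -- see; it integrates to `(2π)^(m/2)`.
  rw [lintegral_const_mul' _ _ hκ, (measurePreserving_transposeTuple (m + 1) m).lintegral_comp hg,
    volume_pi, lintegral_pi_fin_succ m _ hg]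
  simp only [Fin.cons_succ, gaussWeight_cons]
  have e3 : ∀ (a : EuclideanSpace ℝ (Fin m)) (y : Fin m → EuclideanSpace ℝ (Fin m)),
      φ |rowDet fun i => y i| * (ENNReal.ofReal (Real.exp (-‖a‖ ^ 2 / 2)) * gaussWeight y) =
      ENNReal.ofReal (Real.exp (-‖a‖ ^ 2 / 2)) * (φ |rowDet y| * gaussWeight y) := by
    intro a y
    ring
  simp only [e3, lintegral_const_mul _ hgd]
  rw [lintegral_mul_const _ (by fun_prop), lintegral_gauss_vector, gaussDetIntegral, volume_pi]

lemma gaussDetIntegral_succ (m : ℕ) {φ κ : ℝ → ℝ≥0∞} (hφ : Measurable φ) (hκm : Measurable κ)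
    (hφκ : ∀ s t, 0 < s → 0 ≤ t → φ (s * t) = κ s * φ t) (hκ : ∀ s, κ s ≠ ⊤) :
    gaussDetIntegral φ (m + 1) =
      (∫⁻ u : EuclideanSpace ℝ (Fin (m + 1)),
        κ ‖u‖ * ENNReal.ofReal (Real.exp (-‖u‖ ^ 2 / 2))) *
      (ENNReal.ofReal ((2 * Real.pi) ^ ((m : ℝ) / 2)) * gaussDetIntegral φ m) := by
  have hmd : Measurable (rowDet (m := m + 1)) := continuous_rowDet.measurable
  have hgd : Measurable fun x : Fin (m + 1) → EuclideanSpace ℝ (Fin (m + 1)) =>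
      φ |rowDet x| * gaussWeight x := (hφ.comp hmd.norm).mul measurable_gaussWeight
  have hw : Measurable fun u : EuclideanSpace ℝ (Fin (m + 1)) =>
      κ ‖u‖ * ENNReal.ofReal (Real.exp (-‖u‖ ^ 2 / 2)) := by fun_prop
  rw [gaussDetIntegral, volume_pi, lintegral_pi_fin_succ m _ hgd, ← lintegral_mul_const _ hw]
  refine lintegral_congr_ae ?_
  filter_upwards [Measure.ae_ne volume (0 : EuclideanSpace ℝ (Fin (m + 1)))] with u hu
  simp only [gaussWeight_cons]
  have e : ∀ y : Fin m → EuclideanSpace ℝ (Fin (m + 1)),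
      φ |rowDet (Fin.cons u y : Fin (m + 1) → EuclideanSpace ℝ (Fin (m + 1)))| *
        (ENNReal.ofReal (Real.exp (-‖u‖ ^ 2 / 2)) * gaussWeight y) =
      ENNReal.ofReal (Real.exp (-‖u‖ ^ 2 / 2)) *
        (φ |rowDet (Fin.cons u y : Fin (m + 1) → EuclideanSpace ℝ (Fin (m + 1)))| *
          gaussWeight y) := by
    intro y
    ring
  simp only [e]
  rw [lintegral_const_mul' _ _ ENNReal.ofReal_ne_top, ← volume_pi,
    lintegral_rowDet_cons hφ hφκ hu (hκ _)]
  ring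

lemma gaussDetIntegral_zero (φ : ℝ → ℝ≥0∞) : gaussDetIntegral φ 0 = φ 1 := by
  rw [gaussDetIntegral, volume_pi, Measure.pi_of_empty _ Fin.elim0]
  simp [rowDet, gaussWeight]

/-- Bordering the transposed points by a row of ones reduces a Gaussian simplex to a square matrix
with one fixed row, of norm `√(n + 1)`, and otherwise Gaussian rows. -/
lemma abs_det_edgeMatrix_eq {n : ℕ} (y : Fin (n + 1) → EuclideanSpace ℝ (Fin n)) :
    (edgeMatrix y).det = rowDet (Fin.cons (WithLp.toLp 2 fun _ => 1) (transposeTuple y) :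
      Fin (n + 1) → EuclideanSpace ℝ (Fin (n + 1))) := by
  have h1 := det_liftMatrix y
  have h2 : liftMatrix y = Matrix.of fun i j => (Fin.cons 1 fun _ => 2 : Fin (n + 1) → ℝ) j *
      (Matrix.of fun i j => (Fin.cons (WithLp.toLp 2 fun _ => 1) (transposeTuple y) :
      Fin (n + 1) → EuclideanSpace ℝ (Fin (n + 1))) i j).transpose i j := by
    ext i j
    refine Fin.cases ?_ (fun j => ?_) j <;> simp [liftMatrix, transposeTuple]
  rw [h2, Matrix.det_mul_row, Matrix.det_transpose, Fin.prod_univ_succ] at h1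
  simp only [Fin.cons_zero, Fin.cons_succ, Finset.prod_const, Finset.card_univ, Fintype.card_fin,
    one_mul] at h1
  exact (mul_left_cancel₀ (by positivity) h1).symm

lemma lintegral_edgeMatrix {n : ℕ} {φ κ : ℝ → ℝ≥0∞} (hφ : Measurable φ)
    (hφκ : ∀ s t, 0 < s → 0 ≤ t → φ (s * t) = κ s * φ t) (hκ : ∀ s, κ s ≠ ⊤) :
    ∫⁻ y : Fin (n + 1) → EuclideanSpace ℝ (Fin n), φ |(edgeMatrix y).det| * gaussWeight y =
      κ √(n + 1) * (ENNReal.ofReal ((2 * Real.pi) ^ ((n : ℝ) / 2)) * gaussDetIntegral φ n) := by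
  have hmd' : Measurable (rowDet (m := n + 1)) := continuous_rowDet.measurable
  set u : EuclideanSpace ℝ (Fin (n + 1)) := WithLp.toLp 2 fun _ => 1 with hu
  have hnorm : ‖u‖ = √(n + 1) := by
    rw [EuclideanSpace.norm_eq]
    simp [hu]
  have hu0 : u ≠ 0 := by
    rw [← norm_pos_iff, hnorm]
    positivity
  have hf : Measurable fun x : Fin n → EuclideanSpace ℝ (Fin (n + 1)) =>
      φ |rowDet (Fin.cons u x : Fin (n + 1) → _)| * gaussWeight x :=
    ((hφ.comp (hmd'.comp ((measurable_finCons n).comp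
      (measurable_const.prodMk measurable_id))).norm).mul measurable_gaussWeight)
  rw [← hnorm, ← lintegral_rowDet_cons hφ hφκ hu0 (hκ _),
    ← (measurePreserving_transposeTuple n (n + 1)).lintegral_comp hf]
  refine lintegral_congr fun y => ?_
  rw [gaussWeight_transposeTuple, abs_det_edgeMatrix_eq]

/-- Take the indicator of `{0}` for `φ` and `1` for `κ`: the recursion ends at the empty
determinant, which is `1`, so the integral is zero; the Gaussian weight is positive. -/
lemma ae_det_edgeMatrix_ne_zero (n : ℕ) :
    ∀ᵐ y : Fin (n + 1) → EuclideanSpace ℝ (Fin n), (edgeMatrix y).det ≠ 0 := by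
  set φ : ℝ → ℝ≥0∞ := ({0} : Set ℝ).indicator 1 with hφdef
  have hφ : Measurable φ := measurable_one.indicator (measurableSet_singleton 0)
  have hφκ : ∀ s t : ℝ, 0 < s → 0 ≤ t → φ (s * t) = (fun _ => 1 : ℝ → ℝ≥0∞) s * φ t := by
    intro s t hs _
    by_cases ht : t = 0
    · simp [ht]
    · rw [hφdef, indicator_of_notMem (by simp [ht, hs.ne']), indicator_of_notMem (by simp [ht])]
      simp
  have h0 : ∀ m, gaussDetIntegral φ m = 0 := by
    intro m
    induction m with
    | zero => rw [gaussDetIntegral_zero]; simp [hφdef]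
    | succ m ih =>
      rw [gaussDetIntegral_succ m hφ measurable_const hφκ (by simp), ih]
      simp
  have h := lintegral_edgeMatrix (n := n) hφ hφκ (by simp)
  rw [h0, mul_zero, mul_zero] at h
  have hm : Measurable fun y : Fin (n + 1) → EuclideanSpace ℝ (Fin n) =>
      φ |(edgeMatrix y).det| * gaussWeight y :=
    (hφ.comp continuous_det_edgeMatrix.measurable.norm).mul measurable_gaussWeight
  rw [lintegral_eq_zero_iff hm] at h
  filter_upwards [h] with y hy hdet
  have hpos : gaussWeight y ≠ 0 := by
    rw [gaussWeight]
    simp only [ne_eq, ENNReal.ofReal_eq_zero, not_le]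
    positivity
  simp [hdet, hφdef, hpos] at hy

/-- Polar coordinates reduce it to a Gamma integral; the second Gamma value comes from the volume of
the unit ball. -/
lemma lintegral_norm_rpow_gauss (k : ℕ) (hk : 0 < k) {p : ℝ} (hp : 0 ≤ p) :
    ∫⁻ u : EuclideanSpace ℝ (Fin k),
        ENNReal.ofReal (‖u‖ ^ p) * ENNReal.ofReal (Real.exp (-‖u‖ ^ 2 / 2)) =
      ENNReal.ofReal ((2 * Real.pi) ^ ((k : ℝ) / 2) * 2 ^ (p / 2) *
        (Real.Gamma ((k + p) / 2) / Real.Gamma (k / 2))) := by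
  have : Nonempty (Fin k) := ⟨⟨0, hk⟩⟩
  have : Nontrivial (EuclideanSpace ℝ (Fin k)) := inferInstance
  have hk' : (0 : ℝ) < k := by exact_mod_cast hk
  have hG1 : 0 < Real.Gamma ((k + p) / 2) := Real.Gamma_pos_of_pos (by positivity)
  have hG2 : 0 < Real.Gamma ((k : ℝ) / 2) := Real.Gamma_pos_of_pos (by positivity)
  have hval : ∫ u : EuclideanSpace ℝ (Fin k), ‖u‖ ^ p * Real.exp (-‖u‖ ^ 2 / 2) =
      (2 * Real.pi) ^ ((k : ℝ) / 2) * 2 ^ (p / 2) *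
        (Real.Gamma ((k + p) / 2) / Real.Gamma (k / 2)) := by
    rw [integral_fun_norm_addHaar volume (fun r => r ^ p * Real.exp (-r ^ 2 / 2)),
      finrank_euclideanSpace_fin]
    have hintg : ∫ y in Ioi (0 : ℝ), y ^ (k - 1) • (y ^ p * Real.exp (-y ^ 2 / 2)) =
        ∫ y in Ioi (0 : ℝ), y ^ ((k : ℝ) - 1 + p) * Real.exp (-(1 / 2) * y ^ (2 : ℝ)) := by
      refine setIntegral_congr_fun measurableSet_Ioi fun y hy => ?_
      have hy : (0 : ℝ) < y := hy
      simp only [smul_eq_mul]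
      rw [Real.rpow_add hy, ← mul_assoc, ← Real.rpow_natCast y (k - 1), Nat.cast_sub hk]
      norm_num
      ring_nf
      exact Or.inl trivial
    rw [hintg, integral_rpow_mul_exp_neg_mul_rpow (by norm_num) (by linarith) (by norm_num)]
    rw [Measure.real, EuclideanSpace.volume_ball, Fintype.card_fin, ENNReal.ofReal_one, one_pow,
      one_mul, ENNReal.toReal_ofReal (by positivity), Real.Gamma_add_one (by positivity),
      show (k : ℝ) - 1 + p + 1 = k + p by ring, nsmul_eq_mul, smul_eq_mul,
      show √Real.pi ^ k = Real.pi ^ ((k : ℝ) / 2) by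
        rw [Real.sqrt_eq_rpow, ← Real.rpow_natCast, ← Real.rpow_mul Real.pi_pos.le]; ring_nf,
      Real.mul_rpow (by norm_num) Real.pi_pos.le]
    have h2 : ((1 : ℝ) / 2) ^ (-(k + p) / 2) = 2 ^ ((k : ℝ) / 2) * 2 ^ (p / 2) := by
      rw [one_div, Real.inv_rpow (by norm_num), ← Real.rpow_neg (by norm_num),
        ← Real.rpow_add (by norm_num)]
      ring_nf
    rw [h2]
    field_simp
  have hintg : Integrable fun u : EuclideanSpace ℝ (Fin k) => ‖u‖ ^ p * Real.exp (-‖u‖ ^ 2 / 2) := by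
    refine not_imp_comm.1 integral_undef ?_
    rw [hval]
    positivity
  rw [← hval, ofReal_integral_eq_lintegral_ofReal hintg
    (Filter.Eventually.of_forall fun u => by simp only [Pi.zero_apply]; positivity)]
  refine lintegral_congr fun u => ?_
  rw [ENNReal.ofReal_mul (by positivity)]

lemma gaussDetIntegral_rpow {p : ℝ} (hp : 0 ≤ p) (m : ℕ) :
    gaussDetIntegral (fun t => ENNReal.ofReal (t ^ p)) m =
      ENNReal.ofReal ((2 * Real.pi) ^ ((m : ℝ) ^ 2 / 2) * 2 ^ (m * p / 2) *
        ∏ j ∈ Finset.Icc 1 m, Real.Gamma ((j + p) / 2) / Real.Gamma ((j : ℝ) / 2)) := by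
  induction m with
  | zero => rw [gaussDetIntegral_zero]; simp
  | succ m ih =>
    have hm : Measurable fun t : ℝ => ENNReal.ofReal (t ^ p) := by fun_prop
    rw [gaussDetIntegral_succ m hm hm (fun s t hs ht => by
      rw [Real.mul_rpow hs.le ht, ENNReal.ofReal_mul (by positivity)]) (by simp), ih,
      lintegral_norm_rpow_gauss (m + 1) (Nat.succ_pos m) hp]
    have hpos : ∀ j ∈ Finset.Icc 1 m, 0 ≤ Real.Gamma ((j + p) / 2) / Real.Gamma ((j : ℝ) / 2) := by
      intro j _
      exact div_nonneg (Real.Gamma_nonneg_of_nonneg (by positivity))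
        (Real.Gamma_nonneg_of_nonneg (by positivity))
    have hG1 : 0 ≤ Real.Gamma (((m + 1 : ℕ) + p) / 2) := Real.Gamma_nonneg_of_nonneg (by positivity)
    have hG2 : 0 ≤ Real.Gamma (((m + 1 : ℕ) : ℝ) / 2) := Real.Gamma_nonneg_of_nonneg (by positivity)
    rw [← ENNReal.ofReal_mul (by positivity), ← ENNReal.ofReal_mul (by positivity)]
    congr 1
    rw [Finset.prod_Icc_succ_top (by omega)]
    -- The exponents add up by `(m + 1)² = (m + 1) + m + m²`.
    have e1 : (2 * Real.pi) ^ (((m + 1 : ℕ) : ℝ) ^ 2 / 2) =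
        (2 * Real.pi) ^ (((m + 1 : ℕ) : ℝ) / 2) *
        (2 * Real.pi) ^ ((m : ℝ) / 2) * (2 * Real.pi) ^ ((m : ℝ) ^ 2 / 2) := by
      rw [← Real.rpow_add (by positivity), ← Real.rpow_add (by positivity)]
      congr 1
      push_cast
      ring
    have e2 : (2 : ℝ) ^ (((m + 1 : ℕ) : ℝ) * p / 2) = 2 ^ (p / 2) * 2 ^ (m * p / 2) := by
      rw [← Real.rpow_add (by positivity)]
      congr 1
      push_cast
      ring
    rw [e1, e2]
    ring

/-- The moments of the volume of a Gaussian simplex. -/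
theorem lintegral_edgeMatrix_rpow {p : ℝ} (hp : 0 ≤ p) (n : ℕ) :
    ∫⁻ y : Fin (n + 1) → EuclideanSpace ℝ (Fin n),
        ENNReal.ofReal (|(edgeMatrix y).det| ^ p) * gaussWeight y =
      ENNReal.ofReal (((n : ℝ) + 1) ^ (p / 2) * (2 * Real.pi) ^ ((n : ℝ) * (n + 1) / 2) *
        2 ^ (n * p / 2) *
        ∏ j ∈ Finset.Icc 1 n, Real.Gamma ((j + p) / 2) / Real.Gamma ((j : ℝ) / 2)) := by
  have hm : Measurable fun t : ℝ => ENNReal.ofReal (t ^ p) := by fun_prop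
  have h := lintegral_edgeMatrix (n := n) (κ := fun t => ENNReal.ofReal (t ^ p)) hm
    (fun s t hs ht => by rw [Real.mul_rpow hs.le ht, ENNReal.ofReal_mul (by positivity)]) (by simp)
  rw [h, gaussDetIntegral_rpow hp, ← ENNReal.ofReal_mul (by positivity),
    ← ENNReal.ofReal_mul (by positivity)]
  congr 1
  have e1 : √((n : ℝ) + 1) ^ p = ((n : ℝ) + 1) ^ (p / 2) := by
    rw [Real.sqrt_eq_rpow, ← Real.rpow_mul (by positivity)]
    ring_nf
  have e2 : (2 * Real.pi) ^ ((n : ℝ) * (n + 1) / 2) = (2 * Real.pi) ^ ((n : ℝ) / 2) *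
      (2 * Real.pi) ^ ((n : ℝ) ^ 2 / 2) := by
    rw [← Real.rpow_add (by positivity)]
    ring_nf
  rw [e1, e2]
  ring

end GaussianDeterminant

end

noncomputable section

/-! ### The normalizing constants -/

section Normalization

variable {n : ℕ}

/-- The convex hull of finitely many points, as a non-empty compact set. -/
def hullCompacts (y : Fin (n + 1) → EuclideanSpace ℝ (Fin n)) :
    NonemptyCompacts (EuclideanSpace ℝ (Fin n)) where
  carrier := convexHull ℝ (range y)
  isCompact' := (finite_range y).isCompact_convexHull ℝ
  nonempty' := (range_nonempty y).convexHull

open scoped Pointwise in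
lemma exists_mem_convexHull_edist_le (x y : Fin (n + 1) → EuclideanSpace ℝ (Fin n)) :
    ∀ p ∈ convexHull ℝ (range x), ∃ q ∈ convexHull ℝ (range y), edist p q ≤ edist x y := by
  have hsub : convexHull ℝ (range x) ⊆
      convexHull ℝ (range y) + Metric.closedBall (0 : EuclideanSpace ℝ (Fin n)) (dist x y) := by
    refine convexHull_min ?_ ((convex_convexHull ℝ _).add (convex_closedBall _ _))
    rintro _ ⟨i, rfl⟩
    refine ⟨y i, subset_convexHull ℝ _ ⟨i, rfl⟩, x i - y i, ?_, by simp⟩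
    rw [mem_closedBall_zero_iff, ← dist_eq_norm]
    exact dist_le_pi_dist x y i
  intro p hp
  obtain ⟨q, hq, r, hr, rfl⟩ := hsub hp
  refine ⟨q, hq, ?_⟩
  rw [edist_dist, edist_dist]
  refine ENNReal.ofReal_le_ofReal ?_
  simpa [dist_eq_norm] using hr

/-- The hull is 1-Lipschitz in its vertices for the Hausdorff distance. Hence Borel families of
compact sets pull back to measurable sets of tuples. -/
lemma continuous_hullCompacts : Continuous (hullCompacts (n := n)) := by
  refine LipschitzWith.continuous (K := 1) fun x y => ?_
  rw [ENNReal.coe_one, one_mul]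
  refine Metric.hausdorffEDist_le_of_mem_edist (exists_mem_convexHull_edist_le x y) ?_
  rw [edist_comm]
  exact exists_mem_convexHull_edist_le y x

lemma asSets_indicator_convexHull (A : Set (NonemptyCompacts (EuclideanSpace ℝ (Fin n))))
    (y : Fin (n + 1) → EuclideanSpace ℝ (Fin n)) :
    (asSets A).indicator (1 : Set (EuclideanSpace ℝ (Fin n)) → ℝ≥0∞) (convexHull ℝ (range y)) =
      (hullCompacts ⁻¹' A).indicator 1 y := by
  have h : convexHull ℝ (range y) ∈ asSets A ↔ y ∈ hullCompacts ⁻¹' A := by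
    constructor
    · rintro ⟨K, hK, hKy⟩
      have : hullCompacts y = K := NonemptyCompacts.ext hKy.symm
      rwa [mem_preimage, this]
    · exact fun hy => ⟨hullCompacts y, hy, rfl⟩
  by_cases hy : y ∈ hullCompacts ⁻¹' A
  · rw [indicator_of_mem hy, indicator_of_mem (h.2 hy)]; rfl
  · rw [indicator_of_notMem hy, indicator_of_notMem (fun h' => hy (h.1 h'))]

lemma measurable_asSets_indicator {A : Set (NonemptyCompacts (EuclideanSpace ℝ (Fin n)))}
    (hA : MeasurableSet A) :
    Measurable fun y : Fin (n + 1) → EuclideanSpace ℝ (Fin n) =>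
      (asSets A).indicator (1 : Set (EuclideanSpace ℝ (Fin n)) → ℝ≥0∞)
        (convexHull ℝ (range y)) := by
  simp only [asSets_indicator_convexHull]
  exact measurable_one.indicator (continuous_hullCompacts.measurable hA)

lemma unitCube_eq_preimage :
    unitCube n = (MeasurableEquiv.toLp 2 (Fin n → ℝ)).symm ⁻¹' Icc 0 1 := by
  ext v
  simp only [unitCube, mem_preimage, mem_Icc, Pi.le_def, ← forall_and]
  rfl

lemma measurableSet_unitCube : MeasurableSet (unitCube n) := by
  rw [unitCube_eq_preimage]
  exact MeasurableEquiv.measurable _ measurableSet_Icc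

lemma volume_unitCube : volume (unitCube n) = 1 := by
  rw [unitCube_eq_preimage,
    (EuclideanSpace.volume_preserving_symm_measurableEquiv_toLp (Fin n)).measure_preimage_equiv,
    Real.volume_Icc_pi]
  simp

/-- The integral over the heights of the apices. -/
def heightIntegral (n : ℕ) (C : ℝ) : ℝ≥0∞ :=
  ∫⁻ K : ℝ, ENNReal.ofReal (Real.exp (-(C * Real.exp (K / 2)))) *
    ENNReal.ofReal (Real.exp ((n + 1) * K / 2))

lemma heightIntegral_pos (n : ℕ) (C : ℝ) : 0 < heightIntegral n C := by
  rw [heightIntegral, lintegral_pos_iff_support (by fun_prop)]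
  have : Function.support (fun K : ℝ => ENNReal.ofReal (Real.exp (-(C * Real.exp (K / 2)))) *
      ENNReal.ofReal (Real.exp ((n + 1) * K / 2))) = univ := by
    ext K
    simp [Real.exp_pos]
  rw [this]
  simp

/-- Finiteness is all that is needed, as the value cancels. For `K ≤ 0` the double exponential is
bounded by one; for `K > 0` it beats every exponential. -/
lemma heightIntegral_lt_top (n : ℕ) {C : ℝ} (hC : 0 < C) : heightIntegral n C < ⊤ := by
  -- From `e^x ≥ x^(n+2) / (n+2)!` at `x = C e^(K/2)`; the power `n + 2` exceeds the growth `n + 1`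
  -- by one and leaves the decay `e^(-K/2)`.
  let M : ℝ := (n + 2).factorial / C ^ (n + 2)
  have hM : 0 < M := by positivity
  have hleft : IntegrableOn (fun K : ℝ => Real.exp ((n + 1 : ℝ) / 2 * K)) (Iic 0) :=
    integrableOn_exp_mul_Iic (by positivity) 0
  have hright : IntegrableOn (fun K : ℝ => M * Real.exp (-1 / 2 * K)) (Ioi 0) :=
    (integrableOn_exp_mul_Ioi (by norm_num) 0).const_mul M
  have hbound : ∀ K : ℝ, Real.exp (-(C * Real.exp (K / 2))) * Real.exp ((n + 1) * K / 2) ≤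
      M * Real.exp (-1 / 2 * K) := fun K => by
    have h := Real.pow_div_factorial_le_exp (C * Real.exp (K / 2)) (by positivity) (n + 2)
    have hpow : Real.exp (K / 2) ^ (n + 2) * Real.exp (-1 / 2 * K) =
        Real.exp ((n + 1) * K / 2) := by
      rw [← Real.exp_nat_mul, ← Real.exp_add]
      congr 1
      push_cast
      ring
    rw [← hpow, Real.exp_neg, inv_mul_le_iff₀ (Real.exp_pos _), ← mul_assoc]
    refine mul_le_mul_of_nonneg_right ?_ (Real.exp_pos _).le
    rw [mul_pow, div_le_iff₀ (by positivity)] at h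
    simp only [M]
    rw [mul_div_assoc', le_div_iff₀ (by positivity)]
    linarith
  rw [heightIntegral, ← lintegral_add_compl _ (measurableSet_Iic (a := (0 : ℝ))), compl_Iic]
  refine ENNReal.add_lt_top.2 ⟨?_, ?_⟩
  · refine lt_of_le_of_lt (setLIntegral_mono (by fun_prop) fun K _ => ?_)
      hleft.lintegral_lt_top
    rw [← ENNReal.ofReal_mul (Real.exp_pos _).le]
    refine ENNReal.ofReal_le_ofReal ?_
    rw [show (n + 1 : ℝ) / 2 * K = (n + 1) * K / 2 by ring]
    refine mul_le_of_le_one_left (Real.exp_pos _).le (Real.exp_le_one_iff.2 ?_)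
    have := Real.exp_pos (K / 2)
    nlinarith
  · refine lt_of_le_of_lt (setLIntegral_mono (by fun_prop) fun K _ => ?_)
      hright.lintegral_lt_top
    rw [← ENNReal.ofReal_mul (Real.exp_pos _).le]
    exact ENNReal.ofReal_le_ofReal (hbound K)

lemma simplexVolume_eq (y : Fin (n + 1) → EuclideanSpace ℝ (Fin n)) :
    simplexVolume (d := n + 1) y = |(edgeMatrix y).det| / n.factorial := by
  rw [simplexVolume, Measure.real]
  erw [volume_convexHull_range y]
  rw [ENNReal.toReal_ofReal (by positivity)]

lemma alphaHat_pos (n : ℕ) {ν : ℝ} (hν : -1 ≤ ν) : 0 < alphaHat (n + 1) ν := by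
  have h : 0 < ∏ j ∈ Finset.Icc 1 (n + 1 - 1),
      Real.Gamma ((j : ℝ) / 2) / Real.Gamma (((j : ℝ) + ν + 1) / 2) := by
    refine Finset.prod_pos fun j hj => ?_
    have hj : (1 : ℝ) ≤ j := by exact_mod_cast (Finset.mem_Icc.1 hj).1
    exact div_pos (Real.Gamma_pos_of_pos (by linarith)) (Real.Gamma_pos_of_pos (by linarith))
  unfold alphaHat
  positivity

/-- The bracket is the Gaussian moment of order `ν + 1` from `lintegral_edgeMatrix_rpow`; this is
the normalization of the density. -/
lemma alphaHat_mul_eq_one (n : ℕ) {ν : ℝ} (hν : -1 ≤ ν) :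
    alphaHat (n + 1) ν / (n.factorial : ℝ) ^ (ν + 1) *
      (((n : ℝ) + 1) ^ ((ν + 1) / 2) * (2 * Real.pi) ^ ((n : ℝ) * (n + 1) / 2) *
        2 ^ ((n : ℝ) * (ν + 1) / 2) *
        ∏ j ∈ Finset.Icc 1 n, Real.Gamma ((j + (ν + 1)) / 2) / Real.Gamma (j / 2)) = 1 := by
  have hprod : (∏ j ∈ Finset.Icc 1 n,
      Real.Gamma ((j : ℝ) / 2) / Real.Gamma (((j : ℝ) + ν + 1) / 2)) *
      ∏ j ∈ Finset.Icc 1 n, Real.Gamma ((j + (ν + 1)) / 2) / Real.Gamma (j / 2) = 1 := by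
    rw [← Finset.prod_mul_distrib]
    refine Finset.prod_eq_one fun j hj => ?_
    have hj : (1 : ℝ) ≤ j := by exact_mod_cast (Finset.mem_Icc.1 hj).1
    have h1 : Real.Gamma ((j : ℝ) / 2) ≠ 0 := (Real.Gamma_pos_of_pos (by linarith)).ne'
    have h2 : Real.Gamma ((j + (ν + 1)) / 2) ≠ 0 := (Real.Gamma_pos_of_pos (by linarith)).ne'
    rw [add_assoc]
    field_simp
  have htwo : (2 : ℝ) ^ ((n : ℝ) * (n + 1 + ν + 1) / 2) =
      2 ^ ((n : ℝ) * (n + 1) / 2) * 2 ^ ((n : ℝ) * (ν + 1) / 2) := by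
    rw [← Real.rpow_add two_pos]
    congr 1
    ring
  have hpi : Real.pi ^ (((n : ℝ) + 1) * n / 2) = Real.pi ^ ((n : ℝ) * (n + 1) / 2) := by
    rw [mul_comm ((n : ℝ) + 1)]
  unfold alphaHat
  simp only [Nat.add_sub_cancel, Nat.cast_add, Nat.cast_one, add_sub_cancel_right]
  rw [htwo, hpi, Real.mul_rpow zero_le_two Real.pi_pos.le]
  set Q := ∏ j ∈ Finset.Icc 1 n, Real.Gamma ((j : ℝ) / 2) / Real.Gamma (((j : ℝ) + ν + 1) / 2)
  set R := ∏ j ∈ Finset.Icc 1 n, Real.Gamma ((j + (ν + 1)) / 2) / Real.Gamma ((j : ℝ) / 2)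
  have hf : (n.factorial : ℝ) ^ (ν + 1) ≠ 0 := by positivity
  have h1 : ((n : ℝ) + 1) ^ ((ν + 1) / 2) ≠ 0 := by positivity
  have h2 : (2 : ℝ) ^ ((n : ℝ) * (n + 1) / 2) ≠ 0 := by positivity
  have h3 : (2 : ℝ) ^ ((n : ℝ) * (ν + 1) / 2) ≠ 0 := by positivity
  have h4 : Real.pi ^ ((n : ℝ) * (n + 1) / 2) ≠ 0 := by positivity
  generalize (n.factorial : ℝ) ^ (ν + 1) = a at *
  generalize ((n : ℝ) + 1) ^ ((ν + 1) / 2) = b at *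
  generalize (2 : ℝ) ^ ((n : ℝ) * (n + 1) / 2) = e at *
  generalize (2 : ℝ) ^ ((n : ℝ) * (ν + 1) / 2) = f at *
  generalize Real.pi ^ ((n : ℝ) * (n + 1) / 2) = g at *
  field_simp
  exact hprod

lemma simplexDensity_eq (ν : ℝ) (y : Fin (n + 1) → EuclideanSpace ℝ (Fin n)) :
    simplexDensity (n + 1) ν y = alphaHat (n + 1) ν / (n.factorial : ℝ) ^ (ν + 1) *
      (|(edgeMatrix y).det| ^ (ν + 1) * ∏ i, Real.exp (-‖y i‖ ^ 2 / 2)) := by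
  rw [simplexDensity, simplexVolume_eq, Real.div_rpow (abs_nonneg _) (by positivity)]
  ring_nf

lemma lintegral_simplexDensity (n : ℕ) {ν : ℝ} (hν : -1 ≤ ν) :
    ∫⁻ y : Fin (n + 1) → EuclideanSpace ℝ (Fin n),
      ENNReal.ofReal (simplexDensity (n + 1) ν y) = 1 := by
  have ha := alphaHat_pos n hν
  have hconst : 0 ≤ alphaHat (n + 1) ν / (n.factorial : ℝ) ^ (ν + 1) := by positivity
  have hm : Measurable fun y : Fin (n + 1) → EuclideanSpace ℝ (Fin n) =>
      ENNReal.ofReal (|(edgeMatrix y).det| ^ (ν + 1)) * gaussWeight y :=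
    ((continuous_det_edgeMatrix.measurable.norm).pow_const _).ennreal_ofReal.mul
      measurable_gaussWeight
  calc ∫⁻ y : Fin (n + 1) → EuclideanSpace ℝ (Fin n), ENNReal.ofReal (simplexDensity (n + 1) ν y)
      = ∫⁻ y : Fin (n + 1) → EuclideanSpace ℝ (Fin n),
        ENNReal.ofReal (alphaHat (n + 1) ν / (n.factorial : ℝ) ^ (ν + 1)) *
          (ENNReal.ofReal (|(edgeMatrix y).det| ^ (ν + 1)) * gaussWeight y) := by
        refine lintegral_congr fun y => ?_
        rw [simplexDensity_eq, ENNReal.ofReal_mul hconst, ENNReal.ofReal_mul (by positivity),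
          gaussWeight]
    _ = 1 := by
        rw [lintegral_const_mul _ hm, lintegral_edgeMatrix_rpow (by linarith) n,
          ← ENNReal.ofReal_mul hconst, alphaHat_mul_eq_one n hν, ENNReal.ofReal_one]

end Normalization

/-! ### The law of the typical cell -/

section TypicalCell

variable {n : ℕ} {c ν : ℝ} {Ω : Type*} [MeasurableSpace Ω] {P : Measure Ω}
  {ζ : Ω → Measure (EuclideanSpace ℝ (Fin n) × ℝ)} [IsProbabilityMeasure P]

/-- The Jacobian supplies one power of the determinant and the weight supplies `ν`. A degenerate
tuple must be excluded: for `ν = -1` it makes the left side `0` and the right side positive. -/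
lemma det_mul_volume_rpow_eq (hν : -1 ≤ ν) {y : Fin (n + 1) → EuclideanSpace ℝ (Fin n)}
    (hy : (edgeMatrix y).det ≠ 0) :
    ENNReal.ofReal |(edgeMatrix y).det| * volume (convexHull ℝ (range y)) ^ ν *
        ENNReal.ofReal (∏ i, Real.exp (-‖y i‖ ^ 2 / 2)) =
      ENNReal.ofReal (n.factorial / alphaHat (n + 1) ν) *
        ENNReal.ofReal (simplexDensity (n + 1) ν y) := by
  have ha := alphaHat_pos n hν
  have hd : 0 < |(edgeMatrix y).det| := abs_pos.2 hy
  have hf : (0 : ℝ) < n.factorial := by positivity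
  rw [volume_convexHull_range, ENNReal.ofReal_rpow_of_pos (by positivity),
    ← ENNReal.ofReal_mul hd.le, ← ENNReal.ofReal_mul (by positivity),
    ← ENNReal.ofReal_mul (by positivity), simplexDensity_eq,
    Real.div_rpow hd.le hf.le, Real.rpow_add_one hd.ne', Real.rpow_add_one hf.ne']
  congr 1
  have : (n.factorial : ℝ) ^ ν ≠ 0 := by positivity
  field_simp

/-- The constant that relates the intensity of dual points to the simplex density. -/
def cellConstant (n : ℕ) (c ν : ℝ) : ℝ≥0∞ :=
  ENNReal.ofReal (2 ^ n * c ^ (n + 1)) * heightIntegral n (2 * c * (2 * Real.pi) ^ ((n : ℝ) / 2)) *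
    ENNReal.ofReal (n.factorial / alphaHat (n + 1) ν)

lemma cellConstant_pos (hc : 0 < c) (hν : -1 ≤ ν) : 0 < cellConstant n c ν := by
  have ha := alphaHat_pos n hν
  refine ENNReal.mul_pos (ENNReal.mul_pos ?_ (heightIntegral_pos _ _).ne').ne' ?_
  · exact (ENNReal.ofReal_pos.2 (by positivity)).ne'
  · exact (ENNReal.ofReal_pos.2 (by positivity)).ne'

lemma cellConstant_lt_top (hc : 0 < c) : cellConstant n c ν < ⊤ :=
  ENNReal.mul_lt_top (ENNReal.mul_lt_top ENNReal.ofReal_lt_top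
    (heightIntegral_lt_top n (by positivity))) ENNReal.ofReal_lt_top

/-- The cell relative to its dual point is the hull of the differences to the apex, so position,
height and shape separate. All dependence on the intensity sits in `cellConstant`, which is the same
for every `H`. -/
theorem IsPoissonPointProcess.lintegral_tsum_centredCell (hn : 0 < n) (hc : 0 < c) (hν : -1 ≤ ν)
    (hζ : IsPoissonPointProcess P ζ (expIntensity n c))
    {H : Set (EuclideanSpace ℝ (Fin n)) → ℝ≥0∞}
    (hH : Measurable fun y : Fin (n + 1) → EuclideanSpace ℝ (Fin n) => H (convexHull ℝ (range y))) :
    ((n + 1).factorial : ℝ≥0∞) * ∫⁻ ω, ∑' p : dualPoints (points (ζ ω)),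
      H (centredCell (points (ζ ω)) p.1) *
        (unitCube n).indicator 1 p.1.1 * volume (centredCell (points (ζ ω)) p.1) ^ ν ∂P =
      cellConstant n c ν * ∫⁻ y : Fin (n + 1) → EuclideanSpace ℝ (Fin n),
        H (convexHull ℝ (range y)) *
          ENNReal.ofReal (simplexDensity (n + 1) ν y) := by
  let G : (Fin (n + 1) → EuclideanSpace ℝ (Fin n)) → ℝ≥0∞ := fun y =>
    H (convexHull ℝ (range y)) * volume (convexHull ℝ (range y)) ^ ν
  let χ : EuclideanSpace ℝ (Fin n) → ℝ≥0∞ := (unitCube n).indicator 1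
  let ψ : ℝ → ℝ≥0∞ := fun K =>
    ENNReal.ofReal (Real.exp (-(2 * c * (2 * Real.pi) ^ ((n : ℝ) / 2) * Real.exp (K / 2))))
  have hG : Measurable G := by
    refine hH.mul (Measurable.pow_const ?_ _)
    simp only [volume_convexHull_range]
    exact (continuous_det_edgeMatrix.measurable.norm.div_const _).ennreal_ofReal
  have hχ : Measurable χ := measurable_one.indicator measurableSet_unitCube
  have hψ : Measurable ψ := by fun_prop
  have hdiff : Measurable fun x : Fin (n + 1) → EuclideanSpace ℝ (Fin n) × ℝ =>
      fun i => (x i).1 - (apex x).1 :=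
    measurable_pi_lambda _ fun i =>
      (measurable_fst.comp (measurable_pi_apply i)).sub (measurable_fst.comp measurable_apex)
  have hg : Measurable fun x : Fin (n + 1) → EuclideanSpace ℝ (Fin n) × ℝ =>
      G (fun i => (x i).1 - (apex x).1) * χ (apex x).1 :=
    (hG.comp hdiff).mul (hχ.comp (measurable_fst.comp measurable_apex))
  rw [hζ.lintegral_tsum_dualPoints hc hg (fun ω p =>
    H (centredCell (points (ζ ω)) p) *
        (unitCube n).indicator 1 p.1 * volume (centredCell (points (ζ ω)) p) ^ ν)
    (fun ω hω x hx => by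
      rw [hx.centredCell_eq hn hω]
      simp only [G, χ]
      ring)]
  have hcov := lintegral_pi_expIntensity hc.le hG hχ hψ
  simp only [ψ] at hcov
  refine hcov.trans ?_
  rw [show ∫⁻ z, χ z = 1 by
    rw [lintegral_indicator_one measurableSet_unitCube, volume_unitCube], one_mul]
  rw [cellConstant, mul_assoc (ENNReal.ofReal (2 ^ n * c ^ (n + 1)) * _), 
    ← lintegral_const_mul' (ENNReal.ofReal (n.factorial / alphaHat (n + 1) ν)) _
      ENNReal.ofReal_ne_top]
  congr 1
  refine lintegral_congr_ae ?_
  filter_upwards [ae_det_edgeMatrix_ne_zero n] with y hy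
  rw [mul_left_comm (ENNReal.ofReal (n.factorial / alphaHat (n + 1) ν)),
    ← det_mul_volume_rpow_eq hν hy]
  simp only [G]
  ring

theorem IsPoissonPointProcess.factorial_mul_cellIntensity (hn : 0 < n) (hc : 0 < c)
    (hν : -1 ≤ ν) (hζ : IsPoissonPointProcess P ζ (expIntensity n c)) :
    ((n + 1).factorial : ℝ≥0∞) * cellIntensity P ζ ν = cellConstant n c ν := by
  have h := hζ.lintegral_tsum_centredCell hn hc hν (H := fun _ => 1) measurable_const
  simpa only [cellIntensity, one_mul, lintegral_simplexDensity n hν, mul_one] using h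

theorem IsPoissonPointProcess.cellIntensity_pos (hn : 0 < n) (hc : 0 < c) (hν : -1 ≤ ν)
    (hζ : IsPoissonPointProcess P ζ (expIntensity n c)) : 0 < cellIntensity P ζ ν := by
  have h := hζ.factorial_mul_cellIntensity hn hc hν
  refine pos_iff_ne_zero.2 fun h0 => (cellConstant_pos (n := n) hc hν).ne' ?_
  rw [← h, h0, mul_zero]

theorem IsPoissonPointProcess.cellIntensity_lt_top (hn : 0 < n) (hc : 0 < c) (hν : -1 ≤ ν)
    (hζ : IsPoissonPointProcess P ζ (expIntensity n c)) : cellIntensity P ζ ν < ⊤ := by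
  have h := hζ.factorial_mul_cellIntensity hn hc hν
  refine lt_top_iff_ne_top.2 fun h0 => (cellConstant_lt_top (n := n) (ν := ν) hc).ne ?_
  rw [← h, h0, ENNReal.mul_top (by exact_mod_cast (n + 1).factorial_ne_zero)]

/-- Divide the formula for the indicator of `A` by the formula for `H = 1`, whose shape integral is
`1`; the constant, being positive and finite, cancels. -/
theorem IsPoissonPointProcess.typicalCellLaw_eq (hn : 0 < n) (hc : 0 < c) (hν : -1 ≤ ν)
    (hζ : IsPoissonPointProcess P ζ (expIntensity n c))
    {A : Set (NonemptyCompacts (EuclideanSpace ℝ (Fin n)))} (hA : MeasurableSet A) :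
    typicalCellLaw P ζ ν A = ∫⁻ y : Fin (n + 1) → EuclideanSpace ℝ (Fin n),
      (asSets A).indicator 1 (convexHull ℝ (range y)) *
        ENNReal.ofReal (simplexDensity (n + 1) ν y) := by
  have h := hζ.lintegral_tsum_centredCell hn hc hν (measurable_asSets_indicator hA)
  rw [← hζ.factorial_mul_cellIntensity hn hc hν, mul_assoc] at h
  have hfac : ((n + 1).factorial : ℝ≥0∞) ≠ 0 := by exact_mod_cast (n + 1).factorial_ne_zero
  rw [typicalCellLaw, (ENNReal.mul_right_inj hfac (ENNReal.natCast_ne_top _)).1 h, ← mul_assoc,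
    ENNReal.inv_mul_cancel (hζ.cellIntensity_pos hn hc hν).ne'
      (hζ.cellIntensity_lt_top hn hc hν).ne, one_mul]

end TypicalCell

end

end GaussianDelaunay

/-! ### The main theorem -/

theorem theorem5p1 (d : ℕ) (hd : 2 ≤ d) (ν : ℝ) (hν : -1 ≤ ν) (γ : ℝ) (hγ : 0 < γ)
    {Ω : Type*} [MeasurableSpace Ω] (P : Measure Ω) [IsProbabilityMeasure P]
    (ζ : Ω → Measure (EuclideanSpace ℝ (Fin (d - 1)) × ℝ))
    (hζ : GaussianDelaunay.IsPoissonPointProcess P ζ (GaussianDelaunay.gaussianIntensity d γ)) :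
    0 < GaussianDelaunay.cellIntensity P ζ ν ∧
    GaussianDelaunay.cellIntensity P ζ ν < ⊤ ∧
    IsProbabilityMeasure ((volume : Measure (Fin d → EuclideanSpace ℝ (Fin (d - 1)))).withDensity
      fun y => ENNReal.ofReal (GaussianDelaunay.simplexDensity d ν y)) ∧
    ∀ A : Set (NonemptyCompacts (EuclideanSpace ℝ (Fin (d - 1)))), MeasurableSet A →
      GaussianDelaunay.typicalCellLaw P ζ ν A =
        ∫⁻ y : Fin d → EuclideanSpace ℝ (Fin (d - 1)),
          (GaussianDelaunay.asSets A).indicator 1 (convexHull ℝ (range y)) *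
            ENNReal.ofReal (GaussianDelaunay.simplexDensity d ν y) := by
  obtain ⟨n, rfl⟩ : ∃ n, d = n + 1 := ⟨d - 1, by omega⟩
  have hn : 0 < n := by omega
  -- The prefactor of the intensity plays the role of `c`. Its exponent is `d / 2 = (n + 1) / 2`,
  -- not `n / 2`, but only positivity matters.
  have hc : 0 < γ / (2 * Real.pi) ^ (((n + 1 : ℕ) : ℝ) / 2) := by positivity
  have hζ' : GaussianDelaunay.IsPoissonPointProcess P ζ (GaussianDelaunay.expIntensity n
    (γ / (2 * Real.pi) ^ (((n + 1 : ℕ) : ℝ) / 2))) := hζ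
  refine ⟨hζ'.cellIntensity_pos hn hc hν, hζ'.cellIntensity_lt_top hn hc hν, ⟨?_⟩,
    fun A hA => hζ'.typicalCellLaw_eq hn hc hν hA⟩
  rw [withDensity_apply _ MeasurableSet.univ, Measure.restrict_univ]
  exact GaussianDelaunay.lintegral_simplexDensity n hν
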